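/- Let $\varepsilon>0$, $\lambda\in C^2([0,1];[0,\infty))$, $\bar\lambda=\max_{[0,1]}\lambda$ and $q>\frac{\bar\lambda}{2\varepsilon}+\frac12$. Consider the plant $$u_t=\varepsilon u_{xx}+\lambda(x)u,\qquad u_x(0,t)=0,\qquad u_x(1,t)+q\,u(1,t)=U(t),\qquad x\in[0,1].$$ Let $k$ be the backstepping kernel, i.e. the $C^2$ solution on $\mathcal T=\{0\le y\le x\le 1\}$ of $k_{xx}-k_{yy}=\frac{\lambda(y)}{\varepsilon}k$, $k_y(x,0)=0$, $k(x,x)=-\frac1{2\varepsilon}\int_0^x\lambda(y)\,dy$. A (neural-operator) approximate kernel of accuracy $\iota>0$ is a function $\hat k\in C^2(\mathcal T)$ such that, with $\tilde k=k-\hat k$, $$|\tilde k(x,y)|+\Big|2\tfrac{d}{dx}\tilde k(x,x)\Big|+\big|(\partial_{xx}-\partial_{yy})\tilde k(x,y)-\lambda(y)\tilde k(x,y)\big|<\iota\quad\text{for all }(x,y)\in\mathcal T,$$ and such that the gain $\hat K(y)=\wp\,\hat k(1,y)+\hat k_x(1,y)$, $\wp=q-\frac1{2\varepsilon}\int_0^1\lambda$,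 is $C^2$ on $[0,1]$. Put $$\epsilon_1=4\varepsilon^2\hat K(1)^2,\quad \epsilon_2=4\int_0^1\big(\varepsilon\hat K''+\varepsilon\hat K(1)\hat K+\lambda\hat K\big)^2dy,\quad \epsilon_3=4\big(\varepsilon q\hat K(1)+\varepsilon\hat K'(1)\big)^2,\quad \epsilon_4=4\varepsilon^2\hat K'(0)^2 .$$ Event-triggered closed loop, with positive parameters $\eta,\xi,\kappa_1,\kappa_2,\kappa_3,\lambda_d$: $t_0=0$; from the event time $t_j$ on, the plant runs with the constant input $U_d=\int_0^1\hat K(y)u(y,t_j)\,dy$. With $d(t)=\int_0^1\hat K(y)\,(u(y,t)-u(y,t_j))\,dy$ and the continuous variable $m$ satisfying, between events, $$\dot m=-\eta m+\lambda_d d^2-\kappa_1\|u[t]\|^2-\kappa_2u(1,t)^2-\kappa_3u(0,t)^2,\qquad m(0)<0,$$ there is no further event if $d(t)^2>-\xi m(t)$ holds for no $t>t_j$ (under the input held since $t_j$); otherwise $t_{j+1}=\inf\{t>t_j:\ d(t)^2\ge-\xi m(t)\}$. Here $\|u[t]\|$ is the $L^2(0,1)$ norm of $u(\cdot,t)$.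 Solutions are continuous in time with values in $L^2(0,1)$, and between events they satisfy the plant equations classically. Let $\Omega(t)=\|u[t]\|^2+|m(t)|$, $a=\frac{2\bar\lambda}{\varepsilon}e^{4\bar\lambda/\varepsilon}$, $$\Upsilon=\big(1+(\iota+a)^2\big)\big(1+(a+\iota)^2e^{2a+2\iota}\big),$$ $$\sigma^*(\iota,\bar\lambda)=\frac{\varepsilon}{8}-4\iota\big(1+(a+\iota)e^{a+\iota}\big)-\varepsilon\iota\Big(2(a+\iota)^2e^{2a+2\iota}+\frac52\Big),\qquad \sigma=\min\{\eta,\sigma^*(\iota,\bar\lambda)\},$$ $$\tau=\int_0^1\frac{ds}{\bar n_3+\bar n_2s+\bar n_1s^2},\qquad \bar n_1=\tfrac12\lambda_d\xi,\quad \bar n_2=1+\epsilon_1+\xi\lambda_d+\eta,\quad \bar n_3=1+\eta+\epsilon_1+\tfrac12\xi\lambda_d .$$ There is $\iota^*>0$, depending only on $\varepsilon,q,\bar\lambda$, such that for every accuracy $\iota\in(0,\iota^*)$ and every approximate kernel $\hat k$ of accuracy $\iota$ there is $\bar\kappa>0$ with the following property. Let $\eta,\xi,\kappa_1,\kappa_2,\kappa_3>0$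 satisfy $\kappa_1\ge 2\epsilon_2/\xi$, $\kappa_2\ge2\epsilon_3/\xi$, $\kappa_3\ge2\epsilon_4/\xi$. Then: 1. (No Zeno behavior.) For all $\lambda_d>0$, $u[0]\in L^2(0,1)$ and $m(0)<0$, one has $\tau>0$ and, for every event time $t_j$, $t_{j+1}-t_j>\tau$ (with $t_{j+1}=\infty$ if there is no further event). In particular the event times do not accumulate and the closed-loop solution covers all $t\ge0$. 2. (Exponential convergence.) There are $\lambda_d^*>0$ and $C>0$ such that for all $\lambda_d\ge\lambda_d^*$, $u[0]\in L^2(0,1)$ and $m(0)<0$: $\Omega(t)\le C\,\Omega(0)\,e^{-\sigma t}$ for all $t\ge0$; and if moreover $\kappa_1,\kappa_2,\kappa_3\le\bar\kappa$ (which can always be arranged, by taking $\xi$ large), then $$\Omega(t)\le\Upsilon\,\Omega(0)\,e^{-\sigma t}\qquad\text{for all }t\ge0 .$$ -/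

import Mathlib

open Set Filter Topology MeasureTheory

noncomputable section

/-- The closed triangle `0 ≤ y ≤ x ≤ 1`. -/
def kernelTriangle : Set (ℝ × ℝ) := {p | 0 ≤ p.2 ∧ p.2 ≤ p.1 ∧ p.1 ≤ 1}

/-- `k` is the backstepping kernel of the coefficient `lam`: the `C²` solution on the triangle of
`k_xx - k_yy = (lam(y) / ε) k`, `k_y(x, 0) = 0`, `k(x, x) = -(1 / (2 ε)) ∫_0^x lam`.
A `C²` function on the closed triangle is represented by a `C²` extension to the plane; only
its values on the triangle matter. -/
structure IsBacksteppingKernel (ε : ℝ) (lam : ℝ → ℝ) (k : ℝ → ℝ → ℝ) : Prop where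
  contDiff : ContDiff ℝ 2 (Function.uncurry k)
  pde : ∀ x y : ℝ, (x, y) ∈ kernelTriangle →
    iteratedDeriv 2 (fun s => k s y) x - iteratedDeriv 2 (fun s => k x s) y
      = lam y / ε * k x y
  bottom : ∀ x ∈ Icc (0 : ℝ) 1, deriv (fun s => k x s) 0 = 0
  diagonal : ∀ x ∈ Icc (0 : ℝ) 1, k x x = -(1 / (2 * ε)) * ∫ y in (0 : ℝ)..x, lam y

/-- `kh` approximates the kernel `k` with accuracy `ι` on the triangle, in the sense in which
the neural operator approximates the kernel operator. -/
structure IsKernelApprox (lam : ℝ → ℝ) (k kh : ℝ → ℝ → ℝ) (ι : ℝ) : Prop where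
  contDiff : ContDiff ℝ 2 (Function.uncurry kh)
  accuracy : ∀ x y : ℝ, (x, y) ∈ kernelTriangle →
    |k x y - kh x y| + |2 * deriv (fun s => k s s - kh s s) x|
      + |iteratedDeriv 2 (fun s => k s y - kh s y) x
          - iteratedDeriv 2 (fun s => k x s - kh x s) y
          - lam y * (k x y - kh x y)| < ι

/-- `℘ = q - (1 / (2 ε)) ∫_0^1 lam`. -/
def robinGain (ε q : ℝ) (lam : ℝ → ℝ) : ℝ := q - 1 / (2 * ε) * ∫ y in (0 : ℝ)..1, lam y

/-- The control gain `K̂(y) = ℘ k̂(1, y) + k̂_x(1, y)`. -/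
def controlGain (ε q : ℝ) (lam : ℝ → ℝ) (kh : ℝ → ℝ → ℝ) (y : ℝ) : ℝ :=
  robinGain ε q lam * kh 1 y + deriv (fun x => kh x y) 1

/-- First derivative on `[0, 1]` (one-sided at the end points). -/
def gainDeriv (K : ℝ → ℝ) (y : ℝ) : ℝ := derivWithin K (Icc 0 1) y

/-- Second derivative on `[0, 1]` (one-sided at the end points). -/
def gainDeriv2 (K : ℝ → ℝ) (y : ℝ) : ℝ := derivWithin (gainDeriv K) (Icc 0 1) y

/-- `ϵ₁`, as a function of the gain `K`. -/
def eps1 (ε : ℝ) (K : ℝ → ℝ) : ℝ := 4 * ε ^ 2 * K 1 ^ 2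

/-- `ϵ₂`, as a function of the gain `K`. -/
def eps2 (ε : ℝ) (lam K : ℝ → ℝ) : ℝ :=
  4 * ∫ y in (0 : ℝ)..1, (ε * gainDeriv2 K y + ε * K 1 * K y + lam y * K y) ^ 2

/-- `ϵ₃`, as a function of the gain `K`. -/
def eps3 (ε q : ℝ) (K : ℝ → ℝ) : ℝ := 4 * (ε * q * K 1 + ε * gainDeriv K 1) ^ 2

/-- `ϵ₄`, as a function of the gain `K`. -/
def eps4 (ε : ℝ) (K : ℝ → ℝ) : ℝ := 4 * ε ^ 2 * gainDeriv K 0 ^ 2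

/-- The squared `L²(0, 1)` norm of a profile. -/
def normSq (f : ℝ → ℝ) : ℝ := ∫ x in (0 : ℝ)..1, f x ^ 2

/-- The feedback `∫_0^1 K(y) f(y) dy` of a profile `f`. -/
def feedback (K f : ℝ → ℝ) : ℝ := ∫ y in (0 : ℝ)..1, K y * f y

/-- The parameters of the dynamic event trigger. -/
structure TriggerParams where
  η : ℝ
  ξ : ℝ
  κ₁ : ℝ
  κ₂ : ℝ
  κ₃ : ℝ
  lamd : ℝ

/-- `v` (time first, space second) solves, for `t ≥ a`, the plant
`v_t = ε v_xx + lam v`, `v_x(0, t) = 0`, `v_x(1, t) + q v(1, t) = U` with the constant input `U`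
and initial profile `v a ∈ L²(0, 1)`: it is continuous in time with values in `L²(0, 1)` on
`[a, ∞)`, and a classical solution on `(a, ∞) × [0, 1]`. -/
structure IsHeldSolution (ε q : ℝ) (lam : ℝ → ℝ) (a U : ℝ) (v : ℝ → ℝ → ℝ) : Prop where
  memLp : ∀ t, a ≤ t → MemLp (v t) 2 (volume.restrict (Icc (0 : ℝ) 1))
  continuous_L2 : ∀ t, a ≤ t →
    Tendsto (fun s => normSq (fun x => v s x - v t x)) (𝓝[Ici a] t) (𝓝 0)
  classical : ∃ vt vx vxx : ℝ → ℝ → ℝ,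
    ContinuousOn (Function.uncurry v) (Ioi a ×ˢ Icc (0 : ℝ) 1) ∧
    ContinuousOn (Function.uncurry vt) (Ioi a ×ˢ Icc (0 : ℝ) 1) ∧
    ContinuousOn (Function.uncurry vx) (Ioi a ×ˢ Icc (0 : ℝ) 1) ∧
    ContinuousOn (Function.uncurry vxx) (Ioi a ×ˢ Icc (0 : ℝ) 1) ∧
    ∀ t, a < t →
      (∀ x ∈ Icc (0 : ℝ) 1,
        HasDerivAt (fun s => v s x) (vt t x) t ∧
        HasDerivWithinAt (v t) (vx t x) (Icc 0 1) x ∧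
        HasDerivWithinAt (vx t) (vxx t x) (Icc 0 1) x ∧
        vt t x = ε * vxx t x + lam x * v t x) ∧
      vx t 0 = 0 ∧ vx t 1 + q * v t 1 = U

/-- The input deviation `d(t) = ∫_0^1 K(y) (v(y, t) - v(y, a)) dy` for the input held since
time `a`. -/
def deviation (K : ℝ → ℝ) (a : ℝ) (v : ℝ → ℝ → ℝ) (t : ℝ) : ℝ :=
  feedback K (fun y => v t y - v a y)

/-- The dynamic variable `μ` of the trigger for `t ≥ a`, driven by the state `v`. -/
structure IsHeldTrigger (P : TriggerParams) (K : ℝ → ℝ) (a : ℝ) (v : ℝ → ℝ → ℝ)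
    (μ : ℝ → ℝ) : Prop where
  continuousOn : ContinuousOn μ (Ici a)
  ode : ∀ t, a < t → HasDerivAt μ
    (-P.η * μ t + P.lamd * deviation K a v t ^ 2 - P.κ₁ * normSq (v t)
      - P.κ₂ * v t 1 ^ 2 - P.κ₃ * v t 0 ^ 2) t

open Classical in
/-- The event that follows the one at time `a`: no further event (`⊤`) if `d² > -ξ μ` never holds
after `a`, and otherwise the infimum of the times `t > a` with `d(t)² ≥ -ξ μ(t)`. -/
def nextEvent (ξ a : ℝ) (d μ : ℝ → ℝ) : EReal :=
  if ∃ t, a < t ∧ d t ^ 2 > -ξ * μ t then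
    ((sInf {t : ℝ | a < t ∧ d t ^ 2 ≥ -ξ * μ t} : ℝ) : EReal)
  else ⊤

/-- `(u, m)` is a trajectory of the closed loop with event times `t 0 = 0, t 1, …`, where
`t j = ⊤` means that there are fewer than `j + 1` events. From each event time `a = t j` on, the
plant runs with the constant input `∫_0^1 K(y) u(y, a) dy`; the next event time is read off this
evolution `(v, μ)`, and `(u, m)` follows it up to that time. (Values of `u` and `m` after an
accumulation point of the event times, should there be one, are not constrained.) -/
structure IsClosedLoop (ε q : ℝ) (lam K : ℝ → ℝ) (P : TriggerParams)
    (t : ℕ → EReal) (u : ℝ → ℝ → ℝ) (m : ℝ → ℝ) : Prop where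
  start : t 0 = 0
  step : ∀ (j : ℕ) (a : ℝ), t j = (a : EReal) → ∃ (v : ℝ → ℝ → ℝ) (μ : ℝ → ℝ),
    IsHeldSolution ε q lam a (feedback K (u a)) v ∧
    IsHeldTrigger P K a v μ ∧
    t (j + 1) = nextEvent P.ξ a (deviation K a v) μ ∧
    ∀ s : ℝ, a ≤ s → (s : EReal) ≤ t (j + 1) →
      m s = μ s ∧ ∀ x ∈ Icc (0 : ℝ) 1, u s x = v s x
  noMore : ∀ j : ℕ, t j = ⊤ → t (j + 1) = ⊤

/-- The dwell time `τ = ∫_0^1 ds / (n₃ + n₂ s + n₁ s²)` with `n₁ = lamd ξ / 2`,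
`n₂ = 1 + ϵ₁ + ξ lamd + η`, `n₃ = 1 + η + ϵ₁ + ξ lamd / 2`. -/
def dwellTime (ε : ℝ) (K : ℝ → ℝ) (P : TriggerParams) : ℝ :=
  ∫ s in (0 : ℝ)..1,
    1 / ((1 + P.η + eps1 ε K + 1 / 2 * P.ξ * P.lamd)
      + (1 + eps1 ε K + P.ξ * P.lamd + P.η) * s
      + (1 / 2 * P.lamd * P.ξ) * s ^ 2)

/-- `Ω(t) = ‖u[t]‖² + |m(t)|`. -/
def Omega (u : ℝ → ℝ → ℝ) (m : ℝ → ℝ) (t : ℝ) : ℝ := normSq (u t) + |m t|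

/-- The bound `(2 L / ε) exp (4 L / ε)` on the kernel, where `L = max |lam|`. -/
def kernelBound (ε L : ℝ) : ℝ := 2 * L / ε * Real.exp (4 * L / ε)

/-- The overshoot constant `Υ`. -/
def overshoot (ε L ι : ℝ) : ℝ :=
  (1 + (ι + kernelBound ε L) ^ 2) *
    (1 + (kernelBound ε L + ι) ^ 2
      * Real.exp (4 * L / ε * Real.exp (4 * L / ε) + 2 * ι))

/-- The rate `σ*(ι, L)`. -/
def sigmaStar (ε L ι : ℝ) : ℝ :=
  ε / 8
    - 4 * ι * (1 + (kernelBound ε L + ι) * Real.exp (kernelBound ε L + ι))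
    - ε * ι * (2 * (kernelBound ε L + ι) ^ 2
        * Real.exp (4 * L / ε * Real.exp (4 * L / ε) + 2 * ι) + 5 / 2)

end

/-!
The kernel of the plant is the *exact* backstepping kernel `k`; the approximate kernel enters only
through the gain, hence only through the right boundary condition of the transformed state. So the
Lyapunov function is built from `k`: with `z = u - ∫_0^x k(x, y) u(y) dy`, the plant becomes the heat
equation for `z`, with `z_x(0) = 0` and
`z_x(1) = -℘ z(1) - (gain error applied to u) - (input deviation d)`, where `℘ > 1/2`.

* *Gain error* (`IsNeumannProfile.sq_gainError_le`). Write `e = k - kh`. The gain error contains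
  `e_x(1, ·)`, which the accuracy does not bound. But `e_x + e_y` is bounded by integrating
  `e_xx - e_yy` along a characteristic from the diagonal, and the remaining `e_y(1, ·)` is integrated
  by parts against `u`. So the error is at most a multiple of the accuracy times the `H¹` norm of `u`,
  and the dissipation absorbs it.

* *Overshoot* (`exists_isLyapunovTransform`). For small accuracy, `Υ` is near `1 + O((L / ε)²)`,
  where the condition number of `u ↦ z` would only be bounded by `1 + O(L / ε)`. When `L / ε ≤ 1/10`,
  the transform is therefore localised near the controlled end, `z = u - xⁿ ∫_0^x k(x, y) u(y) dy`
  with `n` of the order of `(ε / L)²`. It has the same values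
  at the end points, and the factor `xⁿ` makes the perturbation of the identity of norm
  `O((L / ε)²)`, while the terms that it adds to the energy identity stay below the dissipation. For
  larger `L / ε` the choice `n = 0` and a bound on `k` by characteristics
  (`IsBacksteppingKernel.bounds_of_bound`) are enough.

* *Decay* (`IsHeldSolution.energy_decay`). For `V = M ‖z‖² + |m|`, the dissipation of `‖z‖²`
  absorbs the `κ` terms of the trigger, and a large `λ_d` absorbs `d²`. Hence `V` decays at the rate
  `min η (ε / 8)`, which is at least `σ`, across all events, since `V` is continuous. With
  `M = A` this gives the overshoot `A B ≤ Υ` for small `κ`; with a larger `M` it gives some overshoot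
  for any `κ`.

* *Dwell time* (`IsHeldSolution.dwell`). After an event, `φ = 2 d² / (ξ |m|) - 1` rises from `-1` to at
  least `1` by the time of the next one. An integration by parts bounds `(d')²` by `ϵ₁ d²` and the terms with
  `ϵ₂, ϵ₃, ϵ₄`, which the `κ` terms dominate; so `φ' ≤ n₃ + n₂ φ + n₁ φ²` where `φ ≥ 0`. The
  integral of the reciprocal of the right side over `[0, 1]` is `τ`.
-/

/-! ### Partial derivatives and characteristic directions -/

/-- The partial derivative of `h x y` in `x`. -/
noncomputable def partialX (h : ℝ → ℝ → ℝ) (x y : ℝ) : ℝ :=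
  fderiv ℝ (Function.uncurry h) (x, y) (1, 0)

/-- The partial derivative of `h x y` in `y`. -/
noncomputable def partialY (h : ℝ → ℝ → ℝ) (x y : ℝ) : ℝ :=
  fderiv ℝ (Function.uncurry h) (x, y) (0, 1)

/-- The derivative along a straight line, in terms of the partial derivatives. -/
lemma hasDerivAt_line {h : ℝ → ℝ → ℝ} (hh : ContDiff ℝ 1 (Function.uncurry h))
    (p q α β r : ℝ) :
    HasDerivAt (fun r => h (p + α * r) (q + β * r))
      (α * partialX h (p + α * r) (q + β * r) + β * partialY h (p + α * r) (q + β * r)) r := by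
  have h1 : HasFDerivAt (Function.uncurry h)
      (fderiv ℝ (Function.uncurry h) (p + α * r, q + β * r)) (p + α * r, q + β * r) :=
    (hh.differentiable one_ne_zero _).hasFDerivAt
  have h2 : HasDerivAt (fun r : ℝ => (p + α * r, q + β * r)) (α, β) r := by
    have ha : HasDerivAt (fun r : ℝ => p + α * r) α r := by
      simpa using ((hasDerivAt_id r).const_mul α).const_add p
    have hb : HasDerivAt (fun r : ℝ => q + β * r) β r := by
      simpa using ((hasDerivAt_id r).const_mul β).const_add q
    exact ha.prodMk hb
  have h3 := h1.comp_hasDerivAt r h2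
  have h4 : ((α, β) : ℝ × ℝ) = α • ((1, 0) : ℝ × ℝ) + β • ((0, 1) : ℝ × ℝ) := by simp
  rw [h4, map_add, map_smul, map_smul] at h3
  exact h3

lemma hasDerivAt_partialX {h : ℝ → ℝ → ℝ} (hh : ContDiff ℝ 1 (Function.uncurry h))
    (x y : ℝ) : HasDerivAt (fun s => h s y) (partialX h x y) x := by
  simpa using hasDerivAt_line hh 0 y 1 0 x

lemma hasDerivAt_partialY {h : ℝ → ℝ → ℝ} (hh : ContDiff ℝ 1 (Function.uncurry h))
    (x y : ℝ) : HasDerivAt (fun s => h x s) (partialY h x y) y := by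
  simpa using hasDerivAt_line hh x 0 0 1 y

lemma hasDerivAt_diagonal {h : ℝ → ℝ → ℝ} (hh : ContDiff ℝ 1 (Function.uncurry h))
    (x : ℝ) : HasDerivAt (fun s => h s s) (partialX h x x + partialY h x x) x := by
  simpa using hasDerivAt_line hh 0 0 1 1 x

lemma contDiff_partialX {h : ℝ → ℝ → ℝ} (hh : ContDiff ℝ 2 (Function.uncurry h)) :
    ContDiff ℝ 1 (Function.uncurry (partialX h)) :=
  (hh.fderiv_right (m := 1) (by norm_num)).clm_apply contDiff_const

lemma contDiff_partialY {h : ℝ → ℝ → ℝ} (hh : ContDiff ℝ 2 (Function.uncurry h)) :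
    ContDiff ℝ 1 (Function.uncurry (partialY h)) :=
  (hh.fderiv_right (m := 1) (by norm_num)).clm_apply contDiff_const

lemma continuous_partialX {h : ℝ → ℝ → ℝ} (hh : ContDiff ℝ 1 (Function.uncurry h)) :
    Continuous (Function.uncurry (partialX h)) :=
  (hh.continuous_fderiv one_ne_zero).clm_apply continuous_const

lemma continuous_partialY {h : ℝ → ℝ → ℝ} (hh : ContDiff ℝ 1 (Function.uncurry h)) :
    Continuous (Function.uncurry (partialY h)) :=
  (hh.continuous_fderiv one_ne_zero).clm_apply continuous_const

lemma partialX_partialY_comm {h : ℝ → ℝ → ℝ} (hh : ContDiff ℝ 2 (Function.uncurry h))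
    (x y : ℝ) : partialX (partialY h) x y = partialY (partialX h) x y := by
  have hd : DifferentiableAt ℝ (fderiv ℝ (Function.uncurry h)) (x, y) :=
    (hh.fderiv_right (m := 1) (by norm_num)).differentiable one_ne_zero _
  have e (v : ℝ × ℝ) : HasFDerivAt (fun p => fderiv ℝ (Function.uncurry h) p v)
      ((fderiv ℝ (fderiv ℝ (Function.uncurry h)) (x, y)).flip v) (x, y) := by
    simpa using hd.hasFDerivAt.clm_apply (hasFDerivAt_const v (x, y))
  have hs : IsSymmSndFDerivAt ℝ (Function.uncurry h) (x, y) :=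
    hh.contDiffAt.isSymmSndFDerivAt (by simp)
  have e1 : fderiv ℝ (Function.uncurry (partialY h)) (x, y) = _ := (e (0, 1)).fderiv
  have e2 : fderiv ℝ (Function.uncurry (partialX h)) (x, y) = _ := (e (1, 0)).fderiv
  rw [partialX, partialY, e1, e2]
  exact hs.eq _ _

lemma iteratedDeriv_two_eq_partialX {h : ℝ → ℝ → ℝ} (hh : ContDiff ℝ 2 (Function.uncurry h))
    (x y : ℝ) : iteratedDeriv 2 (fun s => h s y) x = partialX (partialX h) x y := by
  have e : deriv (fun s => h s y) = fun s => partialX h s y :=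
    funext fun s => (hasDerivAt_partialX (hh.of_le (by norm_num)) s y).deriv
  rw [iteratedDeriv_succ, iteratedDeriv_one, e]
  exact (hasDerivAt_partialX (contDiff_partialX hh) x y).deriv

lemma iteratedDeriv_two_eq_partialY {h : ℝ → ℝ → ℝ} (hh : ContDiff ℝ 2 (Function.uncurry h))
    (x y : ℝ) : iteratedDeriv 2 (fun s => h x s) y = partialY (partialY h) x y := by
  have e : deriv (fun s => h x s) = fun s => partialY h x s :=
    funext fun s => (hasDerivAt_partialY (hh.of_le (by norm_num)) x s).deriv
  rw [iteratedDeriv_succ, iteratedDeriv_one, e]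
  exact (hasDerivAt_partialY (contDiff_partialY hh) x y).deriv

lemma hasDerivAt_add_partials_antidiagonal {h : ℝ → ℝ → ℝ}
    (hh : ContDiff ℝ 2 (Function.uncurry h)) (p q r : ℝ) :
    HasDerivAt (fun r => partialX h (p + r) (q - r) + partialY h (p + r) (q - r))
      (partialX (partialX h) (p + r) (q - r) - partialY (partialY h) (p + r) (q - r)) r := by
  have h1 := hasDerivAt_line (contDiff_partialX hh) p q 1 (-1) r
  have h2 := hasDerivAt_line (contDiff_partialY hh) p q 1 (-1) r
  have h3 := h1.add h2
  rw [partialX_partialY_comm hh] at h3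
  simp only [one_mul, neg_one_mul, ← sub_eq_add_neg] at h3
  refine h3.congr_deriv ?_
  ring

lemma hasDerivAt_sub_partials_diagonal {h : ℝ → ℝ → ℝ}
    (hh : ContDiff ℝ 2 (Function.uncurry h)) (p q r : ℝ) :
    HasDerivAt (fun r => partialX h (p + r) (q + r) - partialY h (p + r) (q + r))
      (partialX (partialX h) (p + r) (q + r) - partialY (partialY h) (p + r) (q + r)) r := by
  have h1 := hasDerivAt_line (contDiff_partialX hh) p q 1 1 r
  have h2 := hasDerivAt_line (contDiff_partialY hh) p q 1 1 r
  have h3 := h1.sub h2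
  rw [partialX_partialY_comm hh] at h3
  simp only [one_mul] at h3
  refine h3.congr_deriv ?_
  ring

lemma hasDerivAt_antidiagonal {h : ℝ → ℝ → ℝ}
    (hh : ContDiff ℝ 1 (Function.uncurry h)) (p q r : ℝ) :
    HasDerivAt (fun r => h (p + r) (q - r))
      (partialX h (p + r) (q - r) - partialY h (p + r) (q - r)) r := by
  simpa [← sub_eq_add_neg] using hasDerivAt_line hh p q 1 (-1) r

lemma abs_sub_le_of_abs_deriv_le {F F' B b : ℝ → ℝ} {p R : ℝ} (hR : 0 ≤ R)
    (hF : ∀ r, HasDerivAt F (F' r) r) (hB : ∀ x, HasDerivAt B (b x) x)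
    (hle : ∀ r ∈ Icc 0 R, |F' r| ≤ b (p + r)) : |F R - F 0| ≤ B (p + R) - B p := by
  have hB' (r : ℝ) : HasDerivAt (fun r => B (p + r) - B p) (b (p + r)) r := by
    simpa using ((hB (p + r)).comp_const_add p r).sub_const (B p)
  have := image_norm_le_of_norm_deriv_right_le_deriv_boundary (f := fun r => F r - F 0)
    (f' := F') (a := 0) (b := R) (B := fun r => B (p + r) - B p) (B' := fun r => b (p + r))
    (fun r _ => ((hF r).sub_const _).continuousAt.continuousWithinAt)
    (fun r _ => ((hF r).sub_const _).hasDerivWithinAt) (by simp) hB'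
    (fun r hr => hle r (Ico_subset_Icc_self hr))
  simpa using this (right_mem_Icc.2 hR)

/-- Bound for `h_x + h_y` by integrating `h_xx - h_yy` along the antidiagonal characteristic from the
diagonal. -/
lemma abs_add_partials_sub_diagonal_le {h : ℝ → ℝ → ℝ} {B b : ℝ → ℝ}
    (hh : ContDiff ℝ 2 (Function.uncurry h)) (hB : ∀ x, HasDerivAt B (b x) x)
    (hle : ∀ x y, (x, y) ∈ kernelTriangle →
      |partialX (partialX h) x y - partialY (partialY h) x y| ≤ b x)
    {x y : ℝ} (hxy : (x, y) ∈ kernelTriangle) :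
    |(partialX h x y + partialY h x y)
      - (partialX h ((x + y) / 2) ((x + y) / 2) + partialY h ((x + y) / 2) ((x + y) / 2))|
      ≤ B x - B ((x + y) / 2) := by
  obtain ⟨h1, h2, h3⟩ := hxy
  simp only at h1 h2 h3
  have := abs_sub_le_of_abs_deriv_le (p := (x + y) / 2) (R := (x - y) / 2) (by linarith)
    (hasDerivAt_add_partials_antidiagonal hh ((x + y) / 2) ((x + y) / 2)) hB
    (fun r hr => hle _ _ ⟨by simp only; linarith [hr.2], by simp only; linarith [hr.1],
      by simp only; linarith [hr.2]⟩)
  rw [show (x + y) / 2 + (x - y) / 2 = x by ring, show (x + y) / 2 - (x - y) / 2 = y by ring]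
    at this
  simpa using this

/-- Bound for `h_x - h_y` by integrating `h_xx - h_yy` along the diagonal characteristic from the
bottom edge. -/
lemma abs_sub_partials_sub_bottom_le {h : ℝ → ℝ → ℝ} {B b : ℝ → ℝ}
    (hh : ContDiff ℝ 2 (Function.uncurry h)) (hB : ∀ x, HasDerivAt B (b x) x)
    (hle : ∀ x y, (x, y) ∈ kernelTriangle →
      |partialX (partialX h) x y - partialY (partialY h) x y| ≤ b x)
    {x y : ℝ} (hxy : (x, y) ∈ kernelTriangle) :
    |(partialX h x y - partialY h x y) - (partialX h (x - y) 0 - partialY h (x - y) 0)|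
      ≤ B x - B (x - y) := by
  obtain ⟨h1, h2, h3⟩ := hxy
  simp only at h1 h2 h3
  have := abs_sub_le_of_abs_deriv_le (p := x - y) (R := y) (by linarith)
    (hasDerivAt_sub_partials_diagonal hh (x - y) 0) hB
    (fun r hr => hle _ _ ⟨by simp only; linarith [hr.1], by simp only; linarith [hr.1],
      by simp only; linarith [hr.2]⟩)
  rw [show x - y + y = x by ring] at this
  simpa using this

lemma abs_sub_diagonal_le {h : ℝ → ℝ → ℝ} {B b : ℝ → ℝ}
    (hh : ContDiff ℝ 1 (Function.uncurry h)) (hB : ∀ x, HasDerivAt B (b x) x)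
    (hle : ∀ x y, (x, y) ∈ kernelTriangle → |partialX h x y - partialY h x y| ≤ b x)
    {x y : ℝ} (hxy : (x, y) ∈ kernelTriangle) :
    |h x y - h ((x + y) / 2) ((x + y) / 2)| ≤ B x - B ((x + y) / 2) := by
  obtain ⟨h1, h2, h3⟩ := hxy
  simp only at h1 h2 h3
  have := abs_sub_le_of_abs_deriv_le (p := (x + y) / 2) (R := (x - y) / 2) (by linarith)
    (hasDerivAt_antidiagonal hh ((x + y) / 2) ((x + y) / 2)) hB
    (fun r hr => hle _ _ ⟨by simp only; linarith [hr.2], by simp only; linarith [hr.1],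
      by simp only; linarith [hr.2]⟩)
  rw [show (x + y) / 2 + (x - y) / 2 = x by ring, show (x + y) / 2 - (x - y) / 2 = y by ring]
    at this
  simpa using this

/-! ### Bounds on the backstepping kernel -/

lemma hasDerivWithinAt_integral_of_continuousOn {f : ℝ → ℝ} {a b : ℝ} (hab : a ≤ b)
    (hf : ContinuousOn f (Icc a b)) {x : ℝ} (hx : x ∈ Icc a b) :
    HasDerivWithinAt (fun x => ∫ y in a..x, f y) (f x) (Icc a b) x := by
  have hc : Continuous (IccExtend hab ((Icc a b).domRestrict f)) :=
    (continuousOn_iff_continuous_domRestrict.1 hf).Icc_extend'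
  have e (y : ℝ) (hy : y ∈ Icc a b) : IccExtend hab ((Icc a b).domRestrict f) y = f y := by
    rw [IccExtend_of_mem hab _ hy]; rfl
  have h1 := (intervalIntegral.integral_hasDerivAt_right (hc.intervalIntegrable a x)
    (hc.stronglyMeasurableAtFilter _ _) hc.continuousAt).hasDerivWithinAt (s := Icc a b)
  rw [e x hx] at h1
  refine h1.congr (fun z hz => ?_) ?_
  · refine intervalIntegral.integral_congr fun y hy => (e y ?_).symm
    rw [uIcc_of_le hz.1] at hy
    exact ⟨hy.1, hy.2.trans hz.2⟩
  · refine intervalIntegral.integral_congr fun y hy => (e y ?_).symm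
    rw [uIcc_of_le hx.1] at hy
    exact ⟨hy.1, hy.2.trans hx.2⟩

namespace IsBacksteppingKernel

variable {ε L : ℝ} {lam : ℝ → ℝ} {k : ℝ → ℝ → ℝ}

lemma partials_pde (hk : IsBacksteppingKernel ε lam k) {x y : ℝ} (h : (x, y) ∈ kernelTriangle) :
    partialX (partialX k) x y - partialY (partialY k) x y = lam y / ε * k x y := by
  rw [← iteratedDeriv_two_eq_partialX hk.contDiff, ← iteratedDeriv_two_eq_partialY hk.contDiff]
  exact hk.pde x y h

lemma partialY_bottom (hk : IsBacksteppingKernel ε lam k) {x : ℝ} (hx : x ∈ Icc (0 : ℝ) 1) :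
    partialY k x 0 = 0 := by
  exact (hasDerivAt_partialY (hk.contDiff.of_le (by norm_num)) x 0).deriv.symm.trans
    (hk.bottom x hx)

lemma add_partials_diagonal (hk : IsBacksteppingKernel ε lam k)
    (hlam : ContinuousOn lam (Icc 0 1)) {x : ℝ} (hx : x ∈ Icc (0 : ℝ) 1) :
    partialX k x x + partialY k x x = -(1 / (2 * ε)) * lam x := by
  have h1 := (hasDerivAt_diagonal (hk.contDiff.of_le (by norm_num)) x).hasDerivWithinAt
    (s := Icc 0 1)
  have h2 := ((hasDerivWithinAt_integral_of_continuousOn zero_le_one hlam hx).const_mul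
    (-(1 / (2 * ε)))).congr hk.diagonal (hk.diagonal x hx)
  exact (uniqueDiffOn_Icc zero_lt_one x hx).eq_deriv _ h1 h2

lemma abs_diagonal_le (hk : IsBacksteppingKernel ε lam k) (hε : 0 < ε)
    (h0 : ∀ x ∈ Icc (0 : ℝ) 1, 0 ≤ lam x) (hL : ∀ x ∈ Icc (0 : ℝ) 1, lam x ≤ L)
    {x : ℝ} (hx : x ∈ Icc (0 : ℝ) 1) : |k x x| ≤ L / ε / 2 * x := by
  rw [hk.diagonal x hx, neg_mul, abs_neg, abs_mul, abs_of_pos (by positivity : 0 < 1 / (2 * ε))]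
  have : ‖∫ y in (0 : ℝ)..x, lam y‖ ≤ L * |x - 0| := by
    refine intervalIntegral.norm_integral_le_of_norm_le_const fun y hy => ?_
    rw [uIoc_of_le hx.1] at hy
    have hy' : y ∈ Icc (0 : ℝ) 1 := ⟨hy.1.le, hy.2.trans hx.2⟩
    rw [Real.norm_of_nonneg (h0 y hy')]
    exact hL y hy'
  rw [sub_zero, abs_of_nonneg hx.1, Real.norm_eq_abs] at this
  calc 1 / (2 * ε) * |∫ y in (0 : ℝ)..x, lam y| ≤ 1 / (2 * ε) * (L * x) := by gcongr
    _ = L / ε / 2 * x := by field_simp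

/-- One step of the successive approximation for the kernel: a bound `φ x` on `|k x y|` yields,
by integrating the wave equation along characteristics, the bound
`L / (2 ε) x + (L / ε) ∫_0^x (x - r) φ r dr` on `|k x y|`, and a bound on `|k_x|`. -/
lemma bounds_of_bound (hk : IsBacksteppingKernel ε lam k) (hε : 0 < ε)
    (hlam : ContinuousOn lam (Icc 0 1))
    (h0 : ∀ x ∈ Icc (0 : ℝ) 1, 0 ≤ lam x) (hL : ∀ x ∈ Icc (0 : ℝ) 1, lam x ≤ L)
    {φ Φ₁ Φ₂ : ℝ → ℝ} (hφ : ∀ x y, (x, y) ∈ kernelTriangle → |k x y| ≤ φ x)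
    (hΦ₁ : ∀ x, HasDerivAt Φ₁ (L / ε * φ x) x) (hΦ₂ : ∀ x, HasDerivAt Φ₂ (Φ₁ x) x)
    (hΦ₁0 : ∀ x, 0 ≤ x → 0 ≤ Φ₁ x) (hΦ₂0 : ∀ x, 0 ≤ x → 0 ≤ Φ₂ x)
    {x y : ℝ} (hxy : (x, y) ∈ kernelTriangle) :
    |partialX k x y| ≤ L / ε / 2 + Φ₁ x ∧ |k x y| ≤ L / ε / 2 * x + Φ₂ x := by
  have hL0 : 0 ≤ L := (h0 0 (by simp)).trans (hL 0 (by simp))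
  have hf (x y : ℝ) (hxy : (x, y) ∈ kernelTriangle) :
      |partialX (partialX k) x y - partialY (partialY k) x y| ≤ L / ε * φ x := by
    have hy : y ∈ Icc (0 : ℝ) 1 := ⟨hxy.1, hxy.2.1.trans hxy.2.2⟩
    rw [hk.partials_pde hxy, abs_mul, abs_div, abs_of_nonneg (h0 y hy), abs_of_pos hε]
    have := hL y hy
    have := hφ x y hxy
    gcongr
  have hdiag (s : ℝ) (hs : s ∈ Icc (0 : ℝ) 1) :
      |partialX k s s + partialY k s s| ≤ L / ε / 2 := by
    rw [hk.add_partials_diagonal hlam hs, neg_mul, abs_neg, abs_mul,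
      abs_of_pos (by positivity : 0 < 1 / (2 * ε)), abs_of_nonneg (h0 s hs)]
    calc 1 / (2 * ε) * lam s ≤ 1 / (2 * ε) * L := by
          have := hL s hs
          gcongr
      _ = L / ε / 2 := by field_simp
  have hP (x y : ℝ) (hxy : (x, y) ∈ kernelTriangle) :
      |partialX k x y + partialY k x y| ≤ L / ε / 2 + Φ₁ x - Φ₁ ((x + y) / 2) := by
    have h1 := abs_add_partials_sub_diagonal_le hk.contDiff hΦ₁ hf hxy
    obtain ⟨ha, hb, hc⟩ := hxy
    simp only at ha hb hc
    have h2 := hdiag ((x + y) / 2) ⟨by linarith, by linarith⟩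
    rw [abs_le] at *
    constructor <;> linarith [h1.1, h1.2, h2.1, h2.2]
  have hQ (x y : ℝ) (hxy : (x, y) ∈ kernelTriangle) :
      |partialX k x y - partialY k x y| ≤ L / ε / 2 + Φ₁ x := by
    have h1 := abs_sub_partials_sub_bottom_le hk.contDiff hΦ₁ hf hxy
    obtain ⟨ha, hb, hc⟩ := hxy
    simp only at ha hb hc
    have h2 := hP (x - y) 0 ⟨le_rfl, by simpa using hb, by simp only; linarith⟩
    have h3 := hΦ₁0 ((x - y + 0) / 2) (by linarith)
    rw [hk.partialY_bottom ⟨by linarith, by linarith⟩] at h1 h2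
    rw [add_zero] at h2
    rw [abs_le] at *
    constructor <;> linarith [h1.1, h1.2, h2.1, h2.2]
  constructor
  · have h1 := hP x y hxy
    have h2 := hQ x y hxy
    have h3 := hΦ₁0 ((x + y) / 2) (by linarith [hxy.1, hxy.1.trans hxy.2.1])
    rw [abs_le] at *
    constructor <;> linarith [h1.1, h1.2, h2.1, h2.2]
  · have hB (x : ℝ) : HasDerivAt (fun x => L / ε / 2 * x + Φ₂ x) (L / ε / 2 + Φ₁ x) x := by
      simpa using ((hasDerivAt_id x).const_mul (L / ε / 2)).fun_add (hΦ₂ x)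
    have h1 := abs_sub_diagonal_le (hk.contDiff.of_le (by norm_num)) hB hQ hxy
    obtain ⟨ha, hb, hc⟩ := hxy
    simp only at ha hb hc
    have h2 := hk.abs_diagonal_le hε h0 hL (x := (x + y) / 2) ⟨by linarith, by linarith⟩
    have h3 := hΦ₂0 ((x + y) / 2) (by linarith)
    rw [abs_le] at *
    constructor <;> linarith [h1.1, h1.2, h2.1, h2.2]

lemma bounds_of_const_bound (hk : IsBacksteppingKernel ε lam k) (hε : 0 < ε)
    (hlam : ContinuousOn lam (Icc 0 1))
    (h0 : ∀ x ∈ Icc (0 : ℝ) 1, 0 ≤ lam x) (hL : ∀ x ∈ Icc (0 : ℝ) 1, lam x ≤ L)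
    {κ : ℝ} (hκ : ∀ x y, (x, y) ∈ kernelTriangle → |k x y| ≤ κ)
    {x y : ℝ} (hxy : (x, y) ∈ kernelTriangle) :
    |partialX k x y| ≤ L / ε / 2 + L / ε * κ * x ∧
      |k x y| ≤ L / ε / 2 * x + L / ε * κ * (x ^ 2 / 2) := by
  have hL0 : 0 ≤ L := (h0 0 (by simp)).trans (hL 0 (by simp))
  have hκ0 : 0 ≤ κ := (abs_nonneg _).trans (hκ 0 0 (by simp [kernelTriangle]))
  refine hk.bounds_of_bound hε hlam h0 hL hκ (Φ₁ := fun x => L / ε * κ * x)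
    (Φ₂ := fun x => L / ε * κ * (x ^ 2 / 2)) (fun x => ?_) (fun x => ?_) (fun x hx => ?_)
    (fun x hx => ?_) hxy
  · simpa using (hasDerivAt_id x).const_mul (L / ε * κ)
  · refine (((hasDerivAt_pow 2 x).div_const 2).const_mul (L / ε * κ)).congr_deriv ?_
    simp
  · positivity
  · positivity

lemma isCompact_kernelTriangle : IsCompact kernelTriangle := by
  refine (isCompact_Icc (a := ((0, 0) : ℝ × ℝ)) (b := (1, 1))).of_isClosed_subset ?_ ?_
  · exact (isClosed_le continuous_const continuous_snd).inter
      ((isClosed_le continuous_snd continuous_fst).inter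
        (isClosed_le continuous_fst continuous_const))
  · rintro ⟨x, y⟩ ⟨h1, h2, h3⟩
    simp only at h1 h2 h3
    exact ⟨⟨by simp only; linarith, h1⟩, ⟨h3, by simp only; linarith⟩⟩

/-- The best bound on the kernel of the form `M exp (β x)` is attained; inserted into
`bounds_of_bound`, it gives an inequality for `M` itself. -/
lemma exists_isMax_weighted (hk : IsBacksteppingKernel ε lam k) (β : ℝ) :
    ∃ M x₀ y₀, (x₀, y₀) ∈ kernelTriangle ∧ M * Real.exp (β * x₀) = |k x₀ y₀| ∧
      ∀ x y, (x, y) ∈ kernelTriangle → |k x y| ≤ M * Real.exp (β * x) := by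
  have hc : Continuous (fun p : ℝ × ℝ => |Function.uncurry k p| * Real.exp (-(β * p.1))) := by
    have := hk.contDiff.continuous
    fun_prop
  obtain ⟨⟨x₀, y₀⟩, h1, h2⟩ := isCompact_kernelTriangle.exists_isMaxOn
    ⟨(0, 0), by simp [kernelTriangle]⟩ hc.continuousOn
  refine ⟨|k x₀ y₀| * Real.exp (-(β * x₀)), x₀, y₀, h1, ?_, fun x y hxy => ?_⟩
  · rw [mul_assoc, ← Real.exp_add]; simp
  · have := h2 hxy
    simp only [mem_ofPred_eq, Function.uncurry_apply_pair] at this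
    calc |k x y| = |k x y| * Real.exp (-(β * x)) * Real.exp (β * x) := by
          rw [mul_assoc, ← Real.exp_add]; simp
      _ ≤ _ := by gcongr

lemma abs_le_of_small (hk : IsBacksteppingKernel ε lam k) (hε : 0 < ε)
    (hlam : ContinuousOn lam (Icc 0 1))
    (h0 : ∀ x ∈ Icc (0 : ℝ) 1, 0 ≤ lam x) (hL : ∀ x ∈ Icc (0 : ℝ) 1, lam x ≤ L)
    (hL1 : L / ε ≤ 1) {x y : ℝ} (hxy : (x, y) ∈ kernelTriangle) :
    |k x y| ≤ L / ε / 2 / (1 - L / ε / 2) := by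
  have hL0 : 0 ≤ L / ε := div_nonneg ((h0 0 (by simp)).trans (hL 0 (by simp))) hε.le
  obtain ⟨M, x₀, y₀, h1, h2, h3⟩ := hk.exists_isMax_weighted 0
  simp only [zero_mul, Real.exp_zero, mul_one] at h2 h3
  have h4 := (hk.bounds_of_const_bound hε hlam h0 hL h3 h1).2
  rw [← h2] at h4
  refine (h3 x y hxy).trans ?_
  rw [le_div_iff₀ (by linarith)]
  have hM : 0 ≤ M := h2 ▸ abs_nonneg _
  have hx1 : x₀ ≤ 1 := h1.2.2
  have hx0 : 0 ≤ x₀ := h1.1.trans h1.2.1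
  have hx2 : x₀ ^ 2 ≤ 1 := by nlinarith
  have e1 : L / ε / 2 * x₀ ≤ L / ε / 2 * 1 := by gcongr
  have e2 : L / ε * M * (x₀ ^ 2 / 2) ≤ L / ε * M * (1 / 2) := by gcongr
  linarith

lemma abs_le_of_large (hk : IsBacksteppingKernel ε lam k) (hε : 0 < ε)
    (hlam : ContinuousOn lam (Icc 0 1))
    (h0 : ∀ x ∈ Icc (0 : ℝ) 1, 0 ≤ lam x) (hL : ∀ x ∈ Icc (0 : ℝ) 1, lam x ≤ L)
    (hL1 : 1 ≤ L / ε) {x y : ℝ} (hxy : (x, y) ∈ kernelTriangle) :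
    |k x y| ≤ 9 / 16 * (L / ε) * Real.exp (3 * (L / ε)) := by
  set l := L / ε with hl
  obtain ⟨M, x₀, y₀, h1, h2, h3⟩ := hk.exists_isMax_weighted (3 * l)
  have hM : 0 ≤ M := by
    have : 0 ≤ M * Real.exp (3 * l * x₀) := h2 ▸ abs_nonneg _
    exact nonneg_of_mul_nonneg_left this (Real.exp_pos _)
  have hx0 : 0 ≤ x₀ := h1.1.trans h1.2.1
  have hexp (x : ℝ) : HasDerivAt (fun x => Real.exp (3 * l * x))
      (Real.exp (3 * l * x) * (3 * l)) x := by
    simpa using ((hasDerivAt_id x).const_mul (3 * l)).exp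
  have h4 := (hk.bounds_of_bound hε hlam h0 hL h3
    (Φ₁ := fun x => M / 3 * (Real.exp (3 * l * x) - 1))
    (Φ₂ := fun x => M / (9 * l) * (Real.exp (3 * l * x) - 1 - 3 * l * x))
    (fun x => (((hexp x).sub_const 1).const_mul (M / 3)).congr_deriv (by ring))
    (fun x => by
      have := (((hexp x).sub_const 1).sub
        ((hasDerivAt_id x).const_mul (3 * l))).const_mul (M / (9 * l))
      refine this.congr_deriv ?_
      field_simp
      ring)
    (fun x hx => by
      have := Real.one_le_exp (x := 3 * l * x) (by positivity)
      have : 0 ≤ Real.exp (3 * l * x) - 1 := by linarith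
      positivity)
    (fun x hx => by
      have := Real.add_one_le_exp (3 * l * x)
      have : 0 ≤ Real.exp (3 * l * x) - 1 - 3 * l * x := by linarith
      positivity) h1).2
  rw [← h2] at h4
  have hlx : 0 ≤ 3 * l * x₀ := by positivity
  have hx1 : x₀ ≤ Real.exp (3 * l * x₀) := by
    have := Real.add_one_le_exp (3 * l * x₀)
    nlinarith
  have e2 : M / (9 * l) * (Real.exp (3 * l * x₀) - 1 - 3 * l * x₀)
      ≤ M / 9 * Real.exp (3 * l * x₀) := by
    have : M / (9 * l) ≤ M / 9 := by gcongr; linarith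
    have h5 : 0 ≤ Real.exp (3 * l * x₀) - 1 - 3 * l * x₀ := by
      linarith [Real.add_one_le_exp (3 * l * x₀)]
    calc _ ≤ M / 9 * (Real.exp (3 * l * x₀) - 1 - 3 * l * x₀) := by gcongr
      _ ≤ _ := by gcongr; linarith
  have hM' : M ≤ 9 / 16 * l := by
    have h6 : M * Real.exp (3 * l * x₀)
        ≤ (l / 2 + M / 9) * Real.exp (3 * l * x₀) := by
      have : l / 2 * x₀ ≤ l / 2 * Real.exp (3 * l * x₀) := by gcongr
      linarith
    have := le_of_mul_le_mul_right h6 (Real.exp_pos _)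
    linarith
  refine (h3 x y hxy).trans ?_
  have hx : x ≤ 1 := hxy.2.2
  have : 3 * l * x ≤ 3 * l := by nlinarith
  gcongr

end IsBacksteppingKernel

/-! ### Square-integrable profiles on the unit interval -/

lemma ContinuousOn.memLp_Icc {f : ℝ → ℝ} (hf : ContinuousOn f (Icc 0 1)) :
    MemLp f 2 (volume.restrict (Icc (0 : ℝ) 1)) := by
  obtain ⟨C, hC⟩ := isCompact_Icc.exists_bound_of_continuousOn hf
  exact MemLp.of_bound (hf.aestronglyMeasurable measurableSet_Icc) C
    ((ae_restrict_iff' measurableSet_Icc).2 (Eventually.of_forall hC))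

lemma MemLp.intervalIntegrable_mul {f g : ℝ → ℝ}
    (hf : MemLp f 2 (volume.restrict (Icc (0 : ℝ) 1)))
    (hg : MemLp g 2 (volume.restrict (Icc (0 : ℝ) 1))) {a b : ℝ} (ha : a ∈ Icc (0 : ℝ) 1)
    (hb : b ∈ Icc (0 : ℝ) 1) : IntervalIntegrable (fun x => f x * g x) volume a b := by
  have : IntervalIntegrable (fun x => f x * g x) volume 0 1 := by
    rw [intervalIntegrable_iff_integrableOn_Icc_of_le zero_le_one]
    exact hf.integrable_mul hg
  refine this.mono_set ?_
  rw [uIcc_of_le zero_le_one]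
  exact uIcc_subset_Icc ha hb

lemma MemLp.intervalIntegrable_sq {f : ℝ → ℝ}
    (hf : MemLp f 2 (volume.restrict (Icc (0 : ℝ) 1))) {a b : ℝ} (ha : a ∈ Icc (0 : ℝ) 1)
    (hb : b ∈ Icc (0 : ℝ) 1) : IntervalIntegrable (fun x => f x ^ 2) volume a b := by
  simpa [sq] using MemLp.intervalIntegrable_mul hf hf ha hb

lemma MemLp.intervalIntegrable_Icc {f : ℝ → ℝ}
    (hf : MemLp f 2 (volume.restrict (Icc (0 : ℝ) 1))) {a b : ℝ} (ha : a ∈ Icc (0 : ℝ) 1)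
    (hb : b ∈ Icc (0 : ℝ) 1) : IntervalIntegrable f volume a b := by
  simpa using MemLp.intervalIntegrable_mul hf
    (continuousOn_const (c := (1 : ℝ))).memLp_Icc ha hb

lemma normSq_nonneg (f : ℝ → ℝ) : 0 ≤ normSq f :=
  intervalIntegral.integral_nonneg zero_le_one fun _ _ => sq_nonneg _

lemma normSq_congr {f g : ℝ → ℝ} (h : ∀ x ∈ Icc (0 : ℝ) 1, f x = g x) :
    normSq f = normSq g :=
  intervalIntegral.integral_congr fun x hx => by
    rw [uIcc_of_le zero_le_one] at hx
    simp only [h x hx]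

lemma feedback_congr {K f g : ℝ → ℝ} (h : ∀ x ∈ Icc (0 : ℝ) 1, f x = g x) :
    feedback K f = feedback K g :=
  intervalIntegral.integral_congr fun x hx => by
    rw [uIcc_of_le zero_le_one] at hx
    simp only [h x hx]

/-- The Cauchy–Schwarz inequality on an interval. -/
lemma sq_integral_mul_le {f g : ℝ → ℝ} {a b : ℝ} (hab : a ≤ b)
    (hf : IntervalIntegrable (fun x => f x ^ 2) volume a b)
    (hg : IntervalIntegrable (fun x => g x ^ 2) volume a b)
    (hfg : IntervalIntegrable (fun x => f x * g x) volume a b) :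
    (∫ x in a..b, f x * g x) ^ 2 ≤ (∫ x in a..b, f x ^ 2) * ∫ x in a..b, g x ^ 2 := by
  have key (t : ℝ) : 0 ≤ (∫ x in a..b, g x ^ 2) * (t * t) + (2 * ∫ x in a..b, f x * g x) * t
      + ∫ x in a..b, f x ^ 2 := by
    have : 0 ≤ ∫ x in a..b, (f x + t * g x) ^ 2 :=
      intervalIntegral.integral_nonneg hab fun _ _ => sq_nonneg _
    have e : ∫ x in a..b, (f x + t * g x) ^ 2 = (∫ x in a..b, t * t * g x ^ 2)
        + (∫ x in a..b, 2 * t * (f x * g x)) + ∫ x in a..b, f x ^ 2 := by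
      rw [← intervalIntegral.integral_add (hg.const_mul _) (hfg.const_mul _),
        ← intervalIntegral.integral_add ((hg.const_mul _).add (hfg.const_mul _)) hf]
      exact intervalIntegral.integral_congr fun x _ => by ring
    rw [e, intervalIntegral.integral_const_mul, intervalIntegral.integral_const_mul] at this
    linarith
  have := discrim_le_zero key
  rw [discrim] at this
  nlinarith

lemma sq_integral_mul_le_normSq {f g : ℝ → ℝ}
    (hf : MemLp f 2 (volume.restrict (Icc (0 : ℝ) 1)))
    (hg : MemLp g 2 (volume.restrict (Icc (0 : ℝ) 1))) :
    (∫ x in (0 : ℝ)..1, f x * g x) ^ 2 ≤ normSq f * normSq g :=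
  sq_integral_mul_le zero_le_one (MemLp.intervalIntegrable_sq hf (by simp) (by simp))
    (MemLp.intervalIntegrable_sq hg (by simp) (by simp))
    (MemLp.intervalIntegrable_mul hf hg (by simp) (by simp))

lemma normSq_add {f g : ℝ → ℝ} (hf : MemLp f 2 (volume.restrict (Icc (0 : ℝ) 1)))
    (hg : MemLp g 2 (volume.restrict (Icc (0 : ℝ) 1))) :
    normSq (fun x => f x + g x)
      = normSq f + 2 * (∫ x in (0 : ℝ)..1, f x * g x) + normSq g := by
  have h1 := MemLp.intervalIntegrable_sq hf (a := 0) (b := 1) (by simp) (by simp)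
  have h2 := MemLp.intervalIntegrable_sq hg (a := 0) (b := 1) (by simp) (by simp)
  have h3 := MemLp.intervalIntegrable_mul hf hg (a := 0) (b := 1) (by simp) (by simp)
  rw [normSq, normSq, normSq, ← intervalIntegral.integral_const_mul,
    ← intervalIntegral.integral_add h1 (h3.const_mul _),
    ← intervalIntegral.integral_add (h1.add (h3.const_mul _)) h2]
  exact intervalIntegral.integral_congr fun x _ => by ring

lemma normSq_le_of_abs_le {f : ℝ → ℝ} {C : ℝ} {p : ℕ}
    (hf : MemLp f 2 (volume.restrict (Icc (0 : ℝ) 1)))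
    (h : ∀ x ∈ Icc (0 : ℝ) 1, f x ^ 2 ≤ C * x ^ p) : normSq f ≤ C / (p + 1) := by
  have : normSq f ≤ ∫ x in (0 : ℝ)..1, C * x ^ p :=
    intervalIntegral.integral_mono_on zero_le_one
      (MemLp.intervalIntegrable_sq hf (by simp) (by simp))
      (Continuous.intervalIntegrable (by fun_prop) _ _) h
  refine this.trans_eq ?_
  rw [intervalIntegral.integral_const_mul, integral_pow]
  simp
  ring

/-! ### Volterra operators -/

/-- The Volterra operator `u ↦ ∫_0^x k(x, y) u(y) dy`. -/
noncomputable def volterra (k : ℝ → ℝ → ℝ) (u : ℝ → ℝ) (x : ℝ) : ℝ :=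
  ∫ y in (0 : ℝ)..x, k x y * u y

lemma volterra_congr {k : ℝ → ℝ → ℝ} {u v : ℝ → ℝ} (h : ∀ x ∈ Icc (0 : ℝ) 1, u x = v x)
    {x : ℝ} (hx : x ∈ Icc (0 : ℝ) 1) : volterra k u x = volterra k v x :=
  intervalIntegral.integral_congr fun y hy => by
    rw [uIcc_of_le hx.1] at hy
    simp only [h y ⟨hy.1, hy.2.trans hx.2⟩]

@[simp] lemma volterra_zero (k : ℝ → ℝ → ℝ) (u : ℝ → ℝ) : volterra k u 0 = 0 := by
  simp [volterra]

lemma Continuous.memLp_section {k : ℝ → ℝ → ℝ} (hk : Continuous (Function.uncurry k)) (x : ℝ) :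
    MemLp (k x) 2 (volume.restrict (Icc (0 : ℝ) 1)) :=
  (hk.comp (Continuous.prodMk_right x)).continuousOn.memLp_Icc

lemma sq_volterra_le {k : ℝ → ℝ → ℝ} {u : ℝ → ℝ} (hk : Continuous (Function.uncurry k))
    (hu : MemLp u 2 (volume.restrict (Icc (0 : ℝ) 1))) {x c : ℝ} (hx : x ∈ Icc (0 : ℝ) 1)
    (hc : ∀ y ∈ Icc 0 x, |k x y| ≤ c) : volterra k u x ^ 2 ≤ c ^ 2 * x * normSq u := by
  have h0 : (0 : ℝ) ∈ Icc (0 : ℝ) 1 := by simp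
  have h1 := MemLp.intervalIntegrable_sq (hk.memLp_section x) h0 hx
  have h2 := sq_integral_mul_le hx.1 h1 (MemLp.intervalIntegrable_sq hu h0 hx)
    (MemLp.intervalIntegrable_mul (hk.memLp_section x) hu h0 hx)
  have h3 : ∫ y in (0 : ℝ)..x, k x y ^ 2 ≤ c ^ 2 * x := by
    have : ∫ y in (0 : ℝ)..x, k x y ^ 2 ≤ ∫ y in (0 : ℝ)..x, c ^ 2 :=
      intervalIntegral.integral_mono_on hx.1 h1 (by simp) fun y hy => by
        rw [← sq_abs]
        exact pow_le_pow_left₀ (abs_nonneg _) (hc y hy) 2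
    simpa [mul_comm] using this
  have h4 : ∫ y in (0 : ℝ)..x, u y ^ 2 ≤ normSq u :=
    intervalIntegral.integral_mono_interval le_rfl hx.1 hx.2
      (Eventually.of_forall fun _ => sq_nonneg _)
      (MemLp.intervalIntegrable_sq hu h0 (by simp))
  have h5 : 0 ≤ ∫ y in (0 : ℝ)..x, u y ^ 2 :=
    intervalIntegral.integral_nonneg hx.1 fun _ _ => sq_nonneg _
  refine h2.trans ?_
  have := hx.1
  gcongr

lemma continuousOn_volterra {k : ℝ → ℝ → ℝ} {u : ℝ → ℝ} (hk : Continuous (Function.uncurry k))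
    (hu : MemLp u 2 (volume.restrict (Icc (0 : ℝ) 1))) :
    ContinuousOn (volterra k u) (Icc 0 1) := by
  have hui := MemLp.intervalIntegrable_Icc hu (a := 0) (b := 1) (by simp) (by simp)
  obtain ⟨C, hC⟩ := (isCompact_Icc (a := ((0, 0) : ℝ × ℝ)) (b := (1, 1))).exists_bound_of_continuousOn
    hk.continuousOn
  have e (x : ℝ) (hx : x ∈ Icc (0 : ℝ) 1) :
      volterra k u x = ∫ y in (0 : ℝ)..1, (Iic x).indicator (fun y => k x y * u y) y := by
    rw [volterra, intervalIntegral.integral_of_le hx.1, intervalIntegral.integral_of_le zero_le_one,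
      setIntegral_indicator measurableSet_Iic]
    congr 2
    ext y
    simp only [mem_Ioc, mem_inter_iff, mem_Iic]
    exact ⟨fun h => ⟨⟨h.1, h.2.trans hx.2⟩, h.2⟩, fun h => ⟨h.1.1, h.2⟩⟩
  refine ContinuousOn.congr (f := fun x =>
    ∫ y in (0 : ℝ)..1, (Iic x).indicator (fun y => k x y * u y) y) (fun x₀ hx₀ => ?_) e
  refine intervalIntegral.continuousWithinAt_of_dominated_interval (bound := fun y => C * |u y|)
    ?_ ?_ (hui.abs.const_mul C) ?_
  · refine Eventually.of_forall fun x => ?_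
    refine AEStronglyMeasurable.indicator ?_ measurableSet_Iic
    rw [uIoc_of_le zero_le_one]
    exact ((hk.comp (Continuous.prodMk_right x)).aestronglyMeasurable).mul
      hui.1.aestronglyMeasurable
  · filter_upwards [self_mem_nhdsWithin] with x hx
    refine Eventually.of_forall fun y hy => ?_
    rw [uIoc_of_le zero_le_one] at hy
    have h1 := hC (x, y) ⟨⟨hx.1, hy.1.le⟩, ⟨hx.2, hy.2⟩⟩
    refine (norm_indicator_le_norm_self _ _).trans ?_
    rw [norm_mul, Real.norm_eq_abs (u y)]
    exact mul_le_mul_of_nonneg_right h1 (abs_nonneg _)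
  · have : ∀ᵐ y : ℝ, y ≠ x₀ := by simp [ae_iff, measure_singleton]
    filter_upwards [this] with y hy _
    refine ContinuousAt.continuousWithinAt ?_
    have hc : ContinuousAt (fun x => k x y * u y) x₀ :=
      ((hk.comp (Continuous.prodMk_left y)).mul continuous_const).continuousAt
    rcases lt_or_gt_of_ne hy with h | h
    · refine hc.congr ?_
      filter_upwards [lt_mem_nhds h] with x hx
      rw [indicator_of_mem (show y ∈ Iic x from hx.le)]
    · refine continuousAt_const.congr (f := fun _ => (0 : ℝ)) ?_
      filter_upwards [gt_mem_nhds h] with x hx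
      rw [indicator_of_notMem (show y ∉ Iic x from not_le.2 hx)]

/-- Differentiation under the integral sign, with a uniform bound on the derivative. -/
lemma hasDerivAt_integral_of_bounded {φ φ' : ℝ → ℝ → ℝ} {t a b C : ℝ} {s : Set ℝ} (hs : s ∈ 𝓝 t)
    (hφ : ∀ r ∈ s, ContinuousOn (φ r) (uIcc a b)) (hφ' : ContinuousOn (φ' t) (uIcc a b))
    (hC : ∀ r ∈ s, ∀ x ∈ uIcc a b, |φ' r x| ≤ C)
    (hd : ∀ r ∈ s, ∀ x ∈ uIcc a b, HasDerivAt (fun r => φ r x) (φ' r x) r) :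
    HasDerivAt (fun r => ∫ x in a..b, φ r x) (∫ x in a..b, φ' t x) t := by
  have hsub : uIoc a b ⊆ uIcc a b := uIoc_subset_uIcc
  refine (intervalIntegral.hasDerivAt_integral_of_dominated_loc_of_deriv_le (s := s)
    (bound := fun _ => C) hs ?_ ((hφ t (mem_of_mem_nhds hs)).intervalIntegrable) ?_ ?_
    (by simp) ?_).2
  · filter_upwards [hs] with r hr
    exact ((hφ r hr).mono hsub).aestronglyMeasurable measurableSet_uIoc
  · exact (hφ'.mono hsub).aestronglyMeasurable measurableSet_uIoc
  · exact Eventually.of_forall fun x hx r hr => hC r hr x (hsub hx)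
  · exact Eventually.of_forall fun x hx r hr => hd r hr x (hsub hx)

/-- The Leibniz rule for Volterra operators. -/
lemma hasDerivWithinAt_volterra {k : ℝ → ℝ → ℝ} {u : ℝ → ℝ}
    (hk : ContDiff ℝ 1 (Function.uncurry k)) (hu : ContinuousOn u (Icc 0 1)) {x : ℝ}
    (hx : x ∈ Icc (0 : ℝ) 1) :
    HasDerivWithinAt (volterra k u) (k x x * u x + volterra (partialX k) u x) (Icc 0 1) x := by
  set v : ℝ → ℝ := IccExtend zero_le_one ((Icc (0 : ℝ) 1).domRestrict u) with hv
  have hvc : Continuous v := (continuousOn_iff_continuous_domRestrict.1 hu).Icc_extend'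
  have e (y : ℝ) (hy : y ∈ Icc (0 : ℝ) 1) : u y = v y := by
    rw [hv, IccExtend_of_mem zero_le_one _ hy]; rfl
  have hkc : Continuous (Function.uncurry k) := hk.continuous
  have hkx : Continuous (Function.uncurry (partialX k)) := continuous_partialX hk
  have hc1 : Continuous (fun p : ℝ × ℝ => ∫ y in (0 : ℝ)..p.2, partialX k p.1 y * v y) := by
    refine intervalIntegral.continuous_parametric_intervalIntegral_of_continuous
      (f := fun (p : ℝ × ℝ) y => partialX k p.1 y * v y) ?_ continuous_snd
    exact (hkx.comp (by fun_prop : Continuous fun p : (ℝ × ℝ) × ℝ => (p.1.1, p.2))).mul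
      (hvc.comp continuous_snd)
  have hd1 (x b : ℝ) : HasDerivAt (fun x => ∫ y in (0 : ℝ)..b, k x y * v y)
      (∫ y in (0 : ℝ)..b, partialX k x y * v y) x := by
    obtain ⟨C, hC⟩ := ((isCompact_Icc (a := x - 1) (b := x + 1)).prod
      (isCompact_uIcc (a := (0 : ℝ)) (b := b))).exists_bound_of_continuousOn
      (f := fun p : ℝ × ℝ => partialX k p.1 p.2 * v p.2)
      (hkx.mul (hvc.comp continuous_snd)).continuousOn
    refine hasDerivAt_integral_of_bounded (φ := fun x y => k x y * v y)
      (φ' := fun x y => partialX k x y * v y) (s := Icc (x - 1) (x + 1)) (C := C)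
      (Icc_mem_nhds (by linarith) (by linarith)) ?_ ?_ ?_ ?_
    · intro r _
      exact ((hkc.comp (Continuous.prodMk_right r)).mul hvc).continuousOn
    · exact ((hkx.comp (Continuous.prodMk_right x)).mul hvc).continuousOn
    · exact fun r hr y hy => hC (r, y) ⟨hr, hy⟩
    · exact fun r _ y _ => (hasDerivAt_partialX hk r y).mul_const _
  have hd2 (x b : ℝ) : HasDerivAt (fun b => ∫ y in (0 : ℝ)..b, k x y * v y) (k x b * v b) b := by
    have hc : Continuous fun y => k x y * v y := (hkc.comp (Continuous.prodMk_right x)).mul hvc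
    exact intervalIntegral.integral_hasDerivAt_right (hc.intervalIntegrable _ _)
      (hc.stronglyMeasurableAtFilter _ _) hc.continuousAt
  have hstrict := hasStrictFDerivAt_uncurry_coprod (𝕜 := ℝ) (u := (x, x))
    (f := fun x b => ∫ y in (0 : ℝ)..b, k x y * v y)
    (f₁ := fun x b => ContinuousLinearMap.toSpanSingleton ℝ
      (∫ y in (0 : ℝ)..b, partialX k x y * v y))
    (f₂ := fun x b => ContinuousLinearMap.toSpanSingleton ℝ (k x b * v b))
    (Eventually.of_forall fun p => (hd1 p.1 p.2).hasFDerivAt)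
    (Eventually.of_forall fun p => (hd2 p.1 p.2).hasFDerivAt)
    ((ContinuousLinearMap.toSpanSingletonCLE (𝕜 := ℝ) (E := ℝ)).continuous.comp hc1).continuousAt
    ((ContinuousLinearMap.toSpanSingletonCLE (𝕜 := ℝ) (E := ℝ)).continuous.comp
      (hkc.mul (hvc.comp continuous_snd))).continuousAt
  have h1 := hstrict.hasFDerivAt.comp_hasDerivAt (f := fun x : ℝ => (x, x)) x
    ((hasDerivAt_id' x).prodMk (hasDerivAt_id' x))
  have h2 : HasDerivAt (volterra k v) (k x x * v x + volterra (partialX k) v x) x := by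
    refine h1.congr_deriv ?_
    simp [Function.HasUncurry.uncurry, volterra]
    ring
  rw [e x hx, volterra_congr e hx]
  exact h2.hasDerivWithinAt.congr (fun y hy => volterra_congr e hy) (volterra_congr e hx)

/-! ### The localised backstepping transformation -/

/-- The localised backstepping transformation `u ↦ u - xⁿ ∫_0^x k(x, y) u(y) dy`. For `n = 0` it is
the backstepping transformation with kernel `k`; for every `n` it agrees with it at `x = 1`. -/
noncomputable def localBackstepping (k : ℝ → ℝ → ℝ) (n : ℕ) (u : ℝ → ℝ) (x : ℝ) : ℝ :=
  u x - x ^ n * volterra k u x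

/-- `u` is twice continuously differentiable on `[0, 1]` with derivatives `ux` and `uxx`, and
satisfies the Neumann condition at `0`. -/
structure IsNeumannProfile (u ux uxx : ℝ → ℝ) : Prop where
  cont : ContinuousOn u (Icc 0 1)
  contX : ContinuousOn ux (Icc 0 1)
  contXX : ContinuousOn uxx (Icc 0 1)
  hasDeriv : ∀ x ∈ Icc (0 : ℝ) 1, HasDerivWithinAt u (ux x) (Icc 0 1) x
  hasDerivX : ∀ x ∈ Icc (0 : ℝ) 1, HasDerivWithinAt ux (uxx x) (Icc 0 1) x
  neumann : ux 0 = 0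

/-- The derivative of `volterra k u`. -/
noncomputable def volterraX (k : ℝ → ℝ → ℝ) (u : ℝ → ℝ) (x : ℝ) : ℝ :=
  k x x * u x + volterra (partialX k) u x

/-- The second derivative of `volterra k u`, where `ux` is the derivative of `u`. -/
noncomputable def volterraXX (k : ℝ → ℝ → ℝ) (u ux : ℝ → ℝ) (x : ℝ) : ℝ :=
  (partialX k x x + partialY k x x) * u x + k x x * ux x + volterraX (partialX k) u x

/-- The derivative of `localBackstepping k n u`, where `ux` is the derivative of `u`. -/
noncomputable def localBacksteppingX (k : ℝ → ℝ → ℝ) (n : ℕ) (u ux : ℝ → ℝ) (x : ℝ) : ℝ :=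
  ux x - (n * x ^ (n - 1) * volterra k u x + x ^ n * volterraX k u x)

lemma Continuous.diagonal {k : ℝ → ℝ → ℝ} (hk : Continuous (Function.uncurry k)) :
    Continuous fun x => k x x :=
  hk.comp (continuous_id.prodMk continuous_id)

lemma continuousOn_volterraX {k : ℝ → ℝ → ℝ} {u : ℝ → ℝ}
    (hk : ContDiff ℝ 1 (Function.uncurry k)) (hu : ContinuousOn u (Icc 0 1)) :
    ContinuousOn (volterraX k u) (Icc 0 1) :=
  (hk.continuous.diagonal.continuousOn.mul hu).add
    (continuousOn_volterra (continuous_partialX hk) hu.memLp_Icc)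

lemma intervalIntegral.integral_mul_deriv_of_hasDerivWithinAt_Icc {a b : ℝ} (hab : a ≤ b)
    {u v u' v' : ℝ → ℝ} (hu : ∀ x ∈ Icc a b, HasDerivWithinAt u (u' x) (Icc a b) x)
    (hv : ∀ x ∈ Icc a b, HasDerivWithinAt v (v' x) (Icc a b) x)
    (hu' : ContinuousOn u' (Icc a b)) (hv' : ContinuousOn v' (Icc a b)) :
    ∫ x in a..b, u x * v' x = u b * v b - u a * v a - ∫ x in a..b, u' x * v x := by
  rw [← uIcc_of_le hab] at hu hv hu' hv'
  exact intervalIntegral.integral_mul_deriv_eq_deriv_mul_of_hasDerivWithinAt hu hv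
    hu'.intervalIntegrable hv'.intervalIntegrable

namespace IsNeumannProfile

variable {u ux uxx : ℝ → ℝ} {k : ℝ → ℝ → ℝ}

lemma hasDerivWithinAt_volterraX (h : IsNeumannProfile u ux uxx)
    (hk : ContDiff ℝ 2 (Function.uncurry k)) {x : ℝ} (hx : x ∈ Icc (0 : ℝ) 1) :
    HasDerivWithinAt (volterraX k u) (volterraXX k u ux x) (Icc 0 1) x :=
  ((hasDerivAt_diagonal (hk.of_le (by norm_num)) x).hasDerivWithinAt.mul (h.hasDeriv x hx)).add
    (hasDerivWithinAt_volterra (contDiff_partialX hk) h.cont hx)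

lemma hasDerivWithinAt_localBackstepping (h : IsNeumannProfile u ux uxx)
    (hk : ContDiff ℝ 2 (Function.uncurry k)) (n : ℕ) {x : ℝ} (hx : x ∈ Icc (0 : ℝ) 1) :
    HasDerivWithinAt (localBackstepping k n u) (localBacksteppingX k n u ux x) (Icc 0 1) x :=
  (h.hasDeriv x hx).sub ((hasDerivAt_pow n x).hasDerivWithinAt.mul
    (hasDerivWithinAt_volterra (hk.of_le (by norm_num)) h.cont hx))

lemma continuousOn_localBackstepping {u : ℝ → ℝ} (h : ContinuousOn u (Icc 0 1))
    (hk : Continuous (Function.uncurry k)) (n : ℕ) :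
    ContinuousOn (localBackstepping k n u) (Icc 0 1) :=
  h.sub ((continuous_pow n).continuousOn.mul (continuousOn_volterra hk h.memLp_Icc))

lemma continuousOn_localBacksteppingX (h : IsNeumannProfile u ux uxx)
    (hk : ContDiff ℝ 2 (Function.uncurry k)) (n : ℕ) :
    ContinuousOn (localBacksteppingX k n u ux) (Icc 0 1) :=
  h.contX.sub (((Continuous.continuousOn (by fun_prop)).mul
    (continuousOn_volterra hk.continuous h.cont.memLp_Icc)).add
    ((continuous_pow n).continuousOn.mul (continuousOn_volterraX (hk.of_le (by norm_num)) h.cont)))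

lemma continuousOn_volterraXX (h : IsNeumannProfile u ux uxx)
    (hk : ContDiff ℝ 2 (Function.uncurry k)) : ContinuousOn (volterraXX k u ux) (Icc 0 1) := by
  have h1 : ContDiff ℝ 1 (Function.uncurry k) := hk.of_le (by norm_num)
  exact ((((continuous_partialX h1).diagonal.add (continuous_partialY h1).diagonal).continuousOn.mul
    h.cont).add (hk.continuous.diagonal.continuousOn.mul h.contX)).add
    (continuousOn_volterraX (contDiff_partialX hk) h.cont)

/-- The kernel equations: `∫_0^x k(x, y) (ε u'' + λ u)(y) dy = ε (∫_0^x k(x, y) u(y) dy)'' + λ u`. -/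
lemma volterra_plant (h : IsNeumannProfile u ux uxx) {ε : ℝ} (hε : 0 < ε) {lam : ℝ → ℝ}
    (hlam : ContinuousOn lam (Icc 0 1)) (hk : IsBacksteppingKernel ε lam k) {x : ℝ}
    (hx : x ∈ Icc (0 : ℝ) 1) :
    volterra k (fun y => ε * uxx y + lam y * u y) x
      = ε * volterraXX k u ux x + lam x * u x := by
  have hk1 : ContDiff ℝ 1 (Function.uncurry k) := hk.contDiff.of_le (by norm_num)
  have hsub : Icc 0 x ⊆ Icc (0 : ℝ) 1 := Icc_subset_Icc_right hx.2
  have hint (f : ℝ → ℝ) (hf : ContinuousOn f (Icc 0 1)) : IntervalIntegrable f volume 0 x :=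
    ContinuousOn.intervalIntegrable (by rw [uIcc_of_le hx.1]; exact hf.mono hsub)
  have sec {p : ℝ → ℝ → ℝ} (hp : Continuous (Function.uncurry p)) :
      ContinuousOn (p x) (Icc 0 1) := (hp.comp (Continuous.prodMk_right x)).continuousOn
  have ibp1 := intervalIntegral.integral_mul_deriv_of_hasDerivWithinAt_Icc hx.1
    (fun y _ => (hasDerivAt_partialY hk1 x y).hasDerivWithinAt)
    (fun y hy => (h.hasDerivX y (hsub hy)).mono hsub)
    ((sec (continuous_partialY hk1)).mono hsub) (h.contXX.mono hsub)
  have ibp2 := intervalIntegral.integral_mul_deriv_of_hasDerivWithinAt_Icc hx.1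
    (fun y _ => (hasDerivAt_partialY (contDiff_partialY hk.contDiff) x y).hasDerivWithinAt)
    (fun y hy => (h.hasDeriv y (hsub hy)).mono hsub)
    ((sec (continuous_partialY (contDiff_partialY hk.contDiff))).mono hsub) (h.contX.mono hsub)
  rw [h.neumann] at ibp1
  rw [hk.partialY_bottom hx] at ibp2
  have cxx := sec (continuous_partialX (contDiff_partialX hk.contDiff))
  have cyy := sec (continuous_partialY (contDiff_partialY hk.contDiff))
  have e1 : volterra k (fun y => ε * uxx y + lam y * u y) x
      = ε * (∫ y in (0 : ℝ)..x, k x y * uxx y) + ∫ y in (0 : ℝ)..x, k x y * (lam y * u y) := by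
    rw [← intervalIntegral.integral_const_mul, ← intervalIntegral.integral_add]
    · exact intervalIntegral.integral_congr fun y _ => by ring
    · exact hint _ (((sec hk.contDiff.continuous).mul h.contXX).const_mul ε)
    · exact hint _ ((sec hk.contDiff.continuous).mul (hlam.mul h.cont))
  have e2 : ε * volterra (partialX (partialX k)) u x
      = ε * (∫ y in (0 : ℝ)..x, partialY (partialY k) x y * u y)
        + ∫ y in (0 : ℝ)..x, k x y * (lam y * u y) := by
    rw [volterra, ← intervalIntegral.integral_const_mul, ← intervalIntegral.integral_const_mul,
      ← intervalIntegral.integral_add]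
    · refine intervalIntegral.integral_congr fun y hy => ?_
      rw [uIcc_of_le hx.1] at hy
      have := hk.partials_pde (x := x) (y := y) ⟨hy.1, hy.2, hx.2⟩
      rw [sub_eq_iff_eq_add] at this
      rw [this]
      field_simp
      ring
    · exact hint _ ((cyy.mul h.cont).const_mul ε)
    · exact hint _ ((sec hk.contDiff.continuous).mul (hlam.mul h.cont))
  have e3 : ε * (partialX k x x + partialY k x x) = -(1 / 2) * lam x := by
    rw [hk.add_partials_diagonal hlam hx]
    field_simp
  rw [e1, ibp1, ibp2, volterraXX, volterraX]
  linear_combination -e2 - 2 * u x * e3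

/-- The energy identity for the transformed profile. -/
lemma integral_localBackstepping_mul (h : IsNeumannProfile u ux uxx) {ε : ℝ} (hε : 0 < ε)
    {lam : ℝ → ℝ} (hlam : ContinuousOn lam (Icc 0 1)) (hk : IsBacksteppingKernel ε lam k) (n : ℕ) :
    ∫ x in (0 : ℝ)..1, localBackstepping k n u x *
        localBackstepping k n (fun y => ε * uxx y + lam y * u y) x
      = ε * (localBackstepping k n u 1 * (ux 1 - volterraX k u 1)
          - normSq (localBacksteppingX k n u ux)
          - (∫ x in (0 : ℝ)..1, n * x ^ (n - 1) * (volterra k u x * localBacksteppingX k n u ux x))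
          + (∫ x in (0 : ℝ)..1, n * x ^ (n - 1) * (localBackstepping k n u x * volterraX k u x)))
        + ∫ x in (0 : ℝ)..1, lam x * (1 - x ^ n) * (u x * localBackstepping k n u x) := by
  set z := localBackstepping k n u with hz
  set zx := localBacksteppingX k n u ux with hzx
  have hk1 : ContDiff ℝ 1 (Function.uncurry k) := hk.contDiff.of_le (by norm_num)
  have cz : ContinuousOn z (Icc 0 1) := continuousOn_localBackstepping h.cont hk.contDiff.continuous n
  have czx : ContinuousOn zx (Icc 0 1) := h.continuousOn_localBacksteppingX hk.contDiff n
  have dz (x : ℝ) (hx : x ∈ Icc (0 : ℝ) 1) : HasDerivWithinAt z (zx x) (Icc 0 1) x :=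
    h.hasDerivWithinAt_localBackstepping hk.contDiff n hx
  have cv := continuousOn_volterra hk.contDiff.continuous h.cont.memLp_Icc
  have cvx := continuousOn_volterraX hk1 h.cont
  have cvxx := h.continuousOn_volterraXX hk.contDiff
  have cp (m : ℕ) : ContinuousOn (fun x : ℝ => x ^ m) (Icc 0 1) := (continuous_pow m).continuousOn
  have cn : ContinuousOn (fun x : ℝ => n * x ^ (n - 1)) (Icc 0 1) := (cp _).const_mul _
  have hint (f : ℝ → ℝ) (hf : ContinuousOn f (Icc 0 1)) : IntervalIntegrable f volume 0 1 :=
    ContinuousOn.intervalIntegrable (by rwa [uIcc_of_le zero_le_one])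
  have ibp1 := intervalIntegral.integral_mul_deriv_of_hasDerivWithinAt_Icc zero_le_one dz h.hasDerivX
    czx h.contXX
  have ibp2 := intervalIntegral.integral_mul_deriv_of_hasDerivWithinAt_Icc zero_le_one
    (fun x hx => (hasDerivAt_pow n x).hasDerivWithinAt.mul (dz x hx))
    (fun x hx => h.hasDerivWithinAt_volterraX hk.contDiff hx)
    (((cn.mul cz).add ((cp n).mul czx))) cvxx
  have hv0 : volterraX k u 0 = 0 := by
    have : k 0 0 = 0 := by simpa using hk.diagonal 0 (by simp)
    simp [volterraX, this]
  rw [h.neumann] at ibp1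
  rw [hv0] at ibp2
  simp only [Pi.mul_apply, one_pow, one_mul, mul_zero, sub_zero] at ibp1 ibp2
  have e1 : ∫ x in (0 : ℝ)..1, z x * localBackstepping k n (fun y => ε * uxx y + lam y * u y) x
      = ε * (∫ x in (0 : ℝ)..1, z x * uxx x) - ε * (∫ x in (0 : ℝ)..1, x ^ n * z x *
        volterraXX k u ux x) + ∫ x in (0 : ℝ)..1, lam x * (1 - x ^ n) * (u x * z x) := by
    rw [← intervalIntegral.integral_const_mul, ← intervalIntegral.integral_const_mul,
      ← intervalIntegral.integral_sub, ← intervalIntegral.integral_add]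
    · refine intervalIntegral.integral_congr fun x hx => ?_
      rw [uIcc_of_le zero_le_one] at hx
      rw [localBackstepping, h.volterra_plant hε hlam hk hx]
      ring
    · exact hint _ (((cz.mul h.contXX).const_mul ε).sub ((((cp n).mul cz).mul cvxx).const_mul ε))
    · exact hint _ ((hlam.mul (continuousOn_const.sub (cp n))).mul (h.cont.mul cz))
    · exact hint _ ((cz.mul h.contXX).const_mul ε)
    · exact hint _ ((((cp n).mul cz).mul cvxx).const_mul ε)
  have e2 : (∫ x in (0 : ℝ)..1, zx x * ux x)
      - (∫ x in (0 : ℝ)..1, (n * x ^ (n - 1) * z x + x ^ n * zx x) * volterraX k u x)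
      = normSq zx + (∫ x in (0 : ℝ)..1, n * x ^ (n - 1) * (volterra k u x * zx x))
        - ∫ x in (0 : ℝ)..1, n * x ^ (n - 1) * (z x * volterraX k u x) := by
    rw [normSq, ← intervalIntegral.integral_add, ← intervalIntegral.integral_sub,
      ← intervalIntegral.integral_sub]
    · refine intervalIntegral.integral_congr fun x _ => ?_
      simp only [hzx, localBacksteppingX]
      ring
    · exact hint _ ((czx.pow 2).add (cn.mul (cv.mul czx)))
    · exact hint _ (cn.mul (cz.mul cvx))
    · exact hint _ (czx.mul h.contX)
    · exact hint _ (((cn.mul cz).add ((cp n).mul czx)).mul cvx)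
    · exact hint _ (czx.pow 2)
    · exact hint _ (cn.mul (cv.mul czx))
  rw [e1, ibp1, ibp2]
  linear_combination (-ε) * e2

end IsNeumannProfile

/-! ### The gain error -/

/-- The error of the gain, as a functional of the profile. -/
noncomputable def gainError (p : ℝ) (e : ℝ → ℝ → ℝ) (u : ℝ → ℝ) : ℝ :=
  ∫ y in (0 : ℝ)..1, (p * e 1 y + partialX e 1 y) * u y

/-- The right boundary condition of the transformed profile. -/
lemma IsNeumannProfile.boundary_localBackstepping {u ux uxx lam : ℝ → ℝ} {k kh : ℝ → ℝ → ℝ}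
    {ε q : ℝ} (h : IsNeumannProfile u ux uxx) (hk : IsBacksteppingKernel ε lam k)
    (hkh : ContDiff ℝ 2 (Function.uncurry kh)) (n : ℕ) :
    ux 1 - volterraX k u 1 = -robinGain ε q lam * localBackstepping k n u 1
      - gainError (robinGain ε q lam) (fun x y => k x y - kh x y) u
      - (feedback (controlGain ε q lam kh) u - (ux 1 + q * u 1)) := by
  have hk1 : ContDiff ℝ 1 (Function.uncurry k) := hk.contDiff.of_le (by norm_num)
  have hkh1 : ContDiff ℝ 1 (Function.uncurry kh) := hkh.of_le (by norm_num)
  have hint (f : ℝ → ℝ) (hf : ContinuousOn f (Icc 0 1)) : IntervalIntegrable f volume 0 1 :=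
    ContinuousOn.intervalIntegrable (by rwa [uIcc_of_le zero_le_one])
  have sec {p : ℝ → ℝ → ℝ} (hp : Continuous (Function.uncurry p)) :
      ContinuousOn (p 1) (Icc 0 1) := (hp.comp (Continuous.prodMk_right 1)).continuousOn
  have ck := sec hk1.continuous
  have ckh := sec hkh1.continuous
  have ckx := sec (continuous_partialX hk1)
  have ckhx := sec (continuous_partialX hkh1)
  have e1 : gainError (robinGain ε q lam) (fun x y => k x y - kh x y) u
      = robinGain ε q lam * volterra k u 1 + volterra (partialX k) u 1
        - feedback (controlGain ε q lam kh) u := by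
    have hp (y : ℝ) : partialX (fun x y => k x y - kh x y) 1 y
        = partialX k 1 y - partialX kh 1 y :=
      (hasDerivAt_partialX (h := fun x y => k x y - kh x y) (hk1.sub hkh1) 1 y).unique
        ((hasDerivAt_partialX hk1 1 y).sub (hasDerivAt_partialX hkh1 1 y))
    have hc (y : ℝ) : controlGain ε q lam kh y = robinGain ε q lam * kh 1 y + partialX kh 1 y := by
      rw [controlGain, (hasDerivAt_partialX hkh1 1 y).deriv]
    rw [gainError, volterra, volterra, feedback, ← intervalIntegral.integral_const_mul,
      ← intervalIntegral.integral_add, ← intervalIntegral.integral_sub]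
    · refine intervalIntegral.integral_congr fun y _ => ?_
      rw [hp, hc]
      ring
    · exact hint _ (((ck.mul h.cont).const_mul _).add (ckx.mul h.cont))
    · simp only [hc]
      exact hint _ (((ckh.const_mul _).add ckhx).mul h.cont)
    · exact hint _ ((ck.mul h.cont).const_mul _)
    · exact hint _ (ckx.mul h.cont)
  have e2 : q + k 1 1 = robinGain ε q lam := by
    rw [hk.diagonal 1 (by simp), robinGain]
    ring
  rw [e1, localBackstepping, volterraX, ← e2]
  simp only [one_pow]
  ring

/-- The gain error is small on `H¹`: along the right edge, `e_x + e_y` is controlled by integration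
along characteristics, and `e_y` by integration by parts. -/
lemma IsNeumannProfile.sq_gainError_le {u ux uxx lam : ℝ → ℝ} {k kh : ℝ → ℝ → ℝ} {L ι p q : ℝ}
    (h : IsNeumannProfile u ux uxx) (hk : ContDiff ℝ 2 (Function.uncurry k))
    (h0 : ∀ x ∈ Icc (0 : ℝ) 1, 0 ≤ lam x) (hL : ∀ x ∈ Icc (0 : ℝ) 1, lam x ≤ L)
    (hkh : IsKernelApprox lam k kh ι) (hp : |p| ≤ q) :
    gainError p (fun x y => k x y - kh x y) u ^ 2
      ≤ 4 * ι ^ 2 * ((q + 1 + L) ^ 2 * normSq u + u 1 ^ 2 + u 0 ^ 2 + normSq ux) := by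
  set e : ℝ → ℝ → ℝ := fun x y => k x y - kh x y with he
  have he2 : ContDiff ℝ 2 (Function.uncurry e) := hk.sub hkh.contDiff
  have he1 : ContDiff ℝ 1 (Function.uncurry e) := he2.of_le (by norm_num)
  have hL0 : 0 ≤ L := (h0 0 (by simp)).trans (hL 0 (by simp))
  have acc (x y : ℝ) (hxy : (x, y) ∈ kernelTriangle) : |e x y| ≤ ι ∧
      |2 * (partialX e x x + partialY e x x)| ≤ ι ∧
      |partialX (partialX e) x y - partialY (partialY e) x y| ≤ (1 + L) * ι := by
    have h1 := hkh.accuracy x y hxy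
    have e1 : deriv (fun s => k s s - kh s s) x = partialX e x x + partialY e x x :=
      (hasDerivAt_diagonal he1 x).deriv
    have e2 : iteratedDeriv 2 (fun s => k s y - kh s y) x = partialX (partialX e) x y :=
      iteratedDeriv_two_eq_partialX he2 x y
    have e3 : iteratedDeriv 2 (fun s => k x s - kh x s) y = partialY (partialY e) x y :=
      iteratedDeriv_two_eq_partialY he2 x y
    have e4 : k x y - kh x y = e x y := rfl
    rw [e1, e2, e3, e4] at h1
    have a1 := abs_nonneg (e x y)
    have a2 := abs_nonneg (2 * (partialX e x x + partialY e x x))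
    have a3 := abs_nonneg (partialX (partialX e) x y - partialY (partialY e) x y - lam y * e x y)
    have hy : y ∈ Icc (0 : ℝ) 1 := ⟨hxy.1, hxy.2.1.trans hxy.2.2⟩
    refine ⟨by linarith, by linarith, ?_⟩
    have a4 : |lam y * e x y| ≤ L * ι := by
      rw [abs_mul, abs_of_nonneg (h0 y hy)]
      have := hL y hy
      have : |e x y| ≤ ι := by linarith
      gcongr
    have a5 := abs_add_le (partialX (partialX e) x y - partialY (partialY e) x y - lam y * e x y)
      (lam y * e x y)
    rw [sub_add_cancel] at a5
    linarith
  have hι : 0 ≤ ι := (abs_nonneg _).trans (acc 0 0 (by simp [kernelTriangle])).1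
  have hB (x : ℝ) : HasDerivAt (fun x => (1 + L) * ι * x) ((1 + L) * ι) x := by
    simpa using (hasDerivAt_id x).const_mul ((1 + L) * ι)
  have hP (y : ℝ) (hy : y ∈ Icc (0 : ℝ) 1) : |partialX e 1 y + partialY e 1 y| ≤ (1 + L) * ι := by
    have h1 := abs_add_partials_sub_diagonal_le he2 hB (fun x y hxy => (acc x y hxy).2.2)
      (x := 1) (y := y) ⟨hy.1, hy.2, le_rfl⟩
    have h2 := (acc ((1 + y) / 2) ((1 + y) / 2) ⟨by simp only; linarith [hy.1], le_rfl,
      by simp only; linarith [hy.2]⟩).2.1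
    have h3 : (1 + L) * ι * ((1 + y) / 2) ≥ (1 + L) * ι * (1 / 2) := by
      have := hy.1
      gcongr
      linarith
    have h4 : 0 ≤ L * ι := by positivity
    rw [abs_mul, abs_two] at h2
    rw [abs_le] at *
    have h5 := abs_le.1 (by linarith : |partialX e ((1 + y) / 2) ((1 + y) / 2)
      + partialY e ((1 + y) / 2) ((1 + y) / 2)| ≤ ι / 2)
    constructor <;> linarith [h1.1, h1.2, h5.1, h5.2]
  have he1' (y : ℝ) (hy : y ∈ Icc (0 : ℝ) 1) : |e 1 y| ≤ ι := (acc 1 y ⟨hy.1, hy.2, le_rfl⟩).1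
  have hint (f : ℝ → ℝ) (hf : ContinuousOn f (Icc 0 1)) : IntervalIntegrable f volume 0 1 :=
    ContinuousOn.intervalIntegrable (by rwa [uIcc_of_le zero_le_one])
  have sec {p : ℝ → ℝ → ℝ} (hp : Continuous (Function.uncurry p)) :
      ContinuousOn (p 1) (Icc 0 1) := (hp.comp (Continuous.prodMk_right 1)).continuousOn
  have c0 := sec he1.continuous
  have cx := sec (continuous_partialX he1)
  have cy := sec (continuous_partialY he1)
  have ibp := intervalIntegral.integral_mul_deriv_of_hasDerivWithinAt_Icc zero_le_one
    (fun y _ => (hasDerivAt_partialY he1 1 y).hasDerivWithinAt) h.hasDeriv cy h.contX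
  have hsplit : gainError p e u
      = (∫ y in (0 : ℝ)..1, (p * e 1 y + (partialX e 1 y + partialY e 1 y)) * u y)
        - e 1 1 * u 1 + e 1 0 * u 0 + ∫ y in (0 : ℝ)..1, e 1 y * ux y := by
    rw [ibp]
    have : gainError p e u
        = (∫ y in (0 : ℝ)..1, (p * e 1 y + (partialX e 1 y + partialY e 1 y)) * u y)
          - ∫ y in (0 : ℝ)..1, partialY e 1 y * u y := by
      rw [gainError, ← intervalIntegral.integral_sub]
      · exact intervalIntegral.integral_congr fun y _ => by ring
      · exact hint _ (((c0.const_mul _).add (cx.add cy)).mul h.cont)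
      · exact hint _ (cy.mul h.cont)
    rw [this]
    ring
  have cA : ContinuousOn (fun y => p * e 1 y + (partialX e 1 y + partialY e 1 y)) (Icc 0 1) :=
    (c0.const_mul _).add (cx.add cy)
  have b1 : (∫ y in (0 : ℝ)..1, (p * e 1 y + (partialX e 1 y + partialY e 1 y)) * u y) ^ 2
      ≤ (ι * (q + 1 + L)) ^ 2 * normSq u := by
    refine (sq_integral_mul_le_normSq cA.memLp_Icc h.cont.memLp_Icc).trans ?_
    have := normSq_le_of_abs_le (C := (ι * (q + 1 + L)) ^ 2) (p := 0) cA.memLp_Icc (fun y hy => by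
      rw [pow_zero, mul_one, ← sq_abs]
      refine pow_le_pow_left₀ (abs_nonneg _) ?_ 2
      refine (abs_add_le _ _).trans ?_
      rw [abs_mul]
      have h1 := hP y hy
      have h2 : |p| * |e 1 y| ≤ q * ι := by
        have := he1' y hy
        have := (abs_nonneg p).trans hp
        gcongr
      linarith)
    have h2 := normSq_nonneg u
    simp only [CharP.cast_eq_zero, zero_add, div_one] at this
    gcongr
  have b2 : (∫ y in (0 : ℝ)..1, e 1 y * ux y) ^ 2 ≤ ι ^ 2 * normSq ux := by
    refine (sq_integral_mul_le_normSq c0.memLp_Icc h.contX.memLp_Icc).trans ?_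
    have := normSq_le_of_abs_le (C := ι ^ 2) (p := 0) c0.memLp_Icc (fun y hy => by
      rw [pow_zero, mul_one, ← sq_abs]
      exact pow_le_pow_left₀ (abs_nonneg _) (he1' y hy) 2)
    have h2 := normSq_nonneg ux
    simp only [CharP.cast_eq_zero, zero_add, div_one] at this
    gcongr
  have b3 (y v : ℝ) (hy : y ∈ Icc (0 : ℝ) 1) : (e 1 y * v) ^ 2 ≤ ι ^ 2 * v ^ 2 := by
    rw [mul_pow, ← sq_abs (e 1 y)]
    have := he1' y hy
    gcongr
  have b4 := b3 1 (u 1) (by simp)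
  have b5 := b3 0 (u 0) (by simp)
  rw [hsplit]
  have key (a b c d : ℝ) : (a - b + c + d) ^ 2 ≤ 4 * (a ^ 2 + b ^ 2 + c ^ 2 + d ^ 2) := by
    nlinarith [sq_nonneg (a + b), sq_nonneg (a - c), sq_nonneg (a - d), sq_nonneg (b + c),
      sq_nonneg (b + d), sq_nonneg (c - d)]
  refine (key _ _ _ _).trans ?_
  rw [mul_pow] at b1
  linarith

/-! ### Elementary norm estimates -/

lemma sq_integral_mul_le_of_normSq_le {u f : ℝ → ℝ} {r : ℝ} (hr : 0 ≤ r)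
    (hu : MemLp u 2 (volume.restrict (Icc (0 : ℝ) 1)))
    (hf : MemLp f 2 (volume.restrict (Icc (0 : ℝ) 1))) (h : normSq f ≤ r ^ 2 * normSq u) :
    |∫ x in (0 : ℝ)..1, u x * f x| ≤ √(normSq u) * √(normSq f) ∧
      √(normSq f) ≤ r * √(normSq u) := by
  constructor
  · rw [← Real.sqrt_mul (normSq_nonneg u)]
    exact Real.abs_le_sqrt (sq_integral_mul_le_normSq hu hf)
  · rw [Real.sqrt_le_left (by positivity), mul_pow, Real.sq_sqrt (normSq_nonneg u)]
    exact h

lemma normSq_add_le {u f : ℝ → ℝ} {r : ℝ} (hr : 0 ≤ r)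
    (hu : MemLp u 2 (volume.restrict (Icc (0 : ℝ) 1)))
    (hf : MemLp f 2 (volume.restrict (Icc (0 : ℝ) 1))) (h : normSq f ≤ r ^ 2 * normSq u) :
    normSq (fun x => u x + f x) ≤ (1 + r) ^ 2 * normSq u := by
  obtain ⟨h1, h2⟩ := sq_integral_mul_le_of_normSq_le hr hu hf h
  have h3 := Real.sq_sqrt (normSq_nonneg u)
  have h4 := (le_abs_self _).trans h1
  have h5 : √(normSq u) * √(normSq f) ≤ √(normSq u) * (r * √(normSq u)) := by gcongr
  rw [normSq_add hu hf]
  nlinarith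

lemma le_normSq_add {u f : ℝ → ℝ} {r : ℝ} (hr : 0 ≤ r) (hr1 : r ≤ 1)
    (hu : MemLp u 2 (volume.restrict (Icc (0 : ℝ) 1)))
    (hf : MemLp f 2 (volume.restrict (Icc (0 : ℝ) 1))) (h : normSq f ≤ r ^ 2 * normSq u) :
    (1 - r) ^ 2 * normSq u ≤ normSq (fun x => u x + f x) := by
  obtain ⟨h1, h2⟩ := sq_integral_mul_le_of_normSq_le hr hu hf h
  have h3 := Real.sq_sqrt (normSq_nonneg u)
  have h3' := Real.sq_sqrt (normSq_nonneg f)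
  have h4 := (neg_le_of_abs_le h1)
  have h5 : (1 - r) * √(normSq u) ≤ √(normSq u) - √(normSq f) := by linarith
  have h6 : ((1 - r) * √(normSq u)) ^ 2 ≤ (√(normSq u) - √(normSq f)) ^ 2 :=
    pow_le_pow_left₀ (mul_nonneg (by linarith) (Real.sqrt_nonneg _)) h5 2
  rw [normSq_add hu hf]
  nlinarith

/-- The Agmon and Poincaré inequalities, with the trace at `1`. -/
lemma trace_inequalities {z zx : ℝ → ℝ} (hzx : ContinuousOn zx (Icc 0 1))
    (hd : ∀ x ∈ Icc (0 : ℝ) 1, HasDerivWithinAt z (zx x) (Icc 0 1) x) :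
    (∀ x ∈ Icc (0 : ℝ) 1, z x ^ 2 ≤ 3 / 2 * z 1 ^ 2 + 3 * normSq zx) ∧
      normSq z ≤ 3 / 2 * (z 1 ^ 2 + normSq zx) := by
  have hz : ContinuousOn z (Icc 0 1) := fun x hx => (hd x hx).continuousWithinAt
  have key (x : ℝ) (hx : x ∈ Icc (0 : ℝ) 1) :
      z x ^ 2 ≤ 3 / 2 * z 1 ^ 2 + 3 * normSq zx * (1 - x) := by
    have hsub : Icc x 1 ⊆ Icc (0 : ℝ) 1 := Icc_subset_Icc_left hx.1
    have e : ∫ y in x..1, zx y = z 1 - z x := by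
      refine intervalIntegral.integral_eq_sub_of_hasDerivAt_of_le hx.2 (hz.mono hsub)
        (fun y hy => ?_) ?_
      · exact (hd y (hsub (Ioo_subset_Icc_self hy))).hasDerivAt
          (Icc_mem_nhds (hx.1.trans_lt hy.1) hy.2)
      · exact ContinuousOn.intervalIntegrable (by rw [uIcc_of_le hx.2]; exact hzx.mono hsub)
    have hcs := sq_integral_mul_le (f := zx) (g := fun _ => 1) hx.2
      (MemLp.intervalIntegrable_sq hzx.memLp_Icc hx (by simp)) (by simp)
      (by simpa using MemLp.intervalIntegrable_Icc hzx.memLp_Icc hx (by simp))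
    simp only [mul_one, e, one_pow, intervalIntegral.integral_const, smul_eq_mul] at hcs
    have h4 : ∫ y in x..1, zx y ^ 2 ≤ normSq zx :=
      intervalIntegral.integral_mono_interval hx.1 hx.2 le_rfl
        (Eventually.of_forall fun _ => sq_nonneg _)
        (MemLp.intervalIntegrable_sq hzx.memLp_Icc (by simp) (by simp))
    have h5 : (z 1 - z x) ^ 2 ≤ normSq zx * (1 - x) :=
      hcs.trans (mul_le_mul_of_nonneg_right h4 (by linarith [hx.2]))
    -- `2 |a b| ≤ a² / 2 + 2 b²` with `a = z 1` and `b = z 1 - z x`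
    nlinarith [sq_nonneg (z 1 / 2 + (z 1 - z x))]
  refine ⟨fun x hx => (key x hx).trans ?_, ?_⟩
  · have := mul_nonneg (normSq_nonneg zx) hx.1
    nlinarith
  · have : normSq z ≤ ∫ x in (0 : ℝ)..1, (3 / 2 * z 1 ^ 2 + 3 * normSq zx * (1 - x)) :=
      intervalIntegral.integral_mono_on zero_le_one
        (MemLp.intervalIntegrable_sq hz.memLp_Icc (by simp) (by simp))
        (Continuous.intervalIntegrable (by fun_prop) _ _) key
    refine this.trans_eq ?_
    rw [intervalIntegral.integral_add (by simp) (Continuous.intervalIntegrable (by fun_prop) _ _),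
      intervalIntegral.integral_const_mul (3 * normSq zx),
      intervalIntegral.integral_sub (by simp) (by simp)]
    simp
    ring

lemma localBackstepping_eq_add (k : ℝ → ℝ → ℝ) (n : ℕ) (u : ℝ → ℝ) :
    localBackstepping k n u = fun x => u x + -(x ^ n * volterra k u x) :=
  funext fun _ => sub_eq_add_neg _ _

lemma memLp_pow_mul_volterra {k : ℝ → ℝ → ℝ} (hk : Continuous (Function.uncurry k)) (n : ℕ)
    {u : ℝ → ℝ} (hu : MemLp u 2 (volume.restrict (Icc (0 : ℝ) 1))) :
    MemLp (fun x => -(x ^ n * volterra k u x)) 2 (volume.restrict (Icc (0 : ℝ) 1)) :=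
  ((continuous_pow n).continuousOn.mul (continuousOn_volterra hk hu)).neg.memLp_Icc

lemma memLp_localBackstepping {k : ℝ → ℝ → ℝ} (hk : Continuous (Function.uncurry k)) (n : ℕ)
    {u : ℝ → ℝ} (hu : MemLp u 2 (volume.restrict (Icc (0 : ℝ) 1))) :
    MemLp (localBackstepping k n u) 2 (volume.restrict (Icc (0 : ℝ) 1)) := by
  rw [localBackstepping_eq_add]
  exact hu.add (memLp_pow_mul_volterra hk n hu)

/-- Inversion of a Volterra operator of the second kind in `L²`, by Gronwall's inequality. -/
lemma normSq_volterra_le_of_gronwall {k : ℝ → ℝ → ℝ} {u : ℝ → ℝ} {κ : ℝ}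
    (hk : Continuous (Function.uncurry k)) (hu : ContinuousOn u (Icc 0 1))
    (hκ : ∀ x y, (x, y) ∈ kernelTriangle → |k x y| ≤ κ) :
    normSq (volterra k u)
      ≤ (κ * Real.exp κ) ^ 2 / 2 * normSq (fun x => u x - volterra k u x) := by
  have hκ0 : 0 ≤ κ := (abs_nonneg _).trans (hκ 0 0 (by simp [kernelTriangle]))
  have hv := continuousOn_volterra hk hu.memLp_Icc
  set w : ℝ → ℝ := fun x => u x - volterra k u x with hw
  have hwc : ContinuousOn w (Icc 0 1) := hu.sub hv
  set I : ℝ → ℝ := fun x => ∫ y in (0 : ℝ)..x, |u y| with hI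
  set J : ℝ → ℝ := fun x => ∫ y in (0 : ℝ)..x, |w y| with hJ
  have hI0 (x : ℝ) (hx : x ∈ Icc (0 : ℝ) 1) : 0 ≤ I x :=
    intervalIntegral.integral_nonneg hx.1 fun _ _ => abs_nonneg _
  have hvI (x : ℝ) (hx : x ∈ Icc (0 : ℝ) 1) : |volterra k u x| ≤ κ * I x := by
    have h1 : IntervalIntegrable (fun y => |u y|) volume 0 x :=
      MemLp.intervalIntegrable_Icc hu.abs.memLp_Icc (by simp) hx
    rw [hI, ← intervalIntegral.integral_const_mul]
    refine intervalIntegral.norm_integral_le_of_norm_le (E := ℝ) (f := fun y => k x y * u y) hx.1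
      (Eventually.of_forall fun y hy => ?_) (h1.const_mul κ)
    rw [norm_mul, Real.norm_eq_abs, Real.norm_eq_abs]
    exact mul_le_mul_of_nonneg_right (hκ x y ⟨hy.1.le, hy.2, hx.2⟩) (abs_nonneg _)
  have hId (x : ℝ) (hx : x ∈ Icc (0 : ℝ) 1) :=
    hasDerivWithinAt_integral_of_continuousOn zero_le_one hu.abs hx
  have hJd (x : ℝ) (hx : x ∈ Icc (0 : ℝ) 1) :=
    hasDerivWithinAt_integral_of_continuousOn zero_le_one hwc.abs hx
  have hexp (x : ℝ) : HasDerivAt (fun x => Real.exp (-(κ * x))) (Real.exp (-(κ * x)) * (-κ)) x := by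
    simpa using ((hasDerivAt_id x).const_mul κ).neg.exp
  have hFd (x : ℝ) (hx : x ∈ Icc (0 : ℝ) 1) := (hJd x hx).sub
    ((hexp x).hasDerivWithinAt.mul (hId x hx))
  have hmono : MonotoneOn (fun x => J x - Real.exp (-(κ * x)) * I x) (Icc 0 1) := by
    refine monotoneOn_of_deriv_nonneg (convex_Icc 0 1)
      (fun x hx => (hFd x hx).continuousWithinAt) ?_ ?_
    · rw [interior_Icc]
      exact fun x hx => ((hFd x (Ioo_subset_Icc_self hx)).hasDerivAt
        (Icc_mem_nhds hx.1 hx.2)).differentiableAt.differentiableWithinAt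
    · rw [interior_Icc]
      intro x hx
      have hx' := Ioo_subset_Icc_self hx
      refine le_of_le_of_eq ?_ ((hFd x hx').hasDerivAt (Icc_mem_nhds hx.1 hx.2)).deriv.symm
      have h1 : |u x| ≤ |w x| + κ * I x := by
        have := abs_add_le (w x) (volterra k u x)
        rw [hw] at this
        simp only [sub_add_cancel] at this
        exact this.trans (by linarith [hvI x hx'])
      have h2 : Real.exp (-(κ * x)) ≤ 1 := by
        rw [Real.exp_le_one_iff]
        have := mul_nonneg hκ0 hx'.1
        linarith
      have h3 := Real.exp_pos (-(κ * x))
      have h4 : Real.exp (-(κ * x)) * |u x| ≤ Real.exp (-(κ * x)) * (|w x| + κ * I x) := by gcongr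
      have h5 : Real.exp (-(κ * x)) * |w x| ≤ 1 * |w x| := by gcongr
      change 0 ≤ |w x| - (Real.exp (-(κ * x)) * -κ * I x + Real.exp (-(κ * x)) * |u x|)
      nlinarith
  have hIJ (x : ℝ) (hx : x ∈ Icc (0 : ℝ) 1) : I x ≤ Real.exp κ * J x := by
    have h1 := hmono (by simp) hx hx.1
    simp only [hI, hJ, intervalIntegral.integral_same, mul_zero, sub_zero] at h1
    change 0 ≤ J x - Real.exp (-(κ * x)) * I x at h1
    have h2 : Real.exp (-(κ * x)) * I x ≤ J x := by linarith
    have h3 : I x ≤ Real.exp (κ * x) * J x := by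
      calc I x = Real.exp (κ * x) * (Real.exp (-(κ * x)) * I x) := by
            rw [← mul_assoc, ← Real.exp_add]; simp
        _ ≤ _ := by gcongr
    have h4 : 0 ≤ J x := intervalIntegral.integral_nonneg hx.1 fun _ _ => abs_nonneg _
    refine h3.trans ?_
    have := mul_le_mul_of_nonneg_left hx.2 hκ0
    rw [mul_one] at this
    gcongr
  have hJ2 (x : ℝ) (hx : x ∈ Icc (0 : ℝ) 1) : J x ^ 2 ≤ x * normSq w := by
    have hcs := sq_integral_mul_le (f := fun y => |w y|) (g := fun _ => 1) hx.1
      (MemLp.intervalIntegrable_sq hwc.abs.memLp_Icc (by simp) hx) (by simp)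
      (by simpa using MemLp.intervalIntegrable_Icc hwc.abs.memLp_Icc (by simp) hx)
    simp only [mul_one, one_pow, intervalIntegral.integral_const, smul_eq_mul, sub_zero,
      sq_abs] at hcs
    have h4 : ∫ y in (0 : ℝ)..x, w y ^ 2 ≤ normSq w :=
      intervalIntegral.integral_mono_interval le_rfl hx.1 hx.2
        (Eventually.of_forall fun _ => sq_nonneg _)
        (MemLp.intervalIntegrable_sq hwc.memLp_Icc (by simp) (by simp))
    have := mul_le_mul_of_nonneg_right h4 hx.1
    linarith
  have := normSq_le_of_abs_le (C := (κ * Real.exp κ) ^ 2 * normSq w) (p := 1) hv.memLp_Icc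
    (fun x hx => by
      have h1 : |volterra k u x| ≤ κ * Real.exp κ * J x := by
        have := mul_le_mul_of_nonneg_left (hIJ x hx) hκ0
        linarith [hvI x hx]
      calc volterra k u x ^ 2 ≤ (κ * Real.exp κ * J x) ^ 2 := by
            rw [← sq_abs]; exact pow_le_pow_left₀ (abs_nonneg _) h1 2
        _ = (κ * Real.exp κ) ^ 2 * J x ^ 2 := by ring
        _ ≤ (κ * Real.exp κ) ^ 2 * (x * normSq w) := by
            have := hJ2 x hx
            gcongr
        _ = _ := by ring)
  norm_num at this
  linarith

/-! ### The overshoot constant -/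

/-- The overshoot constant is at least its value for `ι = 0`, since
`4 L / ε exp (4 L / ε)` is twice the kernel bound. -/
lemma overshoot_ge {ε L ι : ℝ} (hε : 0 < ε) (hL : 0 ≤ L) (hι : 0 ≤ ι) :
    (1 + kernelBound ε L ^ 2) *
      (1 + (kernelBound ε L * Real.exp (kernelBound ε L)) ^ 2) ≤ overshoot ε L ι := by
  have ha : 0 ≤ kernelBound ε L := by rw [kernelBound]; positivity
  have e : (kernelBound ε L * Real.exp (kernelBound ε L)) ^ 2
      = kernelBound ε L ^ 2 * Real.exp (4 * L / ε * Real.exp (4 * L / ε)) := by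
    rw [mul_pow, ← Real.exp_nat_mul]
    congr 2
    rw [kernelBound]
    push_cast
    ring
  rw [e, overshoot]
  gcongr
  · linarith
  · linarith
  · linarith

lemma two_mul_div_le_kernelBound {ε L : ℝ} (hε : 0 < ε) (hL : 0 ≤ L) :
    2 * (L / ε) * (1 + 4 * (L / ε)) ≤ kernelBound ε L := by
  rw [kernelBound, show 2 * (L / ε) = 2 * L / ε by ring, show 4 * (L / ε) = 4 * L / ε by ring]
  have := Real.add_one_le_exp (4 * L / ε)
  gcongr
  linarith

/-- Absorbs the linear term of `(1 + r)²`: here `7072 / 50000` is a fifth of an upper bound of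
`1 / √2`. -/
lemma sq_one_add_le {r a : ℝ} (h0 : 0 ≤ r) (h : r ≤ 7072 / 50000 * a) (ha : 298 / 1000 ≤ a) :
    (1 + r) ^ 2 ≤ 1 + a ^ 2 := by
  nlinarith

lemma kernelBound_ge {ε L : ℝ} (hL : 1 / 10 ≤ L / ε) : 298 / 1000 ≤ kernelBound ε L := by
  have h1 : (149 / 100 : ℝ) ≤ Real.exp (4 * L / ε) := by
    have h2 : Real.exp (4 / 10) ≤ Real.exp (4 * L / ε) := by
      rw [Real.exp_le_exp, mul_div_assoc]
      linarith
    refine le_trans ?_ h2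
    have := Real.sum_le_exp_of_nonneg (x := 4 / 10) (by norm_num) 4
    refine le_trans ?_ this
    norm_num [Finset.sum_range_succ, Nat.factorial]
  rw [kernelBound, show 2 * L / ε = 2 * (L / ε) by ring]
  nlinarith

/-! ### Dissipation of the transformed profile -/

/-- A bound for the `H¹` norm of a profile by that of its transform, given that the transform is
bounded below by `1 / A` and that `κ`, `κ'` bound the kernel and its `x`-derivative. -/
noncomputable def energyConst (A κ κ' : ℝ) (n : ℕ) : ℝ :=
  3 / 2 * A + 2 + 3 * A * κ ^ 2 + 3 + 3 + 9 / 2 * A * (n ^ 2 * κ ^ 2 + 2 * κ ^ 2 + 2 * κ' ^ 2)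

lemma energyConst_ge {A κ κ' : ℝ} {n : ℕ} (hA : 0 ≤ A) : 8 ≤ energyConst A κ κ' n := by
  rw [energyConst]
  have : 0 ≤ 3 / 2 * A + 3 * A * κ ^ 2
    + 9 / 2 * A * (n ^ 2 * κ ^ 2 + 2 * κ ^ 2 + 2 * κ' ^ 2) := by positivity
  linarith

lemma sq_volterraX_le {k : ℝ → ℝ → ℝ} {u : ℝ → ℝ} (hk : ContDiff ℝ 1 (Function.uncurry k))
    (hu : MemLp u 2 (volume.restrict (Icc (0 : ℝ) 1))) {κ κ' : ℝ}
    (hκ : ∀ x y, (x, y) ∈ kernelTriangle → |k x y| ≤ κ)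
    (hκ' : ∀ x y, (x, y) ∈ kernelTriangle → |partialX k x y| ≤ κ') {x : ℝ}
    (hx : x ∈ Icc (0 : ℝ) 1) :
    volterraX k u x ^ 2 ≤ 2 * κ ^ 2 * u x ^ 2 + 2 * κ' ^ 2 * normSq u := by
  have h1 := sq_volterra_le (continuous_partialX hk) hu hx
    (fun y hy => hκ' x y ⟨hy.1, hy.2, hx.2⟩)
  have h2 : (k x x) ^ 2 ≤ κ ^ 2 := by
    rw [← sq_abs]
    exact pow_le_pow_left₀ (abs_nonneg _) (hκ x x ⟨hx.1, le_rfl, hx.2⟩) 2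
  have h3 : κ' ^ 2 * x * normSq u ≤ κ' ^ 2 * 1 * normSq u := by
    have := normSq_nonneg u
    have := hx.2
    gcongr
  have h4 : (k x x * u x) ^ 2 ≤ κ ^ 2 * u x ^ 2 := by
    rw [mul_pow]
    gcongr
  rw [volterraX]
  nlinarith [sq_nonneg (k x x * u x - volterra (partialX k) u x)]

lemma IsNeumannProfile.energy_le {u ux uxx : ℝ → ℝ} {k : ℝ → ℝ → ℝ}
    (h : IsNeumannProfile u ux uxx) (hk : ContDiff ℝ 2 (Function.uncurry k)) {κ κ' A : ℝ} {n : ℕ}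
    (hκ : ∀ x y, (x, y) ∈ kernelTriangle → |k x y| ≤ κ)
    (hκ' : ∀ x y, (x, y) ∈ kernelTriangle → |partialX k x y| ≤ κ') (hA : 0 ≤ A)
    (hlow : normSq u ≤ A * normSq (localBackstepping k n u)) :
    normSq u + u 1 ^ 2 + u 0 ^ 2 + normSq ux ≤ energyConst A κ κ' n *
      (localBackstepping k n u 1 ^ 2 + normSq (localBacksteppingX k n u ux)) := by
  have hk1 : ContDiff ℝ 1 (Function.uncurry k) := hk.of_le (by norm_num)
  set z := localBackstepping k n u with hz
  set zx := localBacksteppingX k n u ux with hzx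
  have czx : ContinuousOn zx (Icc 0 1) := h.continuousOn_localBacksteppingX hk n
  obtain ⟨htr, hpo⟩ := trace_inequalities czx
    fun x hx => h.hasDerivWithinAt_localBackstepping hk n hx
  have hD := normSq_nonneg zx
  have hX := normSq_nonneg u
  set S := z 1 ^ 2 + normSq zx with hS
  have hXS : normSq u ≤ 3 / 2 * A * S := by
    have := mul_le_mul_of_nonneg_left hpo hA
    linarith
  have hv (x : ℝ) (hx : x ∈ Icc (0 : ℝ) 1) : volterra k u x ^ 2 ≤ κ ^ 2 * normSq u := by
    refine (sq_volterra_le hk1.continuous h.cont.memLp_Icc hx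
      (fun y hy => hκ x y ⟨hy.1, hy.2, hx.2⟩)).trans ?_
    have : κ ^ 2 * x * normSq u ≤ κ ^ 2 * 1 * normSq u := by
      have := hx.2
      gcongr
    linarith
  have h1 : u 1 ^ 2 ≤ 2 * S + 3 * A * κ ^ 2 * S := by
    have e : u 1 = z 1 + volterra k u 1 := by simp [hz, localBackstepping]
    have := hv 1 (by simp)
    have h3 := mul_le_mul_of_nonneg_left hXS (sq_nonneg κ)
    rw [e]
    nlinarith [sq_nonneg (z 1 - volterra k u 1)]
  have h0 : u 0 ^ 2 ≤ 3 * S := by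
    have e : u 0 = z 0 := by simp [hz, localBackstepping]
    have := htr 0 (by simp)
    rw [e]
    nlinarith [sq_nonneg (z 1)]
  have hU : normSq ux ≤ 3 * normSq zx + 3 * (n ^ 2 * κ ^ 2 + 2 * κ ^ 2 + 2 * κ' ^ 2) * normSq u := by
    have i1 := MemLp.intervalIntegrable_sq h.contX.memLp_Icc (a := 0) (b := 1) (by simp) (by simp)
    have i2 := MemLp.intervalIntegrable_sq czx.memLp_Icc (a := 0) (b := 1) (by simp) (by simp)
    have i3 := MemLp.intervalIntegrable_sq h.cont.memLp_Icc (a := 0) (b := 1) (by simp) (by simp)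
    have : normSq ux ≤ ∫ x in (0 : ℝ)..1, (3 * zx x ^ 2 + (6 * κ ^ 2 * u x ^ 2
        + 3 * (n ^ 2 * κ ^ 2 + 2 * κ' ^ 2) * normSq u)) := by
      refine intervalIntegral.integral_mono_on zero_le_one i1
        ((i2.const_mul 3).add ((i3.const_mul _).add (by simp))) fun x hx => ?_
      have e : ux x = zx x + n * x ^ (n - 1) * volterra k u x + x ^ n * volterraX k u x := by
        simp only [hzx, localBacksteppingX]
        ring
      have b1 : (n * x ^ (n - 1) * volterra k u x) ^ 2 ≤ n ^ 2 * (κ ^ 2 * normSq u) := by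
        have hp : 0 ≤ x ^ (n - 1) := pow_nonneg hx.1 _
        have hp' : (x ^ (n - 1)) ^ 2 ≤ 1 := pow_le_one₀ hp (pow_le_one₀ hx.1 hx.2)
        have := hv x hx
        calc (n * x ^ (n - 1) * volterra k u x) ^ 2
            = n ^ 2 * ((x ^ (n - 1)) ^ 2 * volterra k u x ^ 2) := by ring
          _ ≤ n ^ 2 * (1 * (κ ^ 2 * normSq u)) := by gcongr
          _ = _ := by ring
      have b2 : (x ^ n * volterraX k u x) ^ 2
          ≤ 2 * κ ^ 2 * u x ^ 2 + 2 * κ' ^ 2 * normSq u := by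
        have hp : 0 ≤ x ^ n := pow_nonneg hx.1 _
        have hp' : (x ^ n) ^ 2 ≤ 1 := pow_le_one₀ hp (pow_le_one₀ hx.1 hx.2)
        have := sq_volterraX_le hk1 h.cont.memLp_Icc hκ hκ' hx
        calc (x ^ n * volterraX k u x) ^ 2 = (x ^ n) ^ 2 * volterraX k u x ^ 2 := by ring
          _ ≤ 1 * volterraX k u x ^ 2 := by gcongr
          _ ≤ _ := by linarith
      rw [e]
      nlinarith [sq_nonneg (zx x - n * x ^ (n - 1) * volterra k u x),
        sq_nonneg (zx x - x ^ n * volterraX k u x),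
        sq_nonneg (n * x ^ (n - 1) * volterra k u x - x ^ n * volterraX k u x)]
    refine this.trans_eq ?_
    rw [intervalIntegral.integral_add (i2.const_mul 3) ((i3.const_mul _).add (by simp)),
      intervalIntegral.integral_add (i3.const_mul _) (by simp),
      intervalIntegral.integral_const_mul, intervalIntegral.integral_const_mul,
      intervalIntegral.integral_const]
    simp only [normSq, sub_zero, smul_eq_mul]
    ring
  have hD' : normSq zx ≤ S := by linarith [sq_nonneg (z 1)]
  have h3 : 3 * (n ^ 2 * κ ^ 2 + 2 * κ ^ 2 + 2 * κ' ^ 2) * normSq u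
      ≤ 3 * (n ^ 2 * κ ^ 2 + 2 * κ ^ 2 + 2 * κ' ^ 2) * (3 / 2 * A * S) := by gcongr
  rw [energyConst]
  nlinarith

lemma robinGain_bounds {ε q L : ℝ} {lam : ℝ → ℝ} (hε : 0 < ε) (hq : q > L / (2 * ε) + 1 / 2)
    (hlam : ContinuousOn lam (Icc 0 1)) (h0 : ∀ x ∈ Icc (0 : ℝ) 1, 0 ≤ lam x)
    (hL : ∀ x ∈ Icc (0 : ℝ) 1, lam x ≤ L) :
    1 / 2 < robinGain ε q lam ∧ |robinGain ε q lam| ≤ q := by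
  have i1 : 0 ≤ ∫ y in (0 : ℝ)..1, lam y := intervalIntegral.integral_nonneg zero_le_one h0
  have i2 : ∫ y in (0 : ℝ)..1, lam y ≤ L := by
    have := intervalIntegral.integral_mono_on zero_le_one
      (MemLp.intervalIntegrable_Icc hlam.memLp_Icc (by simp) (by simp))
      (intervalIntegrable_const (c := L)) hL
    simpa using this
  have i3 : 1 / (2 * ε) * ∫ y in (0 : ℝ)..1, lam y ≤ 1 / (2 * ε) * L := by gcongr
  have i4 : 0 ≤ 1 / (2 * ε) * ∫ y in (0 : ℝ)..1, lam y := by positivity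
  have i5 : 1 / (2 * ε) * L = L / (2 * ε) := by ring
  rw [robinGain]
  refine ⟨by linarith, ?_⟩
  rw [abs_of_nonneg (by linarith)]
  linarith

/-- The threshold on the accuracy of the kernel. -/
noncomputable def accuracyBound (A κ κ' q L : ℝ) (n : ℕ) : ℝ :=
  1 / (2500 * (1 + 4 * ((q + 1 + L) ^ 2 + 1) * energyConst A κ κ' n))

/-- The dissipation inequality: if the energy identity leaves a margin, the gain error and the
input deviation are absorbed. -/
lemma IsNeumannProfile.dissipation {u ux uxx lam : ℝ → ℝ} {k kh : ℝ → ℝ → ℝ}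
    (h : IsNeumannProfile u ux uxx) {ε q L ι κ κ' A : ℝ} {n : ℕ} (hε : 0 < ε)
    (hk : ContDiff ℝ 2 (Function.uncurry k))
    (h0 : ∀ x ∈ Icc (0 : ℝ) 1, 0 ≤ lam x) (hL : ∀ x ∈ Icc (0 : ℝ) 1, lam x ≤ L)
    (hkh : IsKernelApprox lam k kh ι) (hp : |robinGain ε q lam| ≤ q)
    (hκ : ∀ x y, (x, y) ∈ kernelTriangle → |k x y| ≤ κ)
    (hκ' : ∀ x y, (x, y) ∈ kernelTriangle → |partialX k x y| ≤ κ') (hA : 0 ≤ A)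
    (hlow : normSq u ≤ A * normSq (localBackstepping k n u)) (hι : 0 < ι)
    (hι' : ι < accuracyBound A κ κ' q L n) {F d : ℝ}
    (hF : F ≤ ε * (-(1 / 16) * normSq (localBackstepping k n u)
      - 1 / 20 * (localBackstepping k n u 1 ^ 2 + normSq (localBacksteppingX k n u ux))
      - localBackstepping k n u 1 *
        (gainError (robinGain ε q lam) (fun x y => k x y - kh x y) u + d))) :
    F ≤ ε * (-(1 / 16) * normSq (localBackstepping k n u)
      - 1 / (100 * energyConst A κ κ' n) * (normSq u + u 1 ^ 2 + u 0 ^ 2) + 25 * d ^ 2) := by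
  have hE := h.energy_le hk (n := n) hκ hκ' hA hlow
  have herr := h.sq_gainError_le hk h0 hL hkh hp
  have hC := energyConst_ge (κ := κ) (κ' := κ') (n := n) hA
  set C := energyConst A κ κ' n with hCdef
  set z1 := localBackstepping k n u 1
  set D := normSq (localBacksteppingX k n u ux)
  set err := gainError (robinGain ε q lam) (fun x y => k x y - kh x y) u
  set b := (q + 1 + L) ^ 2 with hb
  have hb0 : 0 ≤ b := sq_nonneg _
  have n1 := normSq_nonneg u
  have n2 := normSq_nonneg ux
  have nD : 0 ≤ D := normSq_nonneg _
  have s1 := sq_nonneg (u 1)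
  have s0 := sq_nonneg (u 0)
  have hS : 0 ≤ z1 ^ 2 + D := by positivity
  have herr2 : err ^ 2 ≤ 1 / 2500 * (z1 ^ 2 + D) := by
    have e1 : b * normSq u + u 1 ^ 2 + u 0 ^ 2 + normSq ux
        ≤ (b + 1) * (C * (z1 ^ 2 + D)) := by
      have m1 := mul_le_mul_of_nonneg_left hE (by linarith : 0 ≤ b + 1)
      have m2 : 0 ≤ b * (u 1 ^ 2 + u 0 ^ 2 + normSq ux) + normSq u := by positivity
      linarith
    set G := 4 * (b + 1) * C with hG
    have hG0 : 0 ≤ G := by positivity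
    have hι2 : ι * (2500 * (1 + G)) < 1 := by
      rw [accuracyBound, ← hCdef, ← hb, ← hG, lt_div_iff₀ (by positivity)] at hι'
      exact hι'
    have hι1 : ι ≤ 1 := by linarith [mul_nonneg hι.le hG0]
    have hιG : ι ^ 2 * G ≤ 1 / 2500 := by
      have h1 : ι * G ≤ 1 / 2500 := by linarith
      have h2 : ι * (ι * G) ≤ 1 * (ι * G) := by gcongr
      linarith
    calc err ^ 2 ≤ 4 * ι ^ 2 * ((b + 1) * (C * (z1 ^ 2 + D))) := by
          refine herr.trans ?_
          gcongr
      _ = ι ^ 2 * G * (z1 ^ 2 + D) := by rw [hG]; ring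
      _ ≤ _ := by gcongr
  have hEE : 1 / (100 * C) * (normSq u + u 1 ^ 2 + u 0 ^ 2) ≤ 1 / 100 * (z1 ^ 2 + D) := by
    have : normSq u + u 1 ^ 2 + u 0 ^ 2 ≤ C * (z1 ^ 2 + D) := by linarith
    calc 1 / (100 * C) * (normSq u + u 1 ^ 2 + u 0 ^ 2)
        ≤ 1 / (100 * C) * (C * (z1 ^ 2 + D)) := by gcongr
      _ = _ := by field_simp
  refine hF.trans (mul_le_mul_of_nonneg_left ?_ hε.le)
  have y1 : -(z1 * err) ≤ 1 / 100 * z1 ^ 2 + 25 * err ^ 2 := by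
    linarith [sq_nonneg (z1 / 10 + 5 * err)]
  have y2 : -(z1 * d) ≤ 1 / 100 * z1 ^ 2 + 25 * d ^ 2 := by
    linarith [sq_nonneg (z1 / 10 + 5 * d)]
  linarith

/-! ### The pure and the localised transformation -/

lemma normSq_pow_mul_volterra_le {k : ℝ → ℝ → ℝ} {u : ℝ → ℝ} {κ : ℝ} (n : ℕ)
    (hk : Continuous (Function.uncurry k))
    (hκ : ∀ x y, (x, y) ∈ kernelTriangle → |k x y| ≤ κ * x)
    (hu : MemLp u 2 (volume.restrict (Icc (0 : ℝ) 1))) :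
    normSq (fun x => -(x ^ n * volterra k u x)) ≤ κ ^ 2 * normSq u / (2 * n + 4) := by
  have := normSq_le_of_abs_le (C := κ ^ 2 * normSq u) (p := 2 * n + 3)
    (memLp_pow_mul_volterra hk n hu) (fun x hx => by
      have h1 := sq_volterra_le hk hu hx (fun y hy => hκ x y ⟨hy.1, hy.2, hx.2⟩)
      calc (-(x ^ n * volterra k u x)) ^ 2 = (x ^ n) ^ 2 * volterra k u x ^ 2 := by ring
        _ ≤ (x ^ n) ^ 2 * ((κ * x) ^ 2 * x * normSq u) := by gcongr
        _ = _ := by ring)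
  refine this.trans_eq ?_
  push_cast
  ring

/-- For `n = 0` the energy identity has no error terms. -/
lemma IsNeumannProfile.energy_pure {u ux uxx lam : ℝ → ℝ} {k kh : ℝ → ℝ → ℝ}
    (h : IsNeumannProfile u ux uxx) {ε q L : ℝ} (hε : 0 < ε) (hq : q > L / (2 * ε) + 1 / 2)
    (hlam : ContinuousOn lam (Icc 0 1))
    (h0 : ∀ x ∈ Icc (0 : ℝ) 1, 0 ≤ lam x) (hL : ∀ x ∈ Icc (0 : ℝ) 1, lam x ≤ L)
    (hk : IsBacksteppingKernel ε lam k) (hkh : ContDiff ℝ 2 (Function.uncurry kh)) :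
    ∫ x in (0 : ℝ)..1, localBackstepping k 0 u x *
        localBackstepping k 0 (fun y => ε * uxx y + lam y * u y) x
      ≤ ε * (-(1 / 16) * normSq (localBackstepping k 0 u)
      - 1 / 20 * (localBackstepping k 0 u 1 ^ 2 + normSq (localBacksteppingX k 0 u ux))
      - localBackstepping k 0 u 1 *
        (gainError (robinGain ε q lam) (fun x y => k x y - kh x y) u
          + (feedback (controlGain ε q lam kh) u - (ux 1 + q * u 1)))) := by
  have hp := (robinGain_bounds hε hq hlam h0 hL).1
  rw [h.integral_localBackstepping_mul hε hlam hk 0, h.boundary_localBackstepping (q := q) hk hkh 0]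
  obtain ⟨-, hpo⟩ := trace_inequalities (h.continuousOn_localBacksteppingX hk.contDiff 0)
    fun x hx => h.hasDerivWithinAt_localBackstepping hk.contDiff 0 hx
  simp only [CharP.cast_eq_zero, zero_mul, intervalIntegral.integral_zero, pow_zero, sub_self,
    mul_zero, add_zero, sub_zero]
  refine mul_le_mul_of_nonneg_left ?_ hε.le
  have := normSq_nonneg (localBacksteppingX k 0 u ux)
  have := mul_le_mul_of_nonneg_right hp.le (sq_nonneg (localBackstepping k 0 u 1))
  linarith [sq_nonneg (localBackstepping k 0 u 1)]

lemma ContinuousOn.intervalIntegrable_unit {f : ℝ → ℝ} (hf : ContinuousOn f (Icc 0 1)) :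
    IntervalIntegrable f volume 0 1 :=
  ContinuousOn.intervalIntegrable (by rwa [uIcc_of_le zero_le_one])

lemma integral_add_sq {f g : ℝ → ℝ} (hf : ContinuousOn f (Icc 0 1))
    (hg : ContinuousOn g (Icc 0 1)) (a b : ℝ) :
    ∫ x in (0 : ℝ)..1, (a * f x ^ 2 + b * g x ^ 2) = a * normSq f + b * normSq g := by
  rw [normSq, normSq, ← intervalIntegral.integral_const_mul, ← intervalIntegral.integral_const_mul]
  exact intervalIntegral.integral_add
    (((hf.pow 2).const_mul a).intervalIntegrable_unit)
    (((hg.pow 2).const_mul b).intervalIntegrable_unit)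

/-- The error term of the energy identity with `(xⁿ)'` and the Volterra operator is small because the
factor `κ x` of the kernel compensates one factor `n`. -/
lemma localisation_transport_le {k : ℝ → ℝ → ℝ} {u f : ℝ → ℝ} {κ : ℝ} {n : ℕ} (hn : 1 ≤ n)
    (hk : Continuous (Function.uncurry k)) (hu : ContinuousOn u (Icc 0 1))
    (hf : ContinuousOn f (Icc 0 1))
    (hκ : ∀ x y, (x, y) ∈ kernelTriangle → |k x y| ≤ κ * x) (hnκ : n * κ ^ 2 ≤ 176 / 10000) :
    -(∫ x in (0 : ℝ)..1, n * x ^ (n - 1) * (volterra k u x * f x))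
      ≤ 22 / 1000 * normSq u + 1 / 10 * normSq f := by
  have nX := normSq_nonneg u
  have cn : ContinuousOn (fun x : ℝ => n * x ^ (n - 1)) (Icc 0 1) :=
    Continuous.continuousOn (by fun_prop)
  have cv := continuousOn_volterra hk hu.memLp_Icc
  have cf : ContinuousOn (fun x => n * x ^ (n - 1) * volterra k u x) (Icc 0 1) := cn.mul cv
  have e1 : normSq (fun x => n * x ^ (n - 1) * volterra k u x) ≤ 88 / 10000 * normSq u := by
    have := normSq_le_of_abs_le (C := n ^ 2 * κ ^ 2 * normSq u) (p := 2 * n + 1)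
      cf.memLp_Icc (fun x hx => by
        have h1 := sq_volterra_le hk hu.memLp_Icc hx
          (fun y hy => hκ x y ⟨hy.1, hy.2, hx.2⟩)
        calc (n * x ^ (n - 1) * volterra k u x) ^ 2
            = (n * x ^ (n - 1)) ^ 2 * volterra k u x ^ 2 := by ring
          _ ≤ (n * x ^ (n - 1)) ^ 2 * ((κ * x) ^ 2 * x * normSq u) := by gcongr
          _ = n ^ 2 * κ ^ 2 * normSq u * ((x ^ (n - 1) * x) ^ 2 * x) := by ring
          _ = n ^ 2 * κ ^ 2 * normSq u * x ^ (2 * n + 1) := by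
              rw [← pow_succ, Nat.sub_add_cancel hn]
              ring)
    refine this.trans ?_
    push_cast
    rw [div_le_iff₀ (by positivity)]
    have m1 : n * (n * κ ^ 2) * normSq u ≤ n * (176 / 10000) * normSq u := by gcongr
    linarith
  have e2 : -(∫ x in (0 : ℝ)..1, n * x ^ (n - 1) * (volterra k u x * f x))
      ≤ ∫ x in (0 : ℝ)..1, (5 / 2 * (n * x ^ (n - 1) * volterra k u x) ^ 2
        + 1 / 10 * f x ^ 2) := by
    rw [← intervalIntegral.integral_neg]
    refine intervalIntegral.integral_mono_on zero_le_one
      (cn.mul (cv.mul hf)).neg.intervalIntegrable_unit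
      (((cf.pow 2).const_mul _).add ((hf.pow 2).const_mul _)).intervalIntegrable_unit
      fun x _ => ?_
    linarith [sq_nonneg (5 * (n * x ^ (n - 1) * volterra k u x) + f x)]
  rw [integral_add_sq cf hf] at e2
  linarith

/-- The error term with `(xⁿ)'` and the derivative of the Volterra operator is bounded uniformly in `n`,
with a supremum bound `s` on the transformed profile. -/
lemma localisation_commutator_le {k : ℝ → ℝ → ℝ} {u : ℝ → ℝ} {κ κ' s : ℝ} {n : ℕ} (hn : 1 ≤ n)
    (hk : ContDiff ℝ 1 (Function.uncurry k)) (hu : ContinuousOn u (Icc 0 1))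
    (hκ : ∀ x y, (x, y) ∈ kernelTriangle → |k x y| ≤ κ * x)
    (hκ' : ∀ x y, (x, y) ∈ kernelTriangle → |partialX k x y| ≤ κ')
    (hκ1 : κ ≤ 53 / 1000) (hκ1' : κ' ≤ 56 / 1000)
    (hz : ∀ x ∈ Icc (0 : ℝ) 1, |localBackstepping k n u x| ≤ s)
    (hX : normSq u ≤ (1016 / 1000 * s) ^ 2) :
    ∫ x in (0 : ℝ)..1, n * x ^ (n - 1) * (localBackstepping k n u x * volterraX k u x)
      ≤ 113 / 1000 * s ^ 2 := by
  have hκ0 : 0 ≤ κ := by simpa using (abs_nonneg _).trans (hκ 1 0 (by simp [kernelTriangle]))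
  have hκ0' : 0 ≤ κ' := (abs_nonneg _).trans (hκ' 1 0 (by simp [kernelTriangle]))
  have hs0 : 0 ≤ s := (abs_nonneg _).trans (hz 0 (by simp))
  have nX := normSq_nonneg u
  have cn : ContinuousOn (fun x : ℝ => n * x ^ (n - 1)) (Icc 0 1) :=
    Continuous.continuousOn (by fun_prop)
  have cz : ContinuousOn (localBackstepping k n u) (Icc 0 1) :=
    IsNeumannProfile.continuousOn_localBackstepping hu hk.continuous n
  have cvx := continuousOn_volterraX hk hu
  -- the localisation `(xⁿ)'` has unit mass
  have hmass : ∫ x in (0 : ℝ)..1, (n : ℝ) * x ^ (n - 1) = 1 := by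
    rw [intervalIntegral.integral_const_mul, integral_pow, Nat.cast_sub hn]
    have : n ≠ 0 := by omega
    simp [this]
  have hv (x : ℝ) (hx : x ∈ Icc (0 : ℝ) 1) : |volterra k u x| ≤ 54 / 1000 * s := by
    refine abs_le_of_sq_le_sq ?_ (by positivity)
    have h1 := sq_volterra_le hk.continuous hu.memLp_Icc hx
      (fun y hy => hκ x y ⟨hy.1, hy.2, hx.2⟩)
    have hx3 : κ * x ≤ 53 / 1000 := by nlinarith [hx.1, hx.2]
    have hx4 : 0 ≤ κ * x := mul_nonneg hκ0 hx.1
    calc volterra k u x ^ 2 ≤ (κ * x) ^ 2 * x * normSq u := h1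
      _ ≤ (53 / 1000) ^ 2 * 1 * (1016 / 1000 * s) ^ 2 := by
          have := hx.2
          have := hx.1
          gcongr
      _ ≤ _ := by linarith [sq_nonneg s]
  have hu' (x : ℝ) (hx : x ∈ Icc (0 : ℝ) 1) : |u x| ≤ 1054 / 1000 * s := by
    have e : u x = localBackstepping k n u x + x ^ n * volterra k u x := by
      simp [localBackstepping]
    have h1 := abs_add_le (localBackstepping k n u x) (x ^ n * volterra k u x)
    have h2 : |x ^ n * volterra k u x| ≤ 1 * |volterra k u x| := by
      rw [abs_mul, abs_of_nonneg (pow_nonneg hx.1 n)]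
      have := pow_le_one₀ hx.1 hx.2 (n := n)
      gcongr
    rw [e]
    linarith [hz x hx, hv x hx]
  have hvx (x : ℝ) (hx : x ∈ Icc (0 : ℝ) 1) : |volterraX k u x| ≤ 113 / 1000 * s := by
    have h1 : |volterra (partialX k) u x| ≤ 56 / 1000 * (1016 / 1000 * s) := by
      refine abs_le_of_sq_le_sq ?_ (by positivity)
      refine (sq_volterra_le (continuous_partialX hk) hu.memLp_Icc hx
        (fun y hy => hκ' x y ⟨hy.1, hy.2, hx.2⟩)).trans ?_
      rw [mul_pow (56 / 1000 : ℝ)]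
      calc κ' ^ 2 * x * normSq u ≤ (56 / 1000) ^ 2 * 1 * (1016 / 1000 * s) ^ 2 := by
            have := hx.2
            have := hx.1
            gcongr
        _ = _ := by ring
    have h2 : |k x x * u x| ≤ 53 / 1000 * (1054 / 1000 * s) := by
      rw [abs_mul]
      have h3 : |k x x| ≤ 53 / 1000 :=
        (hκ x x ⟨hx.1, le_rfl, hx.2⟩).trans (by nlinarith [hx.1, hx.2])
      have := hu' x hx
      gcongr
    have h3 := abs_add_le (k x x * u x) (volterra (partialX k) u x)
    rw [volterraX]
    linarith
  calc ∫ x in (0 : ℝ)..1, n * x ^ (n - 1) * (localBackstepping k n u x * volterraX k u x)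
      ≤ ∫ x in (0 : ℝ)..1, n * x ^ (n - 1) * (s * (113 / 1000 * s)) := by
        refine intervalIntegral.integral_mono_on zero_le_one
          (cn.mul (cz.mul cvx)).intervalIntegrable_unit
          (cn.mul continuousOn_const).intervalIntegrable_unit fun x hx => ?_
        have h1 : 0 ≤ n * x ^ (n - 1) := mul_nonneg (by positivity) (pow_nonneg hx.1 _)
        have h2 : localBackstepping k n u x * volterraX k u x ≤ s * (113 / 1000 * s) := by
          refine (le_abs_self _).trans ?_
          rw [abs_mul]
          exact mul_le_mul (hz x hx) (hvx x hx) (abs_nonneg _) hs0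
        exact mul_le_mul_of_nonneg_left h2 h1
    _ = s * (113 / 1000 * s) := by
        rw [intervalIntegral.integral_mul_const, hmass, one_mul]
    _ = _ := by ring

/-- Localisation leaves the part `1 - xⁿ` of the reaction term, which is small with `L / ε`. -/
lemma localisation_reaction_le {ε L : ℝ} {lam u z : ℝ → ℝ} (n : ℕ) (hε : 0 < ε)
    (hlam : ContinuousOn lam (Icc 0 1)) (h0 : ∀ x ∈ Icc (0 : ℝ) 1, 0 ≤ lam x)
    (hL : ∀ x ∈ Icc (0 : ℝ) 1, lam x ≤ L) (hL1 : L / ε ≤ 1 / 10)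
    (hu : ContinuousOn u (Icc 0 1)) (hz : ContinuousOn z (Icc 0 1)) :
    ∫ x in (0 : ℝ)..1, lam x * (1 - x ^ n) * (u x * z x)
      ≤ ε * (1 / 20 * (normSq u + normSq z)) := by
  have hL0 : 0 ≤ L := (h0 0 (by simp)).trans (hL 0 (by simp))
  have cp : ContinuousOn (fun x : ℝ => x ^ n) (Icc 0 1) := (continuous_pow n).continuousOn
  have e1 : ∫ x in (0 : ℝ)..1, lam x * (1 - x ^ n) * (u x * z x)
      ≤ ∫ x in (0 : ℝ)..1, (L / 2 * u x ^ 2 + L / 2 * z x ^ 2) := by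
    refine intervalIntegral.integral_mono_on zero_le_one
      ((hlam.mul (continuousOn_const.sub cp)).mul (hu.mul hz)).intervalIntegrable_unit
      (((hu.pow 2).const_mul _).add ((hz.pow 2).const_mul _)).intervalIntegrable_unit
      fun x hx => ?_
    have p0 : 0 ≤ x ^ n := pow_nonneg hx.1 n
    have p1 : x ^ n ≤ 1 := pow_le_one₀ hx.1 hx.2
    have c0 : 0 ≤ lam x * (1 - x ^ n) := mul_nonneg (h0 x hx) (by linarith)
    have c1 : lam x * (1 - x ^ n) ≤ L * 1 :=
      mul_le_mul (hL x hx) (by linarith) (by linarith) hL0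
    have c2 : lam x * (1 - x ^ n) * (u x * z x)
        ≤ lam x * (1 - x ^ n) * ((u x ^ 2 + z x ^ 2) / 2) := by
      refine mul_le_mul_of_nonneg_left ?_ c0
      linarith [sq_nonneg (u x - z x)]
    have c3 : lam x * (1 - x ^ n) * ((u x ^ 2 + z x ^ 2) / 2)
        ≤ L * 1 * ((u x ^ 2 + z x ^ 2) / 2) := by gcongr
    linarith
  rw [integral_add_sq hu hz] at e1
  rw [div_le_iff₀ hε] at hL1
  have : L / 2 * (normSq u + normSq z) ≤ ε * (1 / 20) * (normSq u + normSq z) := by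
    have h1 : L / 2 ≤ ε * (1 / 20) := by linarith
    exact mul_le_mul_of_nonneg_right h1 (add_nonneg (normSq_nonneg _) (normSq_nonneg _))
  linarith

/-- When `L / ε` is small and `n` is of the order of `(ε / L)²`, the error terms of the energy
identity for the localised transformation are absorbed by the dissipation. -/
lemma IsNeumannProfile.energy_localised {u ux uxx lam : ℝ → ℝ} {k kh : ℝ → ℝ → ℝ}
    (h : IsNeumannProfile u ux uxx) {ε q L κ κ' : ℝ} {n : ℕ} (hε : 0 < ε)
    (hq : q > L / (2 * ε) + 1 / 2) (hlam : ContinuousOn lam (Icc 0 1))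
    (h0 : ∀ x ∈ Icc (0 : ℝ) 1, 0 ≤ lam x) (hL : ∀ x ∈ Icc (0 : ℝ) 1, lam x ≤ L)
    (hk : IsBacksteppingKernel ε lam k) (hkh : ContDiff ℝ 2 (Function.uncurry kh))
    (hL1 : L / ε ≤ 1 / 10) (hn : 1 ≤ n)
    (hκ : ∀ x y, (x, y) ∈ kernelTriangle → |k x y| ≤ κ * x)
    (hκ' : ∀ x y, (x, y) ∈ kernelTriangle → |partialX k x y| ≤ κ')
    (hκ1 : κ ≤ 53 / 1000) (hκ1' : κ' ≤ 56 / 1000) (hnκ : n * κ ^ 2 ≤ 176 / 10000)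
    (hlow : normSq u ≤ 1031 / 1000 * normSq (localBackstepping k n u)) :
    ∫ x in (0 : ℝ)..1, localBackstepping k n u x *
        localBackstepping k n (fun y => ε * uxx y + lam y * u y) x
      ≤ ε * (-(1 / 16) * normSq (localBackstepping k n u)
      - 1 / 20 * (localBackstepping k n u 1 ^ 2 + normSq (localBacksteppingX k n u ux))
      - localBackstepping k n u 1 *
        (gainError (robinGain ε q lam) (fun x y => k x y - kh x y) u
          + (feedback (controlGain ε q lam kh) u - (ux 1 + q * u 1)))) := by
  have hp := (robinGain_bounds hε hq hlam h0 hL).1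
  have hk1 : ContDiff ℝ 1 (Function.uncurry k) := hk.contDiff.of_le (by norm_num)
  have czx : ContinuousOn (localBacksteppingX k n u ux) (Icc 0 1) :=
    h.continuousOn_localBacksteppingX hk.contDiff n
  obtain ⟨htr, hpo⟩ := trace_inequalities czx
    fun x hx => h.hasDerivWithinAt_localBackstepping hk.contDiff n hx
  have nD := normSq_nonneg (localBacksteppingX k n u ux)
  have T1 := localisation_transport_le hn hk1.continuous h.cont czx hκ hnκ
  have T3 := localisation_reaction_le n hε hlam h0 hL hL1 h.cont
    (continuousOn_localBackstepping h.cont hk1.continuous n)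
  have hs2 := Real.sq_sqrt (x := 3 / 2 * localBackstepping k n u 1 ^ 2
    + 3 * normSq (localBacksteppingX k n u ux)) (by positivity)
  have T2 := localisation_commutator_le hn hk1 h.cont hκ hκ' hκ1 hκ1'
    (fun x hx => Real.abs_le_sqrt (htr x hx)) (by
      rw [mul_pow, hs2]
      linarith [sq_nonneg (localBackstepping k n u 1)])
  rw [hs2] at T2
  rw [h.integral_localBackstepping_mul hε hlam hk n,
    h.boundary_localBackstepping (q := q) hk hkh n]
  generalize localBackstepping k n u 1 = z1 at *
  have hpz := mul_le_mul_of_nonneg_right hp.le (sq_nonneg z1)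
  refine (add_le_add_right T3 _).trans ?_
  rw [← mul_add]
  refine mul_le_mul_of_nonneg_left ?_ hε.le
  linarith [sq_nonneg z1]

/-! ### Existence of the Lyapunov functional -/

/-- The squared norm of the transform `localBackstepping k n` is equivalent to the squared norm,
with constants `A` and `B`, and dissipated along the plant at rate `ε / 8`. -/
structure IsLyapunovTransform (ε q A B c : ℝ) (n : ℕ) (lam : ℝ → ℝ) (k kh : ℝ → ℝ → ℝ) :
    Prop where
  upper : ∀ u, MemLp u 2 (volume.restrict (Icc (0 : ℝ) 1)) →
    normSq (localBackstepping k n u) ≤ B * normSq u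
  lower : ∀ u ux uxx, IsNeumannProfile u ux uxx → normSq u ≤ A * normSq (localBackstepping k n u)
  dissipation : ∀ u ux uxx, IsNeumannProfile u ux uxx →
    ∫ x in (0 : ℝ)..1, localBackstepping k n u x *
        localBackstepping k n (fun y => ε * uxx y + lam y * u y) x
      ≤ ε * (-(1 / 16) * normSq (localBackstepping k n u)
        - c * (normSq u + u 1 ^ 2 + u 0 ^ 2)
        + 25 * (feedback (controlGain ε q lam kh) u - (ux 1 + q * u 1)) ^ 2)

/-- The backstepping transformation itself, `n = 0`. The constant `7072 / 10000` is an upper bound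
of `1 / √2`, the factor between the supremum of a kernel on the triangle and the norm of its
Volterra operator. -/
lemma isLyapunovTransform_pure {ε q L ι κ : ℝ} {lam : ℝ → ℝ} {k kh : ℝ → ℝ → ℝ} (hε : 0 < ε)
    (hq : q > L / (2 * ε) + 1 / 2) (hlam : ContinuousOn lam (Icc 0 1))
    (h0 : ∀ x ∈ Icc (0 : ℝ) 1, 0 ≤ lam x) (hL : ∀ x ∈ Icc (0 : ℝ) 1, lam x ≤ L)
    (hk : IsBacksteppingKernel ε lam k) (hkh : IsKernelApprox lam k kh ι)
    (hκ : ∀ x y, (x, y) ∈ kernelTriangle → |k x y| ≤ κ) (hι : 0 < ι)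
    (hι' : ι < accuracyBound ((1 + 7072 / 10000 * (κ * Real.exp κ)) ^ 2) κ
      (L / ε / 2 + L / ε * κ) q L 0) :
    IsLyapunovTransform ε q ((1 + 7072 / 10000 * (κ * Real.exp κ)) ^ 2)
      ((1 + 7072 / 10000 * κ) ^ 2)
      (1 / (100 * energyConst ((1 + 7072 / 10000 * (κ * Real.exp κ)) ^ 2) κ
        (L / ε / 2 + L / ε * κ) 0)) 0 lam k kh := by
  have hκ0 : 0 ≤ κ := (abs_nonneg _).trans (hκ 0 0 (by simp [kernelTriangle]))
  have hL0 : 0 ≤ L := (h0 0 (by simp)).trans (hL 0 (by simp))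
  have hkc := hk.contDiff.continuous
  have hlow (u ux uxx : ℝ → ℝ) (h : IsNeumannProfile u ux uxx) :
      normSq u ≤ (1 + 7072 / 10000 * (κ * Real.exp κ)) ^ 2 * normSq (localBackstepping k 0 u) := by
    have e : u = fun x => localBackstepping k 0 u x + volterra k u x := by
      funext x; simp [localBackstepping]
    have e' : localBackstepping k 0 u = fun x => u x - volterra k u x := by
      funext x; simp [localBackstepping]
    have h1 := normSq_volterra_le_of_gronwall hkc h.cont hκ
    rw [← e'] at h1
    conv_lhs => rw [e]
    refine normSq_add_le (by positivity) (memLp_localBackstepping hkc 0 h.cont.memLp_Icc)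
      (continuousOn_volterra hkc h.cont.memLp_Icc).memLp_Icc (h1.trans ?_)
    have := normSq_nonneg (localBackstepping k 0 u)
    gcongr
    rw [mul_pow]
    have := sq_nonneg (κ * Real.exp κ)
    linarith
  refine ⟨fun u hu => ?_, hlow, fun u ux uxx h => ?_⟩
  · rw [localBackstepping_eq_add]
    refine normSq_add_le (by positivity) hu (memLp_pow_mul_volterra hkc 0 hu) ?_
    have := normSq_le_of_abs_le (C := κ ^ 2 * normSq u) (p := 1) (memLp_pow_mul_volterra hkc 0 hu)
      (fun x hx => by
        have := sq_volterra_le hkc hu hx (fun y hy => hκ x y ⟨hy.1, hy.2, hx.2⟩)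
        simp only [pow_zero, one_mul, neg_sq, pow_one]
        linarith)
    refine this.trans ?_
    have := mul_nonneg (sq_nonneg κ) (normSq_nonneg u)
    rw [mul_pow]
    norm_num
    linarith
  · refine h.dissipation hε hk.contDiff h0 hL hkh (robinGain_bounds hε hq hlam h0 hL).2 hκ
      (fun x y hxy => ?_) (by positivity) (hlow u ux uxx h) hι hι'
      (h.energy_pure hε hq hlam h0 hL hk hkh.contDiff)
    refine (hk.bounds_of_const_bound hε hlam h0 hL hκ hxy).1.trans ?_
    have h1 : x ≤ 1 := hxy.2.2
    have h2 : 0 ≤ L / ε * κ := by positivity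
    have := mul_le_mul_of_nonneg_left h1 h2
    linarith

/-- The localised transformation differs from the identity by an operator of norm at most
`3/2 (L / ε)²`. -/
lemma isLyapunovTransform_localised {ε q L ι : ℝ} {n : ℕ} {lam : ℝ → ℝ} {k kh : ℝ → ℝ → ℝ}
    (hε : 0 < ε) (hq : q > L / (2 * ε) + 1 / 2) (hlam : ContinuousOn lam (Icc 0 1))
    (h0 : ∀ x ∈ Icc (0 : ℝ) 1, 0 ≤ lam x) (hL : ∀ x ∈ Icc (0 : ℝ) 1, lam x ≤ L)
    (hk : IsBacksteppingKernel ε lam k) (hkh : IsKernelApprox lam k kh ι)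
    (hL1 : L / ε ≤ 1 / 10) (hn : 1 ≤ n)
    (hn1 : (L / ε) ^ 2 ≤ 16 * (L / ε) ^ 4 * (n + 2)) (hn2 : 16 * (L / ε) ^ 2 * n ≤ 1) (hι : 0 < ι)
    (hι' : ι < accuracyBound (1 / (1 - 3 / 2 * (L / ε) ^ 2) ^ 2) (53 / 100 * (L / ε))
      (56 / 100 * (L / ε)) q L n) :
    IsLyapunovTransform ε q (1 / (1 - 3 / 2 * (L / ε) ^ 2) ^ 2) ((1 + 3 / 2 * (L / ε) ^ 2) ^ 2)
      (1 / (100 * energyConst (1 / (1 - 3 / 2 * (L / ε) ^ 2) ^ 2) (53 / 100 * (L / ε))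
      (56 / 100 * (L / ε)) n)) n lam k kh := by
  have hL0 : 0 ≤ L := (h0 0 (by simp)).trans (hL 0 (by simp))
  have hkc := hk.contDiff.continuous
  set l := L / ε with hl
  have hl0 : 0 ≤ l := div_nonneg hL0 hε.le
  have hl2 : l ^ 2 ≤ 1 / 100 := by nlinarith
  have hκ0 (x y : ℝ) (hxy : (x, y) ∈ kernelTriangle) : |k x y| ≤ 5264 / 10000 * l := by
    refine (hk.abs_le_of_small hε hlam h0 hL (by linarith) hxy).trans ?_
    rw [← hl, div_le_iff₀ (by linarith)]
    nlinarith
  have hb (x y : ℝ) (hxy : (x, y) ∈ kernelTriangle) :=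
    hk.bounds_of_const_bound hε hlam h0 hL hκ0 hxy
  have hκ (x y : ℝ) (hxy : (x, y) ∈ kernelTriangle) : |k x y| ≤ 53 / 100 * l * x := by
    refine (hb x y hxy).2.trans ?_
    have hx1 : x ≤ 1 := hxy.2.2
    have hx0 : 0 ≤ x := hxy.1.trans hxy.2.1
    have hx2 : x ^ 2 ≤ x := by nlinarith
    have e1 : l * (5264 / 10000 * l) ≤ l * (5264 / 100000) :=
      mul_le_mul_of_nonneg_left (by linarith) hl0
    have e2 : l * (5264 / 10000 * l) * (x ^ 2 / 2) ≤ l * (5264 / 100000) * (x / 2) := by gcongr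
    have e3 := mul_nonneg hl0 hx0
    rw [← hl]
    linarith
  have hκ' (x y : ℝ) (hxy : (x, y) ∈ kernelTriangle) : |partialX k x y| ≤ 56 / 100 * l := by
    refine (hb x y hxy).1.trans ?_
    have hx1 : x ≤ 1 := hxy.2.2
    have hx0 : 0 ≤ x := hxy.1.trans hxy.2.1
    have e1 : l * (5264 / 10000 * l) ≤ l * (5264 / 100000) :=
      mul_le_mul_of_nonneg_left (by linarith) hl0
    have e2 : l * (5264 / 10000 * l) * x ≤ l * (5264 / 100000) * 1 := by gcongr
    rw [← hl]
    linarith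
  have hκ1 (x y : ℝ) (hxy : (x, y) ∈ kernelTriangle) : |k x y| ≤ 53 / 100 * l := by
    refine (hκ x y hxy).trans ?_
    have hx1 : x ≤ 1 := hxy.2.2
    have := mul_le_mul_of_nonneg_left hx1 hl0
    linarith
  have hr (u : ℝ → ℝ) (hu : MemLp u 2 (volume.restrict (Icc (0 : ℝ) 1))) :
      normSq (fun x => -(x ^ n * volterra k u x)) ≤ (3 / 2 * l ^ 2) ^ 2 * normSq u := by
    refine (normSq_pow_mul_volterra_le n hkc hκ hu).trans ?_
    rw [div_le_iff₀ (by positivity)]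
    have e : (53 / 100 * l) ^ 2 ≤ (3 / 2 * l ^ 2) ^ 2 * (2 * n + 4) := by nlinarith
    have := mul_le_mul_of_nonneg_right e (normSq_nonneg u)
    linarith
  have hpos : 0 < (1 - 3 / 2 * l ^ 2) ^ 2 := by
    have : 0 < 1 - 3 / 2 * l ^ 2 := by linarith
    positivity
  have hlow (u ux uxx : ℝ → ℝ) (h : IsNeumannProfile u ux uxx) :
      normSq u ≤ 1 / (1 - 3 / 2 * l ^ 2) ^ 2 * normSq (localBackstepping k n u) := by
    rw [one_div, ← div_eq_inv_mul, le_div_iff₀ hpos, mul_comm, localBackstepping_eq_add]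
    exact le_normSq_add (by positivity) (by linarith) h.cont.memLp_Icc
      (memLp_pow_mul_volterra hkc n h.cont.memLp_Icc) (hr u h.cont.memLp_Icc)
  refine ⟨fun u hu => ?_, hlow, fun u ux uxx h => ?_⟩
  · rw [localBackstepping_eq_add]
    exact normSq_add_le (by positivity) hu (memLp_pow_mul_volterra hkc n hu) (hr u hu)
  · refine h.dissipation hε hk.contDiff h0 hL hkh (robinGain_bounds hε hq hlam h0 hL).2 hκ1
      hκ' (by positivity) (hlow u ux uxx h) hι hι'
      (h.energy_localised hε hq hlam h0 hL hk hkh.contDiff hL1 hn hκ hκ' (by linarith)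
        (by linarith) (by nlinarith) ((hlow u ux uxx h).trans ?_))
    refine mul_le_mul_of_nonneg_right ?_ (normSq_nonneg _)
    rw [div_le_iff₀ hpos]
    nlinarith

/-- The order of localisation: `n` is `1 / (16 l²)` up to rounding. -/
lemma exists_localisation {l : ℝ} (hl : 0 ≤ l) (hl1 : l ≤ 1 / 10) :
    ∃ n : ℕ, 1 ≤ n ∧ l ^ 2 ≤ 16 * l ^ 4 * (n + 2) ∧ 16 * l ^ 2 * n ≤ 1 := by
  rcases hl.eq_or_lt with rfl | hpos
  · exact ⟨1, le_rfl, by norm_num, by norm_num⟩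
  · have hp : 0 < 16 * l ^ 2 := by positivity
    have h1 : 1 ≤ 1 / (16 * l ^ 2) := by
      rw [le_div_iff₀ hp]
      nlinarith
    refine ⟨⌊1 / (16 * l ^ 2)⌋₊, (Nat.one_le_floor_iff _).2 h1, ?_, ?_⟩
    · have h2 := (Nat.lt_floor_add_one (1 / (16 * l ^ 2))).le
      rw [div_le_iff₀ hp] at h2
      nlinarith [mul_nonneg hl hl]
    · have h2 := Nat.floor_le (zero_le_one.trans h1)
      rw [le_div_iff₀ hp] at h2
      linarith

/-- Unless `L / ε` is small, the kernel is bounded by a fifth of `kernelBound`. -/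
lemma exists_kernel_bound_le {ε L : ℝ} (hε : 0 < ε)
    (hL1 : 1 / 10 ≤ L / ε) : ∃ κ, 0 ≤ κ ∧ κ ≤ kernelBound ε L / 5 ∧
    ∀ lam k, ContinuousOn lam (Icc 0 1) → (∀ x ∈ Icc (0 : ℝ) 1, 0 ≤ lam x) →
      (∀ x ∈ Icc (0 : ℝ) 1, lam x ≤ L) → IsBacksteppingKernel ε lam k →
      ∀ x y, (x, y) ∈ kernelTriangle → |k x y| ≤ κ := by
  have hL0 : 0 ≤ L := by
    have := (div_pos_iff_of_pos_right hε).1 (by linarith : 0 < L / ε)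
    exact this.le
  rcases le_total (L / ε) 1 with h | h
  · refine ⟨L / ε / 2 / (1 - L / ε / 2), div_nonneg (by positivity) (by linarith), ?_,
      fun lam k hlam h0 hL hk x y hxy => hk.abs_le_of_small hε hlam h0 hL h hxy⟩
    have h1 := two_mul_div_le_kernelBound hε hL0
    rw [div_le_iff₀ (by linarith)]
    have h2 : 5 / 4 ≤ (1 + 4 * (L / ε)) * (1 - L / ε / 2) := by nlinarith
    have h3 : 2 * (L / ε) * (5 / 4) ≤ 2 * (L / ε) * ((1 + 4 * (L / ε)) * (1 - L / ε / 2)) := by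
      gcongr
    have h4 := mul_le_mul_of_nonneg_right h1 (by linarith : 0 ≤ 1 - L / ε / 2)
    linarith
  · refine ⟨9 / 16 * (L / ε) * Real.exp (3 * (L / ε)), by positivity, ?_,
      fun lam k hlam h0 hL hk x y hxy => hk.abs_le_of_large hε hlam h0 hL h hxy⟩
    have h1 : Real.exp (4 * L / ε) = Real.exp (L / ε) * Real.exp (3 * (L / ε)) := by
      rw [← Real.exp_add]
      ring_nf
    have h2 := Real.add_one_le_exp (L / ε)
    rw [kernelBound, h1, show 2 * L / ε = 2 * (L / ε) by ring]
    have h3 : 2 * Real.exp (3 * (L / ε)) ≤ Real.exp (L / ε) * Real.exp (3 * (L / ε)) := by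
      gcongr
      linarith
    have h4 := mul_le_mul_of_nonneg_left h3 (by positivity : 0 ≤ 2 * (L / ε) / 5)
    have h5 : 0 ≤ L / ε * Real.exp (3 * (L / ε)) := by positivity
    linarith

/-- Existence of a Lyapunov transform, with constants that depend only on `ε`, `q`, `L` and whose
condition number is compatible with the overshoot constant. -/
theorem exists_isLyapunovTransform {ε q L : ℝ} (hε : 0 < ε) (hL0 : 0 ≤ L)
    (hq : q > L / (2 * ε) + 1 / 2) :
    ∃ (n : ℕ) (A B c ιs : ℝ), 0 < A ∧ 0 < B ∧ 0 < c ∧ 0 < ιs ∧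
      A * B ≤ (1 + kernelBound ε L ^ 2) *
        (1 + (kernelBound ε L * Real.exp (kernelBound ε L)) ^ 2) ∧
      ∀ lam k kh ι, ContinuousOn lam (Icc 0 1) → (∀ x ∈ Icc (0 : ℝ) 1, 0 ≤ lam x) →
        (∀ x ∈ Icc (0 : ℝ) 1, lam x ≤ L) → IsBacksteppingKernel ε lam k →
        IsKernelApprox lam k kh ι → 0 < ι → ι < ιs → IsLyapunovTransform ε q A B c n lam k kh := by
  have hacc (A κ κ' : ℝ) (n : ℕ) (hA : 0 ≤ A) : 0 < accuracyBound A κ κ' q L n ∧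
      0 < 1 / (100 * energyConst A κ κ' n) := by
    have := energyConst_ge (κ := κ) (κ' := κ') (n := n) hA
    have h1 : 0 ≤ (q + 1 + L) ^ 2 := sq_nonneg _
    rw [accuracyBound]
    constructor <;> positivity
  set a := kernelBound ε L with ha
  have hal := two_mul_div_le_kernelBound hε hL0
  rw [← ha] at hal
  have hl0 : 0 ≤ L / ε := div_nonneg hL0 hε.le
  have ha2 : 2 * (L / ε) ≤ a := by nlinarith
  have haexp : a ≤ a * Real.exp a := by
    have := Real.one_le_exp (by linarith : 0 ≤ a)
    nlinarith
  rcases le_total (L / ε) (1 / 10) with hL1 | hL1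
  · obtain ⟨n, hn, hn1, hn2⟩ := exists_localisation hl0 hL1
    have hl2 : (L / ε) ^ 2 ≤ 1 / 100 := by nlinarith
    have hpos : 0 < (1 - 3 / 2 * (L / ε) ^ 2) ^ 2 := by
      have : 0 < 1 - 3 / 2 * (L / ε) ^ 2 := by linarith
      positivity
    obtain ⟨h1, h2⟩ := hacc (1 / (1 - 3 / 2 * (L / ε) ^ 2) ^ 2) (53 / 100 * (L / ε))
      (56 / 100 * (L / ε)) n (by positivity)
    refine ⟨n, _, _, _, _, by positivity, by positivity, h2, h1, ?_,
      fun lam k kh ι hlam h0 hL hk hkh hι hι' =>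
        isLyapunovTransform_localised hε hq hlam h0 hL hk hkh hL1 hn hn1 hn2 hι hι'⟩
    have e1 : 1 + 8 * (L / ε) ^ 2 ≤ (1 + a ^ 2) * (1 + (a * Real.exp a) ^ 2) := by
      have e2 : (2 * (L / ε)) ^ 2 ≤ a ^ 2 := pow_le_pow_left₀ (by positivity) ha2 2
      have e3 : a ^ 2 ≤ (a * Real.exp a) ^ 2 := pow_le_pow_left₀ (by linarith) haexp 2
      have e4 := mul_nonneg (sq_nonneg a) (sq_nonneg (a * Real.exp a))
      linarith
    refine le_trans ?_ e1
    rw [one_div, ← div_eq_inv_mul, div_le_iff₀ hpos]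
    have hs := sq_nonneg (L / ε)
    generalize (L / ε) ^ 2 = s at *
    -- `(1 + 8 s) (1 - 3 s / 2)² - (1 + 3 s / 2)² = s (2 - 24 s + 18 s²)`
    nlinarith [mul_nonneg hs (by linarith : 0 ≤ 1 - 100 * s), mul_nonneg hs (mul_nonneg hs hs)]
  · obtain ⟨κ, hκ0, hκa, hκ⟩ := exists_kernel_bound_le hε hL1
    obtain ⟨h1, h2⟩ := hacc ((1 + 7072 / 10000 * (κ * Real.exp κ)) ^ 2) κ
      (L / ε / 2 + L / ε * κ) 0 (by positivity)
    refine ⟨0, _, _, _, _, by positivity, by positivity, h2, h1, ?_,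
      fun lam k kh ι hlam h0 hL hk hkh hι hι' =>
        isLyapunovTransform_pure hε hq hlam h0 hL hk hkh (hκ lam k hlam h0 hL hk) hι hι'⟩
    have ha3 : 298 / 1000 ≤ a := kernelBound_ge hL1
    rw [← ha] at hκa
    have e1 : (1 + 7072 / 10000 * κ) ^ 2 ≤ 1 + a ^ 2 :=
      sq_one_add_le (by positivity) (by linarith) ha3
    have e2 : κ * Real.exp κ ≤ a / 5 * Real.exp a := by
      gcongr
      linarith
    have e3 : (1 + 7072 / 10000 * (κ * Real.exp κ)) ^ 2 ≤ 1 + (a * Real.exp a) ^ 2 :=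
      sq_one_add_le (by positivity) (by linarith) (by linarith)
    rw [mul_comm]
    gcongr

/-! ### Evolution under a constant input -/

lemma tendsto_normSq_of_sub {ι : Type*} {l : Filter ι} {f : ι → ℝ → ℝ} {g : ℝ → ℝ}
    (hf : ∀ᶠ i in l, MemLp (f i) 2 (volume.restrict (Icc (0 : ℝ) 1)))
    (hg : MemLp g 2 (volume.restrict (Icc (0 : ℝ) 1)))
    (h : Tendsto (fun i => normSq (fun x => f i x - g x)) l (𝓝 0)) :
    Tendsto (fun i => normSq (f i)) l (𝓝 (normSq g)) := by
  have hs : Tendsto (fun i => 2 * (√(normSq g) * √(normSq (fun x => f i x - g x)))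
      + normSq (fun x => f i x - g x)) l (𝓝 0) := by
    have := ((h.sqrt.const_mul (√(normSq g))).const_mul 2).add h
    simpa using this
  rw [tendsto_iff_dist_tendsto_zero]
  refine squeeze_zero' (Eventually.of_forall fun _ => dist_nonneg) ?_ hs
  filter_upwards [hf] with i hi
  have hd : MemLp (fun x => f i x - g x) 2 (volume.restrict (Icc (0 : ℝ) 1)) := hi.sub hg
  have e : normSq (f i) = normSq (fun x => g x + (f i x - g x)) := by simp
  have h1 := Real.abs_le_sqrt (sq_integral_mul_le_normSq hg hd)
  rw [Real.sqrt_mul (normSq_nonneg g)] at h1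
  rw [Real.dist_eq, e, normSq_add hg hd]
  have h2 := normSq_nonneg (fun x => f i x - g x)
  rw [abs_le] at *
  constructor <;> linarith [h1.1, h1.2]

lemma localBackstepping_congr {k : ℝ → ℝ → ℝ} {n : ℕ} {u v : ℝ → ℝ}
    (h : ∀ x ∈ Icc (0 : ℝ) 1, u x = v x) {x : ℝ} (hx : x ∈ Icc (0 : ℝ) 1) :
    localBackstepping k n u x = localBackstepping k n v x := by
  rw [localBackstepping, localBackstepping, h x hx, volterra_congr h hx]

lemma localBackstepping_sub {k : ℝ → ℝ → ℝ} (hk : Continuous (Function.uncurry k)) (n : ℕ)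
    {u v : ℝ → ℝ} (hu : MemLp u 2 (volume.restrict (Icc (0 : ℝ) 1)))
    (hv : MemLp v 2 (volume.restrict (Icc (0 : ℝ) 1))) {x : ℝ} (hx : x ∈ Icc (0 : ℝ) 1) :
    localBackstepping k n (fun x => u x - v x) x
      = localBackstepping k n u x - localBackstepping k n v x := by
  have e : volterra k (fun x => u x - v x) x = volterra k u x - volterra k v x := by
    rw [volterra, volterra, volterra, ← intervalIntegral.integral_sub
      (MemLp.intervalIntegrable_mul (hk.memLp_section x) hu (by simp) hx)
      (MemLp.intervalIntegrable_mul (hk.memLp_section x) hv (by simp) hx)]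
    exact intervalIntegral.integral_congr fun y _ => by ring
  rw [localBackstepping, localBackstepping, localBackstepping, e]
  ring

namespace IsHeldSolution

variable {ε q a U : ℝ} {lam K : ℝ → ℝ} {v k : ℝ → ℝ → ℝ}

lemma continuousOn_energy (hv : IsHeldSolution ε q lam a U v)
    (hk : Continuous (Function.uncurry k)) {n : ℕ} {B : ℝ}
    (hB : ∀ u, MemLp u 2 (volume.restrict (Icc (0 : ℝ) 1)) →
      normSq (localBackstepping k n u) ≤ B * normSq u) :
    ContinuousOn (fun t => normSq (localBackstepping k n (v t))) (Ici a) := by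
  intro t ht
  have hev : ∀ᶠ s in 𝓝[Ici a] t, s ∈ Ici a := self_mem_nhdsWithin
  refine tendsto_normSq_of_sub (f := fun s => localBackstepping k n (v s)) ?_
    (memLp_localBackstepping hk n (hv.memLp t ht)) ?_
  · filter_upwards [hev] with s hs
    exact memLp_localBackstepping hk n (hv.memLp s hs)
  · have h0 : Tendsto (fun s => B * normSq (fun x => v s x - v t x)) (𝓝[Ici a] t) (𝓝 0) := by
      simpa using (hv.continuous_L2 t ht).const_mul B
    refine squeeze_zero' (Eventually.of_forall fun _ => normSq_nonneg _) ?_ h0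
    filter_upwards [hev] with s hs
    rw [← normSq_congr fun x hx => localBackstepping_sub hk n (hv.memLp s hs) (hv.memLp t ht) hx]
    exact hB _ ((hv.memLp s hs).sub (hv.memLp t ht))

lemma feedback_sub (hK : ContinuousOn K (Icc 0 1)) {f g : ℝ → ℝ}
    (hf : MemLp f 2 (volume.restrict (Icc (0 : ℝ) 1)))
    (hg : MemLp g 2 (volume.restrict (Icc (0 : ℝ) 1))) :
    feedback K (fun x => f x - g x) = feedback K f - feedback K g := by
  rw [feedback, feedback, feedback, ← intervalIntegral.integral_sub
    (MemLp.intervalIntegrable_mul hK.memLp_Icc hf (by simp) (by simp))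
    (MemLp.intervalIntegrable_mul hK.memLp_Icc hg (by simp) (by simp))]
  exact intervalIntegral.integral_congr fun y _ => by ring

lemma deviation_eq (hv : IsHeldSolution ε q lam a U v) (hK : ContinuousOn K (Icc 0 1)) {t : ℝ}
    (ht : a ≤ t) : deviation K a v t = feedback K (v t) - feedback K (v a) :=
  feedback_sub hK (hv.memLp t ht) (hv.memLp a le_rfl)

lemma continuousOn_deviation (hv : IsHeldSolution ε q lam a U v) (hK : ContinuousOn K (Icc 0 1)) :
    ContinuousOn (deviation K a v) (Ici a) := by
  intro t ht
  rw [ContinuousWithinAt, tendsto_iff_dist_tendsto_zero]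
  have h0 : Tendsto (fun s => √(normSq K) * √(normSq (fun x => v s x - v t x)))
      (𝓝[Ici a] t) (𝓝 0) := by
    simpa using (hv.continuous_L2 t ht).sqrt.const_mul (√(normSq K))
  refine squeeze_zero' (Eventually.of_forall fun _ => dist_nonneg) ?_ h0
  filter_upwards [self_mem_nhdsWithin] with s hs
  rw [Real.dist_eq, hv.deviation_eq hK hs, hv.deviation_eq hK ht, sub_sub_sub_cancel_right,
    ← feedback_sub hK (hv.memLp s hs) (hv.memLp t ht), ← Real.sqrt_mul (normSq_nonneg K)]
  exact Real.abs_le_sqrt (sq_integral_mul_le_normSq hK.memLp_Icc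
    ((hv.memLp s hs).sub (hv.memLp t ht)))

/-- At each positive time, the solution is a classical profile, and the functionals of interest
are differentiated under the integral sign. -/
lemma exists_profile (hv : IsHeldSolution ε q lam a U v) {t : ℝ} (ht : a < t) :
    ∃ ux uxx : ℝ → ℝ, IsNeumannProfile (v t) ux uxx ∧ ux 1 + q * v t 1 = U ∧
      (∀ (k : ℝ → ℝ → ℝ) (n : ℕ), Continuous (Function.uncurry k) →
        HasDerivAt (fun s => normSq (localBackstepping k n (v s)))
          (2 * ∫ x in (0 : ℝ)..1, localBackstepping k n (v t) x *
            localBackstepping k n (fun y => ε * uxx y + lam y * v t y) x) t) ∧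
      ∀ K, ContinuousOn K (Icc 0 1) → HasDerivAt (fun s => feedback K (v s))
        (feedback K (fun y => ε * uxx y + lam y * v t y)) t := by
  obtain ⟨vt, vx, vxx, cv, cvt, cvx, cvxx, hcl⟩ := hv.classical
  have sec {f : ℝ → ℝ → ℝ} (hf : ContinuousOn (Function.uncurry f) (Ioi a ×ˢ Icc (0 : ℝ) 1))
      {s : ℝ} (hs : a < s) : ContinuousOn (f s) (Icc 0 1) :=
    hf.comp (f := fun x => (s, x)) (Continuous.prodMk_right s).continuousOn
      (fun x hx => ⟨hs, hx⟩)
  obtain ⟨hpt, hneu, hrob⟩ := hcl t ht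
  set S : Set ℝ := Icc ((a + t) / 2) (t + 1) with hS
  have hSa (s : ℝ) (hs : s ∈ S) : a < s := by linarith [hs.1]
  have hSt : S ∈ 𝓝 t := Icc_mem_nhds (by linarith) (by linarith)
  have hSc : S ×ˢ Icc (0 : ℝ) 1 ⊆ Ioi a ×ˢ Icc (0 : ℝ) 1 :=
    prod_mono_left fun s hs => hSa s hs
  have bd {f : ℝ → ℝ → ℝ} (hf : ContinuousOn (Function.uncurry f) (Ioi a ×ˢ Icc (0 : ℝ) 1)) :
      ∃ C, 0 ≤ C ∧ ∀ s ∈ S, ∀ x ∈ Icc (0 : ℝ) 1, |f s x| ≤ C := by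
    obtain ⟨C, hC⟩ := ((isCompact_Icc (a := (a + t) / 2) (b := t + 1)).prod
      (isCompact_Icc (a := (0 : ℝ)) (b := 1))).exists_bound_of_continuousOn (hf.mono hSc)
    exact ⟨|C|, abs_nonneg _, fun s hs x hx => (hC (s, x) ⟨hs, hx⟩).trans (le_abs_self C)⟩
  obtain ⟨C₀, hC₀0, hC₀⟩ := bd cv
  obtain ⟨C₁, hC₁0, hC₁⟩ := bd cvt
  have hvteq (x : ℝ) (hx : x ∈ Icc (0 : ℝ) 1) : vt t x = ε * vxx t x + lam x * v t x :=
    (hpt x hx).2.2.2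
  refine ⟨vx t, vxx t, ⟨sec cv ht, sec cvx ht, sec cvxx ht, fun x hx => (hpt x hx).2.1,
    fun x hx => (hpt x hx).2.2.1, hneu⟩, hrob, fun k n hk => ?_, fun K hK => ?_⟩
  · obtain ⟨Ck, hCk⟩ := (isCompact_Icc (a := ((0, 0) : ℝ × ℝ))
      (b := (1, 1))).exists_bound_of_continuousOn hk.continuousOn
    have hCk0 : 0 ≤ Ck := (norm_nonneg _).trans (hCk (0, 0) (by simp))
    have hkb (x y : ℝ) (hx : x ∈ Icc (0 : ℝ) 1) (hy : y ∈ Icc (0 : ℝ) x) : |k x y| ≤ Ck :=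
      hCk (x, y) ⟨⟨hx.1, hy.1⟩, ⟨hx.2, hy.2.trans hx.2⟩⟩
    have bT {f : ℝ → ℝ} {C : ℝ} (hC : 0 ≤ C) (hf : ∀ x ∈ Icc (0 : ℝ) 1, |f x| ≤ C) (x : ℝ)
        (hx : x ∈ Icc (0 : ℝ) 1) : |localBackstepping k n f x| ≤ C + Ck * C := by
      have h1 : |volterra k f x| ≤ Ck * C * |x - 0| := by
        refine intervalIntegral.norm_integral_le_of_norm_le_const (E := ℝ)
          (f := fun y => k x y * f y) fun y hy => ?_
        rw [uIoc_of_le hx.1] at hy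
        rw [norm_mul]
        exact mul_le_mul (hkb x y hx ⟨hy.1.le, hy.2⟩) (hf y ⟨hy.1.le, hy.2.trans hx.2⟩)
          (norm_nonneg _) hCk0
      rw [sub_zero, abs_of_nonneg hx.1] at h1
      have h2 : |x ^ n * volterra k f x| ≤ 1 * (Ck * C * 1) := by
        rw [abs_mul, abs_of_nonneg (pow_nonneg hx.1 n)]
        refine mul_le_mul (pow_le_one₀ hx.1 hx.2) (h1.trans ?_) (abs_nonneg _) zero_le_one
        exact mul_le_mul_of_nonneg_left hx.2 (mul_nonneg hCk0 hC)
      have h3 := abs_sub (f x) (x ^ n * volterra k f x)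
      rw [localBackstepping]
      linarith [hf x hx]
    have hTd (s : ℝ) (hs : a < s) (hsS : S ∈ 𝓝 s) (x : ℝ) (hx : x ∈ Icc (0 : ℝ) 1) :
        HasDerivAt (fun s => localBackstepping k n (v s) x) (localBackstepping k n (vt s) x) s := by
      have hsub : uIcc 0 x ⊆ Icc (0 : ℝ) 1 := uIcc_subset_Icc (by simp) hx
      have hkx : ContinuousOn (k x) (uIcc 0 x) := (hk.comp (Continuous.prodMk_right x)).continuousOn
      have h1 : HasDerivAt (fun s => volterra k (v s) x) (volterra k (vt s) x) s := by
        refine hasDerivAt_integral_of_bounded (φ := fun s y => k x y * v s y)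
          (φ' := fun s y => k x y * vt s y) (C := Ck * C₁) hsS ?_ ?_ ?_ ?_
        · exact fun r hr => hkx.mul ((sec cv (hSa r hr)).mono hsub)
        · exact hkx.mul ((sec cvt hs).mono hsub)
        · intro r hr y hy
          have hy' := hsub hy
          rw [uIcc_of_le hx.1] at hy
          rw [abs_mul]
          exact mul_le_mul (hkb x y hx hy) (hC₁ r hr y hy') (abs_nonneg _) hCk0
        · exact fun r hr y hy => (((hcl r (hSa r hr)).1 y (hsub hy)).1).const_mul _
      exact ((hcl s hs).1 x hx).1.sub (h1.const_mul _)
    -- a smaller neighbourhood, each point of which has `S` as a neighbourhood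
    have hS' : Ioo ((a + t) / 2) (t + 1) ∈ 𝓝 t := Ioo_mem_nhds (by linarith) (by linarith)
    have huI : uIcc (0 : ℝ) 1 = Icc 0 1 := uIcc_of_le zero_le_one
    have h2 : HasDerivAt (fun s => normSq (localBackstepping k n (v s)))
        (∫ x in (0 : ℝ)..1, 2 * localBackstepping k n (v t) x * localBackstepping k n (vt t) x)
        t := by
      refine hasDerivAt_integral_of_bounded (φ := fun s x => localBackstepping k n (v s) x ^ 2)
        (φ' := fun s x => 2 * localBackstepping k n (v s) x * localBackstepping k n (vt s) x)
        (C := 2 * (C₀ + Ck * C₀) * (C₁ + Ck * C₁)) hS' ?_ ?_ ?_ ?_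
      · intro r hr
        rw [huI]
        exact (IsNeumannProfile.continuousOn_localBackstepping
          (sec cv (hSa r (Ioo_subset_Icc_self hr))) hk n).pow 2
      · rw [huI]
        exact ((IsNeumannProfile.continuousOn_localBackstepping (sec cv ht) hk n).const_mul 2).mul
          (IsNeumannProfile.continuousOn_localBackstepping (sec cvt ht) hk n)
      · intro r hr x hx
        rw [huI] at hx
        have hr' := Ioo_subset_Icc_self hr
        rw [abs_mul, abs_mul, abs_two]
        have b0 := bT hC₀0 (hC₀ r hr') x hx
        have b1 := bT hC₁0 (hC₁ r hr') x hx
        gcongr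
      · intro r hr x hx
        rw [huI] at hx
        have := (hTd r (hSa r (Ioo_subset_Icc_self hr)) (Icc_mem_nhds hr.1 hr.2) x hx).fun_pow 2
        refine this.congr_deriv ?_
        simp
    refine h2.congr_deriv ?_
    rw [← intervalIntegral.integral_const_mul]
    refine intervalIntegral.integral_congr fun x hx => ?_
    rw [huI] at hx
    rw [localBackstepping_congr hvteq hx]
    ring
  · rw [← feedback_congr hvteq]
    obtain ⟨CK, hCK⟩ := isCompact_Icc.exists_bound_of_continuousOn hK
    have huI : uIcc (0 : ℝ) 1 = Icc 0 1 := uIcc_of_le zero_le_one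
    refine hasDerivAt_integral_of_bounded (φ := fun s y => K y * v s y)
      (φ' := fun s y => K y * vt s y) (C := CK * C₁) hSt ?_ ?_ ?_ ?_
    · intro r hr
      rw [huI]
      exact hK.mul (sec cv (hSa r hr))
    · rw [huI]
      exact hK.mul (sec cvt ht)
    · intro r hr y hy
      rw [huI] at hy
      rw [abs_mul]
      exact mul_le_mul (hCK y hy) (hC₁ r hr y hy) (abs_nonneg _)
        ((norm_nonneg _).trans (hCK y hy))
    · intro r hr y hy
      rw [huI] at hy
      exact (((hcl r (hSa r hr)).1 y hy).1).const_mul _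

end IsHeldSolution

/-! ### The event trigger -/

lemma deviation_self (K : ℝ → ℝ) (a : ℝ) (v : ℝ → ℝ → ℝ) : deviation K a v a = 0 := by
  simp [deviation, feedback]

lemma eps1_nonneg (ε : ℝ) (K : ℝ → ℝ) : 0 ≤ eps1 ε K := by rw [eps1]; positivity

/-- Since no event takes place just after `a`, the infimum in `nextEvent` is attained after `a`. -/
lemma nextEvent_spec {ξ a : ℝ} {d μ : ℝ → ℝ} (hξ : 0 < ξ) (hd : ContinuousOn d (Ici a))
    (hμ : ContinuousOn μ (Ici a)) (hd0 : d a = 0) (hμ0 : μ a < 0) :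
    (a : EReal) < nextEvent ξ a d μ ∧
    (∀ s : ℝ, a < s → (s : EReal) < nextEvent ξ a d μ → d s ^ 2 ≤ -ξ * μ s) ∧
    (nextEvent ξ a d μ = ⊤ ∨ ∃ T : ℝ, nextEvent ξ a d μ = (T : EReal) ∧ a < T ∧
      -ξ * μ T ≤ d T ^ 2) := by
  rw [nextEvent]
  split_ifs with hex
  · set S : Set ℝ := {t : ℝ | a < t ∧ d t ^ 2 ≥ -ξ * μ t} with hS
    have hne : S.Nonempty := by
      obtain ⟨t, h1, h2⟩ := hex
      exact ⟨t, h1, h2.le⟩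
    have hbdd : BddBelow S := ⟨a, fun t ht => ht.1.le⟩
    have hc : ContinuousOn (fun t => d t ^ 2 - -ξ * μ t) (Ici a) :=
      (hd.pow 2).sub (hμ.const_mul _)
    -- no event takes place in a neighbourhood of `a`
    obtain ⟨δ, hδ, hδ'⟩ : ∃ δ > a, ∀ t ∈ Ico a δ, d t ^ 2 - -ξ * μ t < 0 := by
      have h0 : d a ^ 2 - -ξ * μ a < 0 := by
        rw [hd0]
        have := mul_pos_of_neg_of_neg (neg_lt_zero.2 hξ) hμ0
        linarith
      have := (hc a self_mem_Ici).eventually (gt_mem_nhds h0)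
      obtain ⟨δ, h1, h2⟩ := (mem_nhdsGE_iff_exists_Ico_subset).1 this
      exact ⟨δ, h1, fun t ht => h2 ht⟩
    have hSδ (t : ℝ) (ht : t ∈ S) : δ ≤ t := by
      by_contra hlt
      have := hδ' t ⟨ht.1.le, not_le.1 hlt⟩
      have := ht.2
      linarith
    have hcl : IsClosed S := by
      have : S = Ici δ ∩ (fun t => d t ^ 2 - -ξ * μ t) ⁻¹' Ici 0 := by
        ext t
        refine ⟨fun ht => ⟨hSδ t ht, sub_nonneg.2 ht.2⟩, fun ht => ⟨?_, sub_nonneg.1 ht.2⟩⟩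
        exact (show a < δ from hδ).trans_le ht.1
      rw [this]
      exact (hc.mono (Ici_subset_Ici.2 (le_of_lt hδ))).preimage_isClosed_of_isClosed isClosed_Ici
        isClosed_Ici
    have hmem := hcl.csInf_mem hne hbdd
    refine ⟨by exact_mod_cast hmem.1, fun s hs hs' => ?_, Or.inr ⟨_, rfl, hmem.1, hmem.2⟩⟩
    by_contra hlt
    have := csInf_le hbdd (show s ∈ S from ⟨hs, (not_le.1 hlt).le⟩)
    rw [EReal.coe_lt_coe_iff] at hs'
    linarith
  · refine ⟨EReal.coe_lt_top a, fun s hs _ => ?_, Or.inl rfl⟩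
    by_contra hlt
    exact hex ⟨s, hs, not_le.1 hlt⟩

/-- Before the next event, the dynamic variable stays negative. -/
lemma IsHeldTrigger.neg {P : TriggerParams} {K : ℝ → ℝ} {a T : ℝ} {v : ℝ → ℝ → ℝ} {μ : ℝ → ℝ}
    (hμ : IsHeldTrigger P K a v μ) (hlamd : 0 < P.lamd) (h1 : 0 < P.κ₁)
    (h2 : 0 < P.κ₂) (h3 : 0 < P.κ₃) (hμ0 : μ a < 0)
    (hd : ∀ s ∈ Ioo a T, deviation K a v s ^ 2 ≤ -P.ξ * μ s) {s : ℝ} (hs : s ∈ Icc a T) :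
    μ s < 0 := by
  set c := P.η + P.lamd * P.ξ with hc
  have hexp (s : ℝ) : HasDerivAt (fun s => Real.exp (c * s)) (Real.exp (c * s) * c) s := by
    simpa using ((hasDerivAt_id s).const_mul c).exp
  have hder (s : ℝ) (hs : a < s) := (hμ.ode s hs).mul (hexp s)
  have hanti : AntitoneOn (fun s => μ s * Real.exp (c * s)) (Icc a T) := by
    refine antitoneOn_of_deriv_nonpos (convex_Icc a T)
      ((hμ.continuousOn.mono Icc_subset_Ici_self).mul (by fun_prop)) ?_ ?_
    · rw [interior_Icc]
      exact fun s hs => (hder s hs.1).differentiableAt.differentiableWithinAt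
    · rw [interior_Icc]
      intro s hs
      refine le_of_eq_of_le (hder s hs.1).deriv ?_
      have e1 := mul_le_mul_of_nonneg_left (hd s hs) hlamd.le
      have e2 := mul_nonneg h1.le (normSq_nonneg (v s))
      have e3 := mul_nonneg h2.le (sq_nonneg (v s 1))
      have e4 := mul_nonneg h3.le (sq_nonneg (v s 0))
      have e5 : (-P.η * μ s + P.lamd * deviation K a v s ^ 2 - P.κ₁ * normSq (v s)
          - P.κ₂ * v s 1 ^ 2 - P.κ₃ * v s 0 ^ 2) + c * μ s ≤ 0 := by
        rw [hc]
        linarith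
      have := mul_nonpos_of_nonpos_of_nonneg e5 (Real.exp_pos (c * s)).le
      linarith
  have h4 := hanti (left_mem_Icc.2 (hs.1.trans hs.2)) hs hs.1
  have h5 : μ a * Real.exp (c * a) < 0 := mul_neg_of_neg_of_pos hμ0 (Real.exp_pos _)
  exact neg_of_mul_neg_left (h4.trans_lt h5) (Real.exp_pos _).le

/-- The time derivative of the input deviation along the plant. -/
lemma IsNeumannProfile.feedback_plant {u ux uxx lam K : ℝ → ℝ} {ε q : ℝ}
    (h : IsNeumannProfile u ux uxx) (hlam : ContinuousOn lam (Icc 0 1))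
    (hK : ContDiffOn ℝ 2 K (Icc 0 1)) :
    feedback K (fun y => ε * uxx y + lam y * u y)
      = -(ε * K 1) * (feedback K u - (ux 1 + q * u 1))
        + (∫ y in (0 : ℝ)..1, (ε * gainDeriv2 K y + ε * K 1 * K y + lam y * K y) * u y)
        - (ε * q * K 1 + ε * gainDeriv K 1) * u 1 + ε * gainDeriv K 0 * u 0 := by
  have hud : UniqueDiffOn ℝ (Icc (0 : ℝ) 1) := uniqueDiffOn_Icc zero_lt_one
  have hK1 : ContDiffOn ℝ 1 (gainDeriv K) (Icc 0 1) := hK.derivWithin hud (by norm_num)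
  have cK := hK.continuousOn
  have cK1 := hK1.continuousOn
  have cK2 : ContinuousOn (gainDeriv2 K) (Icc 0 1) := hK1.continuousOn_derivWithin hud le_rfl
  have dK (y : ℝ) (hy : y ∈ Icc (0 : ℝ) 1) : HasDerivWithinAt K (gainDeriv K y) (Icc 0 1) y :=
    (hK.differentiableOn (by norm_num) y hy).hasDerivWithinAt
  have dK1 (y : ℝ) (hy : y ∈ Icc (0 : ℝ) 1) :
      HasDerivWithinAt (gainDeriv K) (gainDeriv2 K y) (Icc 0 1) y :=
    (hK1.differentiableOn (by norm_num) y hy).hasDerivWithinAt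
  have ibp1 := intervalIntegral.integral_mul_deriv_of_hasDerivWithinAt_Icc zero_le_one dK
    h.hasDerivX cK1 h.contXX
  have ibp2 := intervalIntegral.integral_mul_deriv_of_hasDerivWithinAt_Icc zero_le_one dK1
    h.hasDeriv cK2 h.contX
  have e1 : feedback K (fun y => ε * uxx y + lam y * u y)
      = ε * (∫ y in (0 : ℝ)..1, K y * uxx y) + ∫ y in (0 : ℝ)..1, lam y * K y * u y := by
    rw [feedback, ← intervalIntegral.integral_const_mul, ← intervalIntegral.integral_add]
    · exact intervalIntegral.integral_congr fun y _ => by ring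
    · exact ((cK.mul h.contXX).const_mul ε).intervalIntegrable_unit
    · exact ((hlam.mul cK).mul h.cont).intervalIntegrable_unit
  have e2 : ∫ y in (0 : ℝ)..1, (ε * gainDeriv2 K y + ε * K 1 * K y + lam y * K y) * u y
      = ε * (∫ y in (0 : ℝ)..1, gainDeriv2 K y * u y) + ε * K 1 * feedback K u
        + ∫ y in (0 : ℝ)..1, lam y * K y * u y := by
    have i1 : IntervalIntegrable (fun x => ε * (gainDeriv2 K x * u x)) volume 0 1 :=
      ((cK2.mul h.cont).const_mul ε).intervalIntegrable_unit
    have i2 : IntervalIntegrable (fun x => ε * K 1 * (K x * u x)) volume 0 1 :=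
      ((cK.mul h.cont).const_mul (ε * K 1)).intervalIntegrable_unit
    have i3 : IntervalIntegrable (fun x => lam x * K x * u x) volume 0 1 :=
      ((hlam.mul cK).mul h.cont).intervalIntegrable_unit
    rw [feedback, ← intervalIntegral.integral_const_mul, ← intervalIntegral.integral_const_mul,
      ← intervalIntegral.integral_add i1 i2, ← intervalIntegral.integral_add (i1.add i2) i3]
    exact intervalIntegral.integral_congr fun y _ => by ring
  rw [e1, e2, ibp1, ibp2, h.neumann]
  ring

/-- The origin of the constants `ϵ₁, ϵ₂, ϵ₃, ϵ₄`. -/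
lemma IsNeumannProfile.sq_feedback_plant_le {u ux uxx lam K : ℝ → ℝ} {ε q : ℝ}
    (h : IsNeumannProfile u ux uxx) (hlam : ContinuousOn lam (Icc 0 1))
    (hK : ContDiffOn ℝ 2 K (Icc 0 1)) :
    feedback K (fun y => ε * uxx y + lam y * u y) ^ 2
      ≤ eps1 ε K * (feedback K u - (ux 1 + q * u 1)) ^ 2 + eps2 ε lam K * normSq u
        + eps3 ε q K * u 1 ^ 2 + eps4 ε K * u 0 ^ 2 := by
  have hud : UniqueDiffOn ℝ (Icc (0 : ℝ) 1) := uniqueDiffOn_Icc zero_lt_one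
  have hK1 : ContDiffOn ℝ 1 (gainDeriv K) (Icc 0 1) := hK.derivWithin hud (by norm_num)
  have cK2 : ContinuousOn (gainDeriv2 K) (Icc 0 1) := hK1.continuousOn_derivWithin hud le_rfl
  have cF : ContinuousOn (fun y => ε * gainDeriv2 K y + ε * K 1 * K y + lam y * K y) (Icc 0 1) :=
    ((cK2.const_mul _).add (hK.continuousOn.const_mul _)).add (hlam.mul hK.continuousOn)
  have hcs := sq_integral_mul_le_normSq cF.memLp_Icc h.cont.memLp_Icc
  rw [h.feedback_plant (q := q) hlam hK]
  generalize (∫ y in (0 : ℝ)..1, (ε * gainDeriv2 K y + ε * K 1 * K y + lam y * K y) * u y) = I at *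
  generalize feedback K u - (ux 1 + q * u 1) = d at *
  have key (a b c d : ℝ) : (a + b - c + d) ^ 2 ≤ 4 * (a ^ 2 + b ^ 2 + c ^ 2 + d ^ 2) := by
    nlinarith [sq_nonneg (a - b), sq_nonneg (a + c), sq_nonneg (a - d), sq_nonneg (b + c),
      sq_nonneg (b - d), sq_nonneg (c + d)]
  refine (key _ _ _ _).trans ?_
  rw [eps1, eps2, eps3, eps4]
  change I ^ 2 ≤ (∫ y in (0 : ℝ)..1,
    (ε * gainDeriv2 K y + ε * K 1 * K y + lam y * K y) ^ 2) * normSq u at hcs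
  linarith

/-! ### The dwell time -/

/-- A scalar function that starts at `-1`, satisfies `φ' ≤ n₃ + n₂ φ + n₁ φ²` where `φ ≥ 0`, and
reaches `1`, takes longer than `∫_0^1 ds / (n₃ + n₂ s + n₁ s²)`. -/
lemma lt_of_riccati {φ φ' : ℝ → ℝ} {a T n₁ n₂ n₃ : ℝ} (haT : a < T) (h1 : 0 ≤ n₁) (h2 : 0 ≤ n₂)
    (h3 : 0 < n₃) (hc : ContinuousOn φ (Icc a T)) (hd : ∀ t ∈ Ioo a T, HasDerivAt φ (φ' t) t)
    (hle : ∀ t ∈ Ioo a T, 0 ≤ φ t → φ' t ≤ n₃ + n₂ * φ t + n₁ * φ t ^ 2)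
    (ha : φ a = -1) (hT : 1 ≤ φ T) :
    a + ∫ s in (0 : ℝ)..1, 1 / (n₃ + n₂ * s + n₁ * s ^ 2) < T := by
  -- `|s|` makes the integrand positive and continuous on the line
  set p : ℝ → ℝ := fun s => n₃ + n₂ * |s| + n₁ * s ^ 2 with hp
  have hp0 (s : ℝ) : 0 < p s := by
    simp only [hp]
    positivity
  have hpc : Continuous fun s => 1 / p s := by
    refine continuous_const.div (by fun_prop) fun s => (hp0 s).ne'
  set H : ℝ → ℝ := fun x => ∫ s in (0 : ℝ)..x, 1 / p s with hH
  have hHd (x : ℝ) : HasDerivAt H (1 / p x) x :=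
    intervalIntegral.integral_hasDerivAt_right (hpc.intervalIntegrable _ _)
      (hpc.stronglyMeasurableAtFilter _ _) hpc.continuousAt
  have hHm : StrictMono H := strictMono_of_deriv_pos fun x => by
    rw [(hHd x).deriv]
    exact one_div_pos.2 (hp0 x)
  have hH0 : H 0 = 0 := by simp [hH]
  have hτ : ∫ s in (0 : ℝ)..1, 1 / (n₃ + n₂ * s + n₁ * s ^ 2) = H 1 := by
    refine intervalIntegral.integral_congr fun s hs => ?_
    rw [uIcc_of_le zero_le_one] at hs
    simp only [hp, abs_of_nonneg hs.1]
  -- the last time at which `φ ≤ 0`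
  set S : Set ℝ := Icc a T ∩ φ ⁻¹' Iic 0 with hS
  have hScl : IsClosed S := hc.preimage_isClosed_of_isClosed isClosed_Icc isClosed_Iic
  have hScp : IsCompact S := isCompact_Icc.of_isClosed_subset hScl inter_subset_left
  have hSne : S.Nonempty := ⟨a, ⟨le_rfl, haT.le⟩, by simp [ha]⟩
  have hmem := hScp.sSup_mem hSne
  set t₀ := sSup S with ht₀
  have hpos (t : ℝ) (ht : t ∈ Ioc t₀ T) : 0 < φ t := by
    by_contra hneg
    have : t ≤ t₀ := le_csSup hScp.bddAbove ⟨⟨hmem.1.1.trans ht.1.le, ht.2⟩, not_lt.1 hneg⟩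
    linarith [ht.1]
  have hsub : Icc t₀ T ⊆ Icc a T := Icc_subset_Icc_left hmem.1.1
  have hanti : AntitoneOn (fun t => H (φ t) - t) (Icc t₀ T) := by
    have hcH : Continuous H := continuous_iff_continuousAt.2 fun x => (hHd x).continuousAt
    have hder (t : ℝ) (ht : t ∈ Ioo t₀ T) :=
      ((hHd (φ t)).comp t (hd t ⟨hmem.1.1.trans_lt ht.1, ht.2⟩)).sub (hasDerivAt_id t)
    refine antitoneOn_of_deriv_nonpos (convex_Icc _ _)
      ((hcH.comp_continuousOn (hc.mono hsub)).sub continuousOn_id) ?_ ?_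
    · rw [interior_Icc]
      exact fun t ht => (hder t ht).differentiableAt.differentiableWithinAt
    · rw [interior_Icc]
      intro t ht
      refine le_of_eq_of_le (hder t ht).deriv ?_
      have hφ := hpos t (Ioo_subset_Ioc_self ht)
      have := hle t ⟨hmem.1.1.trans_lt ht.1, ht.2⟩ hφ.le
      rw [sub_nonpos, one_div, ← div_eq_inv_mul, div_le_one (hp0 _)]
      simpa only [hp, abs_of_pos hφ] using this
  have h4 := hanti (left_mem_Icc.2 hmem.1.2) (right_mem_Icc.2 hmem.1.2) hmem.1.2
  simp only at h4
  have h5 : H 1 ≤ H (φ T) := hHm.monotone hT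
  rw [hτ]
  rcases hmem.1.1.eq_or_lt with h | h
  · have h6 : H (φ t₀) < 0 := by
      rw [← h, ha, ← hH0]
      exact hHm (by norm_num)
    linarith
  · have h6 : H (φ t₀) ≤ 0 := by
      rw [← hH0]
      exact hHm.monotone hmem.2
    linarith

lemma dwellTime_pos {ε : ℝ} {K : ℝ → ℝ} {P : TriggerParams} (hη : 0 < P.η) (hξ : 0 < P.ξ)
    (hlamd : 0 < P.lamd) : 0 < dwellTime ε K P := by
  have h1 := eps1_nonneg ε K
  have hpos (s : ℝ) (hs : s ∈ Icc (0 : ℝ) 1) :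
      0 < (1 + P.η + eps1 ε K + 1 / 2 * P.ξ * P.lamd)
      + (1 + eps1 ε K + P.ξ * P.lamd + P.η) * s + (1 / 2 * P.lamd * P.ξ) * s ^ 2 := by
    have := hs.1
    positivity
  refine intervalIntegral.intervalIntegral_pos_of_pos_on ?_
    (fun s hs => one_div_pos.2 (hpos s (Ioo_subset_Icc_self hs))) zero_lt_one
  exact ContinuousOn.intervalIntegrable_unit
    (continuousOn_const.div (by fun_prop) fun s hs => (hpos s hs).ne')

/-- The minimal dwell time: the function `d² / (ξ |μ| / 2) - 1` satisfies a Riccati differential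
inequality. -/
lemma IsHeldSolution.dwell {ε q a T : ℝ} {lam K : ℝ → ℝ} {v : ℝ → ℝ → ℝ} {μ : ℝ → ℝ}
    {P : TriggerParams} (hv : IsHeldSolution ε q lam a (feedback K (v a)) v)
    (hμ : IsHeldTrigger P K a v μ) (hlam : ContinuousOn lam (Icc 0 1))
    (hK : ContDiffOn ℝ 2 K (Icc 0 1)) (hη : 0 < P.η) (hξ : 0 < P.ξ) (hlamd : 0 < P.lamd)
    (hκ₁ : P.κ₁ ≥ 2 * eps2 ε lam K / P.ξ) (hκ₂ : P.κ₂ ≥ 2 * eps3 ε q K / P.ξ)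
    (hκ₃ : P.κ₃ ≥ 2 * eps4 ε K / P.ξ) (haT : a < T) (hneg : ∀ s ∈ Icc a T, μ s < 0)
    (hT : -P.ξ * μ T ≤ deviation K a v T ^ 2) : a + dwellTime ε K P < T := by
  set d := deviation K a v with hd
  have hder (t : ℝ) (ht : a < t) : ∃ d', HasDerivAt d d' t ∧
      d' ^ 2 ≤ eps1 ε K * d t ^ 2 + eps2 ε lam K * normSq (v t)
        + eps3 ε q K * v t 1 ^ 2 + eps4 ε K * v t 0 ^ 2 := by
    obtain ⟨ux, uxx, hprof, hrob, -, hfb⟩ := hv.exists_profile ht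
    refine ⟨feedback K (fun y => ε * uxx y + lam y * v t y), ?_, ?_⟩
    · refine ((hfb K hK.continuousOn).sub_const (feedback K (v a))).congr_of_eventuallyEq ?_
      filter_upwards [lt_mem_nhds ht] with s hs
      exact hv.deviation_eq hK.continuousOn hs.le
    · have := hprof.sq_feedback_plant_le (ε := ε) (q := q) hlam hK
      rw [hrob, ← hv.deviation_eq hK.continuousOn ht.le] at this
      exact this
  choose! d' hd' hd'le using hder
  set μ' : ℝ → ℝ := fun t => -P.η * μ t + P.lamd * d t ^ 2 - P.κ₁ * normSq (v t)
      - P.κ₂ * v t 1 ^ 2 - P.κ₃ * v t 0 ^ 2 with hμ'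
  have e1 := eps1_nonneg ε K
  have hne (t : ℝ) (ht : t ∈ Icc a T) : -(P.ξ / 2 * μ t) ≠ 0 := by
    have := mul_neg_of_pos_of_neg (half_pos hξ) (hneg t ht)
    linarith
  have hcd : ContinuousOn d (Icc a T) :=
    (hv.continuousOn_deviation hK.continuousOn).mono Icc_subset_Ici_self
  have hcμ : ContinuousOn μ (Icc a T) := hμ.continuousOn.mono Icc_subset_Ici_self
  have hμT : 0 < -(P.ξ / 2 * μ T) := by
    have := mul_neg_of_pos_of_neg (half_pos hξ) (hneg T (right_mem_Icc.2 haT.le))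
    linarith
  refine lt_of_riccati (φ := fun t => d t ^ 2 / -(P.ξ / 2 * μ t) - 1)
    (φ' := fun t => (2 * d t * d' t * -(P.ξ / 2 * μ t) - d t ^ 2 * -(P.ξ / 2 * μ' t))
      / (-(P.ξ / 2 * μ t)) ^ 2) haT (by positivity) (by positivity) (by positivity)
    (((hcd.pow 2).div (hcμ.const_mul _).neg hne).sub continuousOn_const) (fun t ht => ?_)
    (fun t ht hφ => ?_) ?_ ?_
  · have h1 := (hd' t ht.1).fun_pow 2
    have h2 : HasDerivAt (fun t => -(P.ξ / 2 * μ t)) (-(P.ξ / 2 * μ' t)) t :=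
      ((hμ.ode t ht.1).const_mul (P.ξ / 2)).neg
    refine ((h1.div h2 (hne t (Ioo_subset_Icc_self ht))).sub_const 1).congr_deriv ?_
    simp
  · set y := -(P.ξ / 2 * μ t) with hy
    have hy0 : 0 < y := by
      have := mul_neg_of_pos_of_neg (half_pos hξ) (hneg t (Ioo_subset_Icc_self ht))
      linarith
    set D := d t ^ 2 / y with hD
    have hdD : d t ^ 2 = D * y := by rw [hD]; field_simp
    have hD1 : 1 ≤ D := by linarith
    rw [div_le_iff₀ (by positivity)]
    set N := P.κ₁ * normSq (v t) + P.κ₂ * v t 1 ^ 2 + P.κ₃ * v t 0 ^ 2 with hN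
    have hμy : P.ξ / 2 * μ' t = P.η * y + P.ξ / 2 * (P.lamd * d t ^ 2) - P.ξ / 2 * N := by
      simp only [hμ', hy, hN]
      ring
    have hEN : eps2 ε lam K * normSq (v t) + eps3 ε q K * v t 1 ^ 2 + eps4 ε K * v t 0 ^ 2
        ≤ P.ξ / 2 * N := by
      have b (e κ : ℝ) (h : κ ≥ 2 * e / P.ξ) : e ≤ P.ξ / 2 * κ := by
        rw [ge_iff_le, div_le_iff₀ hξ] at h
        linarith
      have b1 := mul_le_mul_of_nonneg_right (b _ _ hκ₁) (normSq_nonneg (v t))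
      have b2 := mul_le_mul_of_nonneg_right (b _ _ hκ₂) (sq_nonneg (v t 1))
      have b3 := mul_le_mul_of_nonneg_right (b _ _ hκ₃) (sq_nonneg (v t 0))
      rw [hN]
      linarith
    have hN0 : 0 ≤ P.ξ / 2 * N := by
      refine le_trans ?_ hEN
      have g2 : 0 ≤ eps2 ε lam K := by
        rw [eps2]
        exact mul_nonneg (by norm_num)
          (intervalIntegral.integral_nonneg zero_le_one fun _ _ => sq_nonneg _)
      have g3 : 0 ≤ eps3 ε q K := by rw [eps3]; positivity
      have g4 : 0 ≤ eps4 ε K := by rw [eps4]; positivity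
      have := normSq_nonneg (v t)
      positivity
    have hdd : 2 * d t * d' t ≤ (1 + eps1 ε K) * d t ^ 2 + P.ξ / 2 * N := by
      have := hd'le t ht.1
      linarith [sq_nonneg (d t - d' t)]
    have hdd' := mul_le_mul_of_nonneg_right hdd hy0.le
    -- the terms with the norm of the state cancel because `D ≥ 1`
    have hcancel : P.ξ / 2 * N * y ≤ D * y * (P.ξ / 2 * N) := by
      have := mul_le_mul_of_nonneg_right hD1 (mul_nonneg hN0 hy0.le)
      linarith
    rw [hμy]
    rw [hdD] at hdd' ⊢
    linarith
  · rw [hd, deviation_self]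
    norm_num
  · have : 2 ≤ d T ^ 2 / -(P.ξ / 2 * μ T) := by
      rw [le_div_iff₀ hμT]
      linarith
    linarith

/-! ### Decay between two events -/

/-- Between two events, `M ‖z‖² + |μ|` decays exponentially, where `z` is the transformed state:
the dissipation of `‖z‖²` absorbs the terms of the trigger with `κ₁`, `κ₂`, `κ₃`, and the term with
`λ_d` absorbs the influence of the input deviation. -/
lemma IsHeldSolution.energy_decay {ε q A B c M σ a b : ℝ} {n : ℕ} {lam K : ℝ → ℝ}
    {k kh v : ℝ → ℝ → ℝ} {μ : ℝ → ℝ} {P : TriggerParams}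
    (hv : IsHeldSolution ε q lam a (feedback K (v a)) v) (hμ : IsHeldTrigger P K a v μ)
    (hT : IsLyapunovTransform ε q A B c n lam k kh) (hk : Continuous (Function.uncurry k))
    (hK : K = controlGain ε q lam kh) (hKc : ContinuousOn K (Icc 0 1)) (hM : 0 < M)
    (hκ₁ : P.κ₁ ≤ 2 * M * ε * c) (hκ₂ : P.κ₂ ≤ 2 * M * ε * c) (hκ₃ : P.κ₃ ≤ 2 * M * ε * c)
    (hlamd : 50 * M * ε ≤ P.lamd) (hση : σ ≤ P.η) (hσε : σ ≤ ε / 8) (hab : a ≤ b)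
    (hneg : ∀ s ∈ Icc a b, μ s < 0) :
    M * normSq (localBackstepping k n (v b)) - μ b
      ≤ (M * normSq (localBackstepping k n (v a)) - μ a) * Real.exp (-σ * (b - a)) := by
  have hexp (s : ℝ) : HasDerivAt (fun s => Real.exp (σ * s)) (Real.exp (σ * s) * σ) s := by
    simpa using ((hasDerivAt_id s).const_mul σ).exp
  have hc : ContinuousOn (fun s => (M * normSq (localBackstepping k n (v s)) - μ s)
      * Real.exp (σ * s)) (Icc a b) :=
    (((hv.continuousOn_energy hk hT.upper).const_mul M |>.sub hμ.continuousOn).mono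
      Icc_subset_Ici_self).mul (by fun_prop)
  have hder (s : ℝ) (hs : s ∈ Ioo a b) : ∃ e ≤ 0, HasDerivAt (fun s =>
      (M * normSq (localBackstepping k n (v s)) - μ s) * Real.exp (σ * s)) e s := by
    obtain ⟨ux, uxx, hprof, hrob, hen, -⟩ := hv.exists_profile hs.1
    refine ⟨_, ?_, (((hen k n hk).const_mul M).fun_sub (hμ.ode s hs.1)).mul (hexp s)⟩
    have hdis := hT.dissipation _ _ _ hprof
    rw [hrob, ← hK, ← hv.deviation_eq hKc hs.1.le] at hdis
    set I := ∫ x in (0 : ℝ)..1, localBackstepping k n (v s) x *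
      localBackstepping k n (fun y => ε * uxx y + lam y * v s y) x
    have hdis' := mul_le_mul_of_nonneg_left hdis (by linarith : 0 ≤ 2 * M)
    have hZ := normSq_nonneg (localBackstepping k n (v s))
    have h1 := mul_le_mul_of_nonneg_right hκ₁ (normSq_nonneg (v s))
    have h2 := mul_le_mul_of_nonneg_right hκ₂ (sq_nonneg (v s 1))
    have h3 := mul_le_mul_of_nonneg_right hκ₃ (sq_nonneg (v s 0))
    have h4 := mul_le_mul_of_nonneg_right hlamd (sq_nonneg (deviation K a v s))
    have h5 := mul_le_mul_of_nonneg_right hση (neg_nonneg.2 (hneg s (Ioo_subset_Icc_self hs)).le)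
    have h6 := mul_le_mul_of_nonneg_right hσε (mul_nonneg hM.le hZ)
    have h7 : M * (2 * I) - (-P.η * μ s + P.lamd * deviation K a v s ^ 2 - P.κ₁ * normSq (v s)
        - P.κ₂ * v s 1 ^ 2 - P.κ₃ * v s 0 ^ 2)
        + σ * (M * normSq (localBackstepping k n (v s)) - μ s) ≤ 0 := by
      linarith
    have := mul_nonpos_of_nonpos_of_nonneg h7 (Real.exp_pos (σ * s)).le
    linarith
  have hanti : AntitoneOn (fun s => (M * normSq (localBackstepping k n (v s)) - μ s)
      * Real.exp (σ * s)) (Icc a b) := by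
    refine antitoneOn_of_deriv_nonpos (convex_Icc a b) hc ?_ ?_
    · rw [interior_Icc]
      intro s hs
      obtain ⟨e, -, he⟩ := hder s hs
      exact he.differentiableAt.differentiableWithinAt
    · rw [interior_Icc]
      intro s hs
      obtain ⟨e, he0, he⟩ := hder s hs
      exact he.deriv.trans_le he0
  have h := hanti (left_mem_Icc.2 hab) (right_mem_Icc.2 hab) hab
  have e1 : Real.exp (-σ * (b - a)) = Real.exp (σ * a) / Real.exp (σ * b) := by
    rw [← Real.exp_sub]
    ring_nf
  rw [e1, ← mul_div_assoc, le_div_iff₀ (Real.exp_pos _)]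
  exact h

/-! ### The closed loop -/

lemma le_nextEvent (ξ a : ℝ) (d μ : ℝ → ℝ) : (a : EReal) ≤ nextEvent ξ a d μ := by
  rw [nextEvent]
  split_ifs with hex
  · obtain ⟨t, h1, h2⟩ := hex
    exact EReal.coe_le_coe_iff.2 (le_csInf ⟨t, h1, h2.le⟩ fun t ht => ht.1.le)
  · exact le_top

namespace IsClosedLoop

variable {ε q : ℝ} {lam K : ℝ → ℝ} {P : TriggerParams} {t : ℕ → EReal} {u : ℝ → ℝ → ℝ} {m : ℝ → ℝ}

/-- The trajectory after an event: the next event comes later than the dwell time, and up to then the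
trajectory follows a solution under the held input, with a negative dynamic variable. -/
lemma exists_segment (h : IsClosedLoop ε q lam K P t u m) (hlam : ContinuousOn lam (Icc 0 1))
    (hK : ContDiffOn ℝ 2 K (Icc 0 1)) (hη : 0 < P.η) (hξ : 0 < P.ξ) (hlamd : 0 < P.lamd)
    (h1 : 0 < P.κ₁) (h2 : 0 < P.κ₂) (h3 : 0 < P.κ₃)
    (hκ₁ : P.κ₁ ≥ 2 * eps2 ε lam K / P.ξ) (hκ₂ : P.κ₂ ≥ 2 * eps3 ε q K / P.ξ)
    (hκ₃ : P.κ₃ ≥ 2 * eps4 ε K / P.ξ) {j : ℕ} {a : ℝ} (ha : t j = (a : EReal)) (hm : m a < 0) :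
    ((a + dwellTime ε K P : ℝ) : EReal) < t (j + 1) ∧
    ∃ (v : ℝ → ℝ → ℝ) (μ : ℝ → ℝ), IsHeldSolution ε q lam a (feedback K (v a)) v ∧
      IsHeldTrigger P K a v μ ∧ ∀ s : ℝ, a ≤ s → (s : EReal) ≤ t (j + 1) →
        μ s < 0 ∧ m s = μ s ∧ ∀ x ∈ Icc (0 : ℝ) 1, u s x = v s x := by
  obtain ⟨v, μ, hv, hμ, hnext, hum⟩ := h.step j a ha
  have hle : (a : EReal) ≤ t (j + 1) := hnext ▸ le_nextEvent _ _ _ _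
  obtain ⟨hma, hua⟩ := hum a le_rfl hle
  rw [feedback_congr hua] at hv
  obtain ⟨-, hbefore, hafter⟩ := nextEvent_spec hξ (hv.continuousOn_deviation hK.continuousOn)
    hμ.continuousOn (deviation_self K a v) (hma ▸ hm)
  have hneg (s : ℝ) (hs : a ≤ s) (hs' : (s : EReal) ≤ t (j + 1)) : μ s < 0 := by
    refine hμ.neg hlamd h1 h2 h3 (hma ▸ hm) (T := s) (fun r hr => hbefore r hr.1 ?_) ⟨hs, le_rfl⟩
    rw [← hnext]
    exact lt_of_lt_of_le (by exact_mod_cast hr.2) hs'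
  refine ⟨?_, v, μ, hv, hμ, fun s hs hs' => ⟨hneg s hs hs', hum s hs hs'⟩⟩
  rw [hnext]
  rcases hafter with htop | ⟨T, hT, haT, hTd⟩
  · rw [htop]
    exact EReal.coe_lt_top _
  · rw [hT, EReal.coe_lt_coe_iff]
    refine hv.dwell hμ hlam hK hη hξ hlamd hκ₁ hκ₂ hκ₃ haT (fun s hs => hneg s hs.1 ?_) hTd
    rw [hnext, hT]
    exact_mod_cast hs.2

/-- The `j`-th event time is `⊤` or real; then it is at least `j τ`, and the dynamic variable is
negative there. -/
lemma event_cases (h : IsClosedLoop ε q lam K P t u m) (hlam : ContinuousOn lam (Icc 0 1))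
    (hK : ContDiffOn ℝ 2 K (Icc 0 1)) (hη : 0 < P.η) (hξ : 0 < P.ξ) (hlamd : 0 < P.lamd)
    (h1 : 0 < P.κ₁) (h2 : 0 < P.κ₂) (h3 : 0 < P.κ₃)
    (hκ₁ : P.κ₁ ≥ 2 * eps2 ε lam K / P.ξ) (hκ₂ : P.κ₂ ≥ 2 * eps3 ε q K / P.ξ)
    (hκ₃ : P.κ₃ ≥ 2 * eps4 ε K / P.ξ) (hm0 : m 0 < 0) (j : ℕ) :
    t j = ⊤ ∨ ∃ a : ℝ, t j = (a : EReal) ∧ m a < 0 ∧ j * dwellTime ε K P ≤ a := by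
  induction j with
  | zero => exact Or.inr ⟨0, by simpa using h.start, hm0, by simp⟩
  | succ j ih =>
    rcases ih with htop | ⟨a, ha, hma, hja⟩
    · exact Or.inl (h.noMore j htop)
    · obtain ⟨hdw, v, μ, -, -, hs⟩ :=
        h.exists_segment hlam hK hη hξ hlamd h1 h2 h3 hκ₁ hκ₂ hκ₃ ha hma
      induction hb : t (j + 1) with
      | bot => simp [hb] at hdw
      | top => exact Or.inl rfl
      | coe b =>
        have hab : a + dwellTime ε K P < b := by rw [hb] at hdw; exact_mod_cast hdw
        have hτ := dwellTime_pos (ε := ε) (K := K) hη hξ hlamd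
        obtain ⟨hμb, hmb, -⟩ := hs b (by linarith) hb.ge
        refine Or.inr ⟨b, rfl, hmb ▸ hμb, ?_⟩
        push_cast
        linarith

/-- The trajectory decays exponentially at the rate `σ`, with overshoot `C`, as soon as the
Lyapunov function `M ‖z‖² + |m|` lies between the multiples `1` and `C` of `Ω`. -/
theorem omega_le {A B c M C σ : ℝ} {n : ℕ} {k kh : ℝ → ℝ → ℝ}
    (h : IsClosedLoop ε q lam K P t u m) (hlam : ContinuousOn lam (Icc 0 1))
    (hKc : ContDiffOn ℝ 2 K (Icc 0 1)) (hη : 0 < P.η) (hξ : 0 < P.ξ) (hlamd : 0 < P.lamd)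
    (h1 : 0 < P.κ₁) (h2 : 0 < P.κ₂) (h3 : 0 < P.κ₃)
    (hκ₁ : P.κ₁ ≥ 2 * eps2 ε lam K / P.ξ) (hκ₂ : P.κ₂ ≥ 2 * eps3 ε q K / P.ξ)
    (hκ₃ : P.κ₃ ≥ 2 * eps4 ε K / P.ξ) (hm0 : m 0 < 0)
    (hu0 : MemLp (u 0) 2 (volume.restrict (Icc (0 : ℝ) 1)))
    (hT : IsLyapunovTransform ε q A B c n lam k kh) (hk : Continuous (Function.uncurry k))
    (hK : K = controlGain ε q lam kh) (hM : 0 < M) (hAM : A ≤ M)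
    (hMC : M * B ≤ C) (hC : 1 ≤ C) (hκ₁' : P.κ₁ ≤ 2 * M * ε * c) (hκ₂' : P.κ₂ ≤ 2 * M * ε * c)
    (hκ₃' : P.κ₃ ≤ 2 * M * ε * c) (hlamd' : 50 * M * ε ≤ P.lamd) (hση : σ ≤ P.η)
    (hσε : σ ≤ ε / 8) {s : ℝ} (hs : 0 ≤ s) :
    Omega u m s ≤ C * Omega u m 0 * Real.exp (-σ * s) := by
  have hτ := dwellTime_pos (ε := ε) (K := K) hη hξ hlamd
  have hcases := h.event_cases hlam hKc hη hξ hlamd h1 h2 h3 hκ₁ hκ₂ hκ₃ hm0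
  set E : ℝ → ℝ := fun s => M * normSq (localBackstepping k n (u s)) - m s with hE
  have hseg (j : ℕ) (a : ℝ) (ha : t j = (a : EReal)) (hma : m a < 0) (b : ℝ) (hab : a ≤ b)
      (hb : (b : EReal) ≤ t (j + 1)) : E b ≤ E a * Real.exp (-σ * (b - a)) ∧
        (a < b → Omega u m b ≤ E b) := by
    obtain ⟨-, v, μ, hv, hμ, hs⟩ :=
      h.exists_segment hlam hKc hη hξ hlamd h1 h2 h3 hκ₁ hκ₂ hκ₃ ha hma
    have hsb (r : ℝ) (hr : r ∈ Icc a b) := hs r hr.1 ((EReal.coe_le_coe_iff.2 hr.2).trans hb)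
    have hEeq (r : ℝ) (hr : r ∈ Icc a b) :
        E r = M * normSq (localBackstepping k n (v r)) - μ r := by
      obtain ⟨-, hmr, hur⟩ := hsb r hr
      simp only [hE]
      rw [hmr, normSq_congr fun x hx => localBackstepping_congr hur hx]
    have hbb : b ∈ Icc a b := right_mem_Icc.2 hab
    refine ⟨?_, fun hlt => ?_⟩
    · rw [hEeq b hbb, hEeq a (left_mem_Icc.2 hab)]
      exact hv.energy_decay hμ hT hk hK hKc.continuousOn hM hκ₁' hκ₂' hκ₃' hlamd' hση hσε hab
        fun r hr => (hsb r hr).1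
    · obtain ⟨hμb, hmb, hub⟩ := hsb b hbb
      obtain ⟨ux, uxx, hprof, -⟩ := hv.exists_profile hlt
      rw [hEeq b hbb, Omega, hmb, abs_of_neg hμb, normSq_congr hub]
      have e1 := hT.lower _ _ _ hprof
      have e2 := mul_le_mul_of_nonneg_right hAM
        (normSq_nonneg (localBackstepping k n (v b)))
      linarith
  have hE0 : E 0 ≤ C * Omega u m 0 := by
    have e1 := mul_le_mul_of_nonneg_left (hT.upper _ hu0) hM.le
    have e2 := mul_le_mul_of_nonneg_right hMC (normSq_nonneg (u 0))
    have e3 := mul_le_mul_of_nonneg_right hC (neg_nonneg.2 hm0.le)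
    simp only [hE, Omega, abs_of_neg hm0]
    linarith
  have hexp (x a b : ℝ) (hx : x ≤ E 0 * Real.exp (-σ * a)) :
      x * Real.exp (-σ * (b - a)) ≤ E 0 * Real.exp (-σ * b) := by
    refine (mul_le_mul_of_nonneg_right hx (Real.exp_pos _).le).trans_eq ?_
    rw [mul_assoc, ← Real.exp_add]
    ring_nf
  have hevent (j : ℕ) (a : ℝ) (ha : t j = (a : EReal)) : E a ≤ E 0 * Real.exp (-σ * a) := by
    induction j generalizing a with
    | zero =>
      have : a = 0 := by
        rw [h.start] at ha
        exact_mod_cast ha.symm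
      simp [this]
    | succ j ih =>
      rcases hcases j with htop | ⟨b, hb, hmb, -⟩
      · rw [h.noMore j htop] at ha
        exact absurd ha.symm (EReal.coe_ne_top a)
      · have hba : b + dwellTime ε K P < a := by
          have := (h.exists_segment hlam hKc hη hξ hlamd h1 h2 h3 hκ₁ hκ₂ hκ₃ hb hmb).1
          rw [ha] at this
          exact_mod_cast this
        exact (hseg j b hb hmb a (by linarith) ha.ge).1.trans (hexp _ _ _ (ih b hb))
  rcases hs.eq_or_lt with rfl | hs
  · have hΩ : 0 ≤ Omega u m 0 := add_nonneg (normSq_nonneg _) (abs_nonneg _)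
    have := mul_le_mul_of_nonneg_right hC hΩ
    simpa using this
  · obtain ⟨j, hj, hjs⟩ : ∃ j, t j < (s : EReal) ∧ (s : EReal) ≤ t (j + 1) := by
      classical
      have hex : ∃ j, (s : EReal) ≤ t j := by
        obtain ⟨j, hj⟩ := exists_nat_gt (s / dwellTime ε K P)
        refine ⟨j, ?_⟩
        rcases hcases j with htop | ⟨a, ha, -, hja⟩
        · rw [htop]
          exact le_top
        · rw [ha, EReal.coe_le_coe_iff]
          rw [div_lt_iff₀ hτ] at hj
          linarith
      obtain ⟨j, hj⟩ : ∃ j, Nat.find hex = j + 1 := by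
        refine Nat.exists_eq_succ_of_ne_zero fun h0 => ?_
        have := Nat.find_spec hex
        rw [h0, h.start] at this
        exact absurd this (not_le.2 (by exact_mod_cast hs))
      exact ⟨j, not_le.1 (Nat.find_min hex (by omega)), hj ▸ Nat.find_spec hex⟩
    rcases hcases j with htop | ⟨a, ha, hma, -⟩
    · simp [htop] at hj
    · have has : a < s := by rw [ha] at hj; exact_mod_cast hj
      obtain ⟨e1, e2⟩ := hseg j a ha hma s has.le hjs
      refine (e2 has).trans (e1.trans ((hexp _ _ _ (hevent j a ha)).trans ?_))
      exact mul_le_mul_of_nonneg_right hE0 (Real.exp_pos _).le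

end IsClosedLoop

/-! ### Choice of the constants -/

lemma sigmaStar_le {ε L ι : ℝ} (hε : 0 < ε) (hL : 0 ≤ L) (hι : 0 ≤ ι) :
    sigmaStar ε L ι ≤ ε / 8 := by
  have ha : 0 ≤ kernelBound ε L := by rw [kernelBound]; positivity
  have h1 : 0 ≤ 4 * ι * (1 + (kernelBound ε L + ι) * Real.exp (kernelBound ε L + ι)) := by
    positivity
  have h2 : 0 ≤ ε * ι * (2 * (kernelBound ε L + ι) ^ 2
        * Real.exp (4 * L / ε * Real.exp (4 * L / ε) + 2 * ι) + 5 / 2) := by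
    positivity
  rw [sigmaStar]
  linarith

lemma one_le_overshoot (ε L ι : ℝ) : 1 ≤ overshoot ε L ι := by
  rw [overshoot]
  have h1 : 1 ≤ 1 + (ι + kernelBound ε L) ^ 2 := le_add_of_nonneg_right (sq_nonneg _)
  have h2 : 1 ≤ 1 + (kernelBound ε L + ι) ^ 2
      * Real.exp (4 * L / ε * Real.exp (4 * L / ε) + 2 * ι) :=
    le_add_of_nonneg_right (by positivity)
  exact one_le_mul_of_one_le_of_one_le h1 h2

theorem theorem3 (ε q L : ℝ) (hε : 0 < ε) (hq : q > L / (2 * ε) + 1 / 2) :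
    ∃ ιstar : ℝ, 0 < ιstar ∧
    ∀ lam : ℝ → ℝ, ContDiffOn ℝ 2 lam (Icc 0 1) → (∀ x ∈ Icc (0 : ℝ) 1, 0 ≤ lam x) →
      -- `L` is the maximum of `lam = |lam|` on `[0, 1]`
      IsGreatest (lam '' Icc 0 1) L →
    ∀ k : ℝ → ℝ → ℝ, IsBacksteppingKernel ε lam k →
    ∀ ι : ℝ, 0 < ι → ι < ιstar →
    ∀ kh : ℝ → ℝ → ℝ, IsKernelApprox lam k kh ι →
    ∀ K : ℝ → ℝ, K = controlGain ε q lam kh → ContDiffOn ℝ 2 K (Icc 0 1) →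
    ∃ κbar : ℝ, 0 < κbar ∧
    ∀ η ξ κ₁ κ₂ κ₃ : ℝ, 0 < η → 0 < ξ → 0 < κ₁ → 0 < κ₂ → 0 < κ₃ →
      κ₁ ≥ 2 * eps2 ε lam K / ξ → κ₂ ≥ 2 * eps3 ε q K / ξ → κ₃ ≥ 2 * eps4 ε K / ξ →
      -- no Zeno behaviour: the minimal dwell time
      (∀ lamd : ℝ, 0 < lamd →
        0 < dwellTime ε K ⟨η, ξ, κ₁, κ₂, κ₃, lamd⟩ ∧
        ∀ (t : ℕ → EReal) (u : ℝ → ℝ → ℝ) (m : ℝ → ℝ),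
          IsClosedLoop ε q lam K ⟨η, ξ, κ₁, κ₂, κ₃, lamd⟩ t u m →
          MemLp (u 0) 2 (volume.restrict (Icc (0 : ℝ) 1)) → m 0 < 0 →
          (∀ (j : ℕ) (a : ℝ), t j = (a : EReal) →
            ((a + dwellTime ε K ⟨η, ξ, κ₁, κ₂, κ₃, lamd⟩ : ℝ) : EReal) < t (j + 1)) ∧
          (∀ T : ℝ, ∃ j : ℕ, (T : EReal) < t j)) ∧
      -- exponential convergence
      (∃ lamdstar C : ℝ, 0 < lamdstar ∧ 0 < C ∧ ∀ lamd : ℝ, lamdstar ≤ lamd →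
        (∀ (t : ℕ → EReal) (u : ℝ → ℝ → ℝ) (m : ℝ → ℝ),
            IsClosedLoop ε q lam K ⟨η, ξ, κ₁, κ₂, κ₃, lamd⟩ t u m →
            MemLp (u 0) 2 (volume.restrict (Icc (0 : ℝ) 1)) → m 0 < 0 →
            ∀ s : ℝ, 0 ≤ s →
              Omega u m s ≤ C * Omega u m 0 * Real.exp (-(min η (sigmaStar ε L ι)) * s)) ∧
        (κ₁ ≤ κbar → κ₂ ≤ κbar → κ₃ ≤ κbar →
          ∀ (t : ℕ → EReal) (u : ℝ → ℝ → ℝ) (m : ℝ → ℝ),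
            IsClosedLoop ε q lam K ⟨η, ξ, κ₁, κ₂, κ₃, lamd⟩ t u m →
            MemLp (u 0) 2 (volume.restrict (Icc (0 : ℝ) 1)) → m 0 < 0 →
            ∀ s : ℝ, 0 ≤ s →
              Omega u m s ≤
                overshoot ε L ι * Omega u m 0
                  * Real.exp (-(min η (sigmaStar ε L ι)) * s))) := by
  rcases lt_or_ge L 0 with hL | hL0
  · -- a negative `L` is not the maximum of a nonnegative function
    refine ⟨1, one_pos, fun lam _ h0 hLmax => ?_⟩
    obtain ⟨x, hx, rfl⟩ := hLmax.1
    exact absurd (h0 x hx) (not_le.2 hL)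
  obtain ⟨n, A, B, c, ιs, hA, hB, hc, hιs, hAB, htrans⟩ := exists_isLyapunovTransform hε hL0 hq
  refine ⟨ιs, hιs, fun lam hlam2 h0 hLmax k hk ι hι hι' kh hkh K hK hKc => ?_⟩
  have hlam := hlam2.continuousOn
  have hT := htrans lam k kh ι hlam h0 (fun x hx => hLmax.2 (mem_image_of_mem _ hx)) hk hkh hι hι'
  have hkc := hk.contDiff.continuous
  have hση (η : ℝ) : min η (sigmaStar ε L ι) ≤ η := min_le_left _ _
  have hσε (η : ℝ) : min η (sigmaStar ε L ι) ≤ ε / 8 :=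
    (min_le_right _ _).trans (sigmaStar_le hε hL0 hι.le)
  refine ⟨2 * A * ε * c, by positivity, fun η ξ κ₁ κ₂ κ₃ hη hξ h1 h2 h3 hκ₁ hκ₂ hκ₃ =>
    ⟨fun lamd hlamd => ⟨dwellTime_pos hη hξ hlamd, fun t u m h hu0 hm0 => ?_⟩, ?_⟩⟩
  · have hcases := h.event_cases hlam hKc hη hξ hlamd h1 h2 h3 hκ₁ hκ₂ hκ₃ hm0
    refine ⟨fun j a ha => ?_, fun T => ?_⟩
    · rcases hcases j with htop | ⟨b, hb, hmb, -⟩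
      · rw [ha] at htop
        exact absurd htop (EReal.coe_ne_top a)
      · rw [ha, EReal.coe_eq_coe_iff] at hb
        exact (h.exists_segment hlam hKc hη hξ hlamd h1 h2 h3 hκ₁ hκ₂ hκ₃ ha (hb ▸ hmb)).1
    · have hτ : 0 < dwellTime ε K ⟨η, ξ, κ₁, κ₂, κ₃, lamd⟩ := dwellTime_pos hη hξ hlamd
      obtain ⟨j, hj⟩ := exists_nat_gt (T / dwellTime ε K ⟨η, ξ, κ₁, κ₂, κ₃, lamd⟩)
      refine ⟨j, ?_⟩
      rcases hcases j with htop | ⟨a, ha, -, hja⟩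
      · rw [htop]
        exact EReal.coe_lt_top T
      · rw [ha, EReal.coe_lt_coe_iff]
        rw [div_lt_iff₀ hτ] at hj
        linarith
  · -- a large weight `M` of the transformed state dominates any `κ₁`, `κ₂`, `κ₃`
    set M := A + (κ₁ + κ₂ + κ₃) / (2 * ε * c) with hM
    have hAM : A ≤ M := le_add_of_nonneg_right (by positivity)
    have hM0 : 0 < M := hA.trans_le hAM
    have hMκ : κ₁ + κ₂ + κ₃ ≤ 2 * M * ε * c := by
      have e : 2 * M * ε * c = 2 * A * ε * c + (κ₁ + κ₂ + κ₃) := by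
        rw [hM]
        field_simp
      have : 0 < 2 * A * ε * c := by positivity
      linarith
    refine ⟨50 * M * ε, M * B + 1, by positivity, by positivity, fun lamd hlamd => ?_⟩
    have hlamd0 : 0 < lamd := lt_of_lt_of_le (by positivity) hlamd
    refine ⟨fun t u m h hu0 hm0 s hs => ?_, fun hb₁ hb₂ hb₃ t u m h hu0 hm0 s hs => ?_⟩
    · exact h.omega_le hlam hKc hη hξ hlamd0 h1 h2 h3 hκ₁ hκ₂ hκ₃ hm0 hu0 hT hkc hK hM0 hAM
        (by linarith) (le_add_of_nonneg_left (by positivity)) (by linarith) (by linarith)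
        (by linarith) hlamd (hση η) (hσε η) hs
    · refine h.omega_le hlam hKc hη hξ hlamd0 h1 h2 h3 hκ₁ hκ₂ hκ₃ hm0 hu0 hT hkc hK hA le_rfl
        (hAB.trans (overshoot_ge hε hL0 hι.le)) (one_le_overshoot ε L ι) hb₁ hb₂ hb₃ ?_
        (hση η) (hσε η) hs
      refine le_trans ?_ hlamd
      gcongr
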